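/- **Conventions.** For a field $k$, a commutative graded $k$-algebra $Q=\bigoplus_{i\ge 0}Q_i$ and a $\mathbb Z$-graded $Q$-module $M$ (regarded as a $Q\otimes_k Q$-module via $(a\otimes a')m=aa'm$), $\mathrm{HH}^{n,s}(Q,M)$ denotes graded Hochschild cohomology, i.e. the $n$-th cohomology of the complex of graded linear maps $\underline{\mathrm{Hom}}_k(Q^{\otimes *},M[s])$, $M[s]_i=M_{i+s}$, with the Hochschild differential $$(\partial f)(a_1,\dots,a_{n+1})=a_1f(a_2,\dots,a_{n+1})+\sum_{i=1}^n(-1)^if(\dots,a_ia_{i+1},\dots)+(-1)^{n+1}f(a_1,\dots,a_n)a_{n+1}.$$ The algebra $Q$ *satisfies Kadeishvili's vanishing* if $\mathrm{HH}^{n,2-n}(Q,Q)=0$ for every $n\ge 3$. Let $V$ be an $\mathbb F_2$-vector space, and let $V_*$ be its *dual algebra*: $V_0=\mathbb F_2$, $V_1=V$, $V_j=0$ for $j\ge2$. For a Boolean ring $B$ let $B_*$ be its *Boolean graded algebra*: $B_0=\mathbb F_2$, $B_n=B$ for $n\ge1$, where the product $B_m\times B_n\to B_{m+n}$ for $m,n\geq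 1$ is the multiplication of $B$. The *connected sum* $V_*\sqcap B_*$ is the graded algebra with degree $0$ part $\mathbb F_2$ and degree $i$ part $V_i\oplus B_i$ for $i>0$, in which products of a positive degree element of $V_*$ and a positive degree element of $B_*$ are zero. For a (unital) subring $A\subseteq B$, the inclusion makes $V_*\sqcap B_*$ a graded $V_*\sqcap A_*$-module. **Theorem.** Let $V$ be an $\mathbb F_2$-vector space and let $B$ be a Boolean ring. 1. Let $A\subseteq B$ be an arbitrary (possibly infinite) subring with $|A|\ge 8$, and let $s<0$ be an integer. Then $$\mathrm{HH}^{k,s}(V_*\sqcap A_*,\,V_*\sqcap B_*)=0\qquad\text{for every } k\ge 0 \text{ with } k\ne 1-s.$$ 2. The algebra $V_*\sqcap B_*$ satisfies Kadeishvili's vanishing, i.e. $\mathrm{HH}^{n,2-n}(V_*\sqcap B_*,V_*\sqcap B_*)=0$ for every $n\ge 3$. -/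

import Mathlib

open scoped Cardinal

/-! ### Graded Hochschild cohomology (bar complex) -/

/-- Changing one entry of a tuple changes one entry of the tuple obtained from it by multiplying
two neighbouring entries, and it does so linearly. -/
theorem contractNth_update_exists {k Q : Type*} [CommRing k] [CommRing Q] [Algebra k Q] {n : ℕ}
    (j : Fin n) (a : Fin (n + 1) → Q) (p : Fin (n + 1)) :
    ∃ (q : Fin n) (L : Q →ₗ[k] Q), ∀ x : Q,
      Fin.contractNth j.castSucc (· * ·) (Function.update a p x) =
        Function.update (Fin.contractNth j.castSucc (· * ·) a) q (L x) := by
  rcases lt_trichotomy (p : ℕ) (j : ℕ) with h | h | h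
  · refine ⟨⟨p, by omega⟩, LinearMap.id, fun x => ?_⟩
    funext i
    by_cases hi : (i : ℕ) = p
    · obtain rfl : p = i.castSucc := Fin.ext (by simpa using hi.symm)
      have h1 : (i : ℕ) < j := by simpa using h
      have h2 : (⟨(i.castSucc : ℕ), by omega⟩ : Fin n) = i := rfl
      simp [Fin.contractNth, h1]
    · have h0 : i ≠ ⟨p, by omega⟩ := fun e => hi (by simp [e])
      have h1 : i.castSucc ≠ p := fun e => hi (by simp [← e])
      by_cases h2 : i.succ = p
      · have h3 : (i : ℕ) + 1 = p := by simp [← h2]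
        have h4 : (i : ℕ) < j := by omega
        simp [Fin.contractNth, h0, h1, h4]
      · simp [Fin.contractNth, h0, h1, h2]
  · refine ⟨j, LinearMap.mulRight k (a j.succ), fun x => ?_⟩
    have hp : p = j.castSucc := Fin.ext (by simpa using h)
    subst hp
    funext i
    by_cases hi : i = j
    · subst hi
      have h2 : i.succ ≠ i.castSucc := (Fin.castSucc_lt_succ).ne'
      simp [Fin.contractNth, h2]
    · have hi' : (i : ℕ) ≠ j := fun e => hi (Fin.ext e)
      have h1 : i.castSucc ≠ j.castSucc := fun e => hi (Fin.castSucc_injective _ e)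
      by_cases h3 : (i : ℕ) < j
      · simp [Fin.contractNth, hi, h3, h1]
      · have h2 : i.succ ≠ j.castSucc := fun e => by
          have := congrArg Fin.val e
          simp at this
          omega
        simp [Fin.contractNth, hi, hi', h3, h2]
  · obtain ⟨m, hm⟩ : ∃ m : Fin n, p = m.succ := ⟨⟨p - 1, by omega⟩, Fin.ext (by simp; omega)⟩
    subst hm
    have h' : (j : ℕ) ≤ m := by simp at h; omega
    by_cases hjm : j = m
    · subst hjm
      refine ⟨j, LinearMap.mulLeft k (a j.castSucc), fun x => ?_⟩
      funext i
      by_cases hi : i = j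
      · subst hi
        have h2 : i.castSucc ≠ i.succ := (Fin.castSucc_lt_succ).ne
        simp [Fin.contractNth, h2]
      · have hi' : (i : ℕ) ≠ j := fun e => hi (Fin.ext e)
        have h1 : i.succ ≠ j.succ := fun e => hi (Fin.succ_injective _ e)
        by_cases h3 : (i : ℕ) < j
        · have h2 : i.castSucc ≠ j.succ := fun e => by
            have := congrArg Fin.val e
            simp at this
            omega
          simp [Fin.contractNth, hi, h3, h2]
        · simp [Fin.contractNth, hi, hi', h3]
    · have hjm' : (j : ℕ) ≠ m := fun e => hjm (Fin.ext e)
      refine ⟨m, LinearMap.id, fun x => ?_⟩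
      funext i
      by_cases hi : i = m
      · subst hi
        have h3 : ¬ (i : ℕ) < j := by omega
        have h4 : (i : ℕ) ≠ j := by omega
        simp [Fin.contractNth, h3, h4]
      · have h1 : i.succ ≠ m.succ := fun e => hi (Fin.succ_injective _ e)
        by_cases h3 : (i : ℕ) ≤ j
        · have h2 : i.castSucc ≠ m.succ := fun e => by
            have := congrArg Fin.val e
            simp at this
            omega
          simp [Fin.contractNth, hi, h2]
        · have h5 : ¬ (i : ℕ) < j := by omega
          have h6 : (i : ℕ) ≠ j := by omega
          simp [Fin.contractNth, hi, h5, h6]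

/-- The value `(∂f)(a₀,…,aₙ)` of the Hochschild differential of `f : Q^{⊗ n} → M`. -/
def hochschildFun {k Q M : Type*} [CommRing k] [CommRing Q] [Algebra k Q] [AddCommGroup M]
    [Module k M] [Module Q M] {n : ℕ} (f : MultilinearMap k (fun _ : Fin n => Q) M)
    (a : Fin (n + 1) → Q) : M :=
  a 0 • f (fun i => a i.succ)
    + ∑ i : Fin n, (-1 : k) ^ ((i : ℕ) + 1) • f (Fin.contractNth i.castSucc (· * ·) a)
    + (-1 : k) ^ (n + 1) • (a (Fin.last n) • f (fun i => a i.castSucc))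

theorem hochschildFun_update {k Q M : Type*} [CommRing k] [CommRing Q] [Algebra k Q]
    [AddCommGroup M] [Module k M] [Module Q M] [IsScalarTower k Q M] {n : ℕ}
    (f : MultilinearMap k (fun _ : Fin n => Q) M) (a : Fin (n + 1) → Q) (p : Fin (n + 1)) :
    ∃ T : Q →ₗ[k] M, ∀ x : Q, hochschildFun f (Function.update a p x) = T x := by
  have h1 : ∃ T : Q →ₗ[k] M, ∀ x : Q,
      Function.update a p x 0 • f (fun i => Function.update a p x i.succ) = T x := by
    refine Fin.cases ?_ (fun q => ?_) p
    · exact ⟨(LinearMap.toSpanSingleton Q M (f fun i => a i.succ)).restrictScalars k,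
        fun x => by simp⟩
    · refine ⟨(LinearMap.lsmul Q M (a 0)).restrictScalars k ∘ₗ
        f.toLinearMap (fun i => a i.succ) q, fun x => ?_⟩
      have : (fun i : Fin n => Function.update a q.succ x i.succ) =
          Function.update (fun i : Fin n => a i.succ) q x :=
        Function.update_comp_eq_of_injective a (Fin.succ_injective n) q x
      simp [this, Function.update_of_ne (Fin.succ_ne_zero q).symm]
  have h2 : ∀ i : Fin n, ∃ T : Q →ₗ[k] M, ∀ x : Q,
      f (Fin.contractNth i.castSucc (· * ·) (Function.update a p x)) = T x := by
    intro i
    obtain ⟨q, L, h⟩ := contractNth_update_exists (k := k) i a p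
    exact ⟨f.toLinearMap (Fin.contractNth i.castSucc (· * ·) a) q ∘ₗ L, fun x => by simp [h]⟩
  have h3 : ∃ T : Q →ₗ[k] M, ∀ x : Q, Function.update a p x (Fin.last n) •
      f (fun i => Function.update a p x i.castSucc) = T x := by
    refine Fin.lastCases ?_ (fun q => ?_) p
    · exact ⟨(LinearMap.toSpanSingleton Q M (f fun i => a i.castSucc)).restrictScalars k,
        fun x => by simp⟩
    · refine ⟨(LinearMap.lsmul Q M (a (Fin.last n))).restrictScalars k ∘ₗ
        f.toLinearMap (fun i => a i.castSucc) q, fun x => ?_⟩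
      have : (fun i : Fin n => Function.update a q.castSucc x i.castSucc) =
          Function.update (fun i : Fin n => a i.castSucc) q x :=
        Function.update_comp_eq_of_injective a (Fin.castSucc_injective n) q x
      simp [this, Function.update_of_ne (Fin.castSucc_lt_last q).ne']
  obtain ⟨T1, h1⟩ := h1
  choose T2 h2 using h2
  obtain ⟨T3, h3⟩ := h3
  exact ⟨T1 + ∑ i : Fin n, (-1 : k) ^ ((i : ℕ) + 1) • T2 i + (-1 : k) ^ (n + 1) • T3,
    fun x => by simp only [hochschildFun, h1, h2, h3, LinearMap.add_apply, LinearMap.sum_apply,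
      LinearMap.smul_apply]⟩

/-- The Hochschild differential
`(∂f)(a₀,…,aₙ) = a₀ f(a₁,…,aₙ) + ∑_{0 ≤ i < n} (-1)^(i+1) f(a₀,…,aᵢaᵢ₊₁,…,aₙ)
  + (-1)^(n+1) f(a₀,…,aₙ₋₁) aₙ`
from `n`-cochains to `(n+1)`-cochains, for a commutative `k`-algebra `Q` and a `Q`-module `M`,
regarded as a `Q ⊗ Q`-module by `(a ⊗ a') m = a a' m`. A linear map `Q^{⊗ n} → M` is given as a
`k`-multilinear map in `n` variables. -/
def hochschildD (k Q M : Type*) [CommRing k] [CommRing Q] [Algebra k Q] [AddCommGroup M]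
    [Module k M] [Module Q M] [IsScalarTower k Q M] (n : ℕ) :
    MultilinearMap k (fun _ : Fin n => Q) M →ₗ[k]
      MultilinearMap k (fun _ : Fin (n + 1) => Q) M where
  toFun f :=
    { toFun := hochschildFun f
      map_update_add' := by
        intro inst a p x y
        rw [Subsingleton.elim inst (instDecidableEqFin (n + 1))]
        obtain ⟨T, hT⟩ := hochschildFun_update f a p
        simp only [hT, map_add]
      map_update_smul' := by
        intro inst a p c x
        rw [Subsingleton.elim inst (instDecidableEqFin (n + 1))]
        obtain ⟨T, hT⟩ := hochschildFun_update f a p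
        simp only [hT, map_smul] }
  map_add' f g := by
    ext a
    simp only [hochschildFun, MultilinearMap.coe_mk, add_apply, smul_add,
      Finset.sum_add_distrib]
    abel
  map_smul' c f := by
    ext a
    have h : ∀ (q : Q) (m : M), q • c • m = c • q • m := fun q m => by
      rw [← algebraMap_smul Q c m, ← algebraMap_smul Q c (q • m), smul_comm]
    simp only [hochschildFun, MultilinearMap.coe_mk, smul_apply, smul_add,
      Finset.smul_sum, h, smul_comm _ c, RingHom.id_apply]

/-- The `n`-cochains of internal degree `s`: the graded linear maps `Q^{⊗ n} → M[s]`, where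
`M[s]ᵢ = M_{i+s}` and `a₁ ⊗ ⋯ ⊗ aₙ` has degree `|a₁| + ⋯ + |aₙ|`. -/
def gradedCochains {k Q M : Type*} [CommRing k] [CommRing Q] [Algebra k Q] [AddCommGroup M]
    [Module k M] (𝒬 : ℕ → Submodule k Q) (ℳ : ℤ → Submodule k M) (n : ℕ) (s : ℤ) :
    Submodule k (MultilinearMap k (fun _ : Fin n => Q) M) where
  carrier := {f | ∀ (d : Fin n → ℕ) (a : Fin n → Q), (∀ i, a i ∈ 𝒬 (d i)) →
    f a ∈ ℳ ((∑ i, (d i : ℤ)) + s)}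
  add_mem' hf hg d a h := add_mem (hf d a h) (hg d a h)
  zero_mem' _ _ _ := zero_mem _
  smul_mem' c _ hf d a h := Submodule.smul_mem _ c (hf d a h)

/-- Cocycles among the `n`-cochains of internal degree `s`. -/
def hochschildCocycles {k Q M : Type*} [CommRing k] [CommRing Q] [Algebra k Q] [AddCommGroup M]
    [Module k M] [Module Q M] [IsScalarTower k Q M] (𝒬 : ℕ → Submodule k Q)
    (ℳ : ℤ → Submodule k M) (n : ℕ) (s : ℤ) :
    Submodule k (MultilinearMap k (fun _ : Fin n => Q) M) :=
  gradedCochains 𝒬 ℳ n s ⊓ LinearMap.ker (hochschildD k Q M n)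

/-- Coboundaries of cochains of internal degree `s`. -/
def hochschildCoboundaries {k Q M : Type*} [CommRing k] [CommRing Q] [Algebra k Q]
    [AddCommGroup M] [Module k M] [Module Q M] [IsScalarTower k Q M] (𝒬 : ℕ → Submodule k Q)
    (ℳ : ℤ → Submodule k M) :
    (n : ℕ) → (s : ℤ) → Submodule k (MultilinearMap k (fun _ : Fin n => Q) M)
  | 0, _ => ⊥
  | n + 1, s => (gradedCochains 𝒬 ℳ n s).map (hochschildD k Q M n)

/-- The graded Hochschild cohomology group `HH^{n,s}(Q, M)` of a commutative graded `k`-algebra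
`Q = ⨁_{i ≥ 0} 𝒬 i` with coefficients in a graded `Q`-module `M = ⨁_{i ∈ ℤ} ℳ i`: the `n`-th
cohomology of the complex of graded linear maps `Q^{⊗ *} → M[s]`. -/
abbrev GradedHH {k Q M : Type*} [CommRing k] [CommRing Q] [Algebra k Q] [AddCommGroup M]
    [Module k M] [Module Q M] [IsScalarTower k Q M] (𝒬 : ℕ → Submodule k Q)
    (ℳ : ℤ → Submodule k M) (n : ℕ) (s : ℤ) : Type _ :=
  hochschildCocycles 𝒬 ℳ n s ⧸
    (hochschildCoboundaries 𝒬 ℳ n s).comap (hochschildCocycles 𝒬 ℳ n s).subtype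

/-- A grading by `ℕ` regarded as a grading by `ℤ` which is zero in negative degrees. -/
def intGrading {k M : Type*} [CommRing k] [AddCommGroup M] [Module k M]
    (ℳ : ℕ → Submodule k M) : ℤ → Submodule k M
  | Int.ofNat i => ℳ i
  | Int.negSucc _ => ⊥

/-- Kadeishvili's vanishing for a commutative graded algebra `Q`:
`HH^{n,2-n}(Q, Q) = 0` for every `n ≥ 3`. -/
def KadeishviliVanishing {k Q : Type*} [CommRing k] [CommRing Q] [Algebra k Q]
    (𝒬 : ℕ → Submodule k Q) : Prop :=
  ∀ n : ℕ, 3 ≤ n → Subsingleton (GradedHH 𝒬 (intGrading 𝒬) n (2 - (n : ℤ)))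

/-! ### Connected graded algebras and connected sums

A graded `k`-algebra `A = ⨁_{i ≥ 0} Aᵢ` with `A₀ = k` is the unitization `k ⊕ A₊` of its positive
part `A₊ = ⨁_{i > 0} Aᵢ`, a non-unital algebra graded by the positive integers. -/

/-- The grading of the unitization `k ⊕ P` of a positively graded algebra `P`: it is `k` in degree
zero and `gr n` in degree `n > 0`. -/
def unitizationGrading {k P : Type*} [CommRing k] [AddCommGroup P] [Module k P]
    (gr : ℕ+ → Submodule k P) : ℕ → Submodule k (Unitization k P)
  | 0 =>
    { carrier := {x | x.snd = 0}
      add_mem' := fun {x y} hx hy => by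
        simp only [Set.mem_ofPred_eq] at hx hy ⊢
        rw [Unitization.snd_add, hx, hy, add_zero]
      zero_mem' := Unitization.snd_zero
      smul_mem' := fun c x hx => by
        simp only [Set.mem_ofPred_eq] at hx ⊢
        rw [Unitization.snd_smul, hx, smul_zero] }
  | n + 1 =>
    { carrier := {x | x.fst = 0 ∧ x.snd ∈ gr n.succPNat}
      add_mem' := fun {x y} hx hy =>
        ⟨by rw [Unitization.fst_add, hx.1, hy.1, add_zero], by
          rw [Unitization.snd_add]; exact add_mem hx.2 hy.2⟩
      zero_mem' := ⟨Unitization.fst_zero, by rw [Unitization.snd_zero]; exact zero_mem _⟩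
      smul_mem' := fun c x hx =>
        ⟨by rw [Unitization.fst_smul, hx.1, smul_zero], by
          rw [Unitization.snd_smul]; exact Submodule.smul_mem _ c hx.2⟩ }

/-- The connected sum `A ⊓ A'` of the connected graded algebras `A = k ⊕ P` and `A' = k ⊕ P'`:
it is `k` in degree zero, its positive part is `P × P'`, and `P P' = P' P = 0`. -/
abbrev ConnectedSum (k P P' : Type*) : Type _ := Unitization k (P × P')

/-- The grading of the connected sum: `(A ⊓ A')ₙ = Aₙ ⊕ A'ₙ` for `n > 0`. -/
def connectedSumGrading {k P P' : Type*} [CommRing k] [AddCommGroup P] [Module k P]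
    [AddCommGroup P'] [Module k P'] (gr : ℕ+ → Submodule k P) (gr' : ℕ+ → Submodule k P') :
    ℕ → Submodule k (ConnectedSum k P P') :=
  unitizationGrading fun n => (gr n).prod (gr' n)

/-! ### Dual algebras -/

/-- The positive part of the dual algebra `V_* = 𝔽₂ ⊕ V`: the vector space `V`, placed in degree
one, with zero multiplication. -/
def DualPart (V : Type*) : Type _ := V

instance DualPart.instAddCommGroup (V : Type*) [AddCommGroup V] : AddCommGroup (DualPart V) :=
  inferInstanceAs (AddCommGroup V)

instance DualPart.instNonUnitalCommRing (V : Type*) [AddCommGroup V] :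
    NonUnitalCommRing (DualPart V) where
  __ := DualPart.instAddCommGroup V
  mul _ _ := (0 : V)
  left_distrib _ _ _ := (add_zero (0 : V)).symm
  right_distrib _ _ _ := (add_zero (0 : V)).symm
  zero_mul _ := rfl
  mul_zero _ := rfl
  mul_assoc _ _ _ := rfl
  mul_comm _ _ := rfl

instance DualPart.instModule (V : Type*) [AddCommGroup V] [Module (ZMod 2) V] :
    Module (ZMod 2) (DualPart V) :=
  inferInstanceAs (Module (ZMod 2) V)

instance DualPart.instIsScalarTower (V : Type*) [AddCommGroup V] [Module (ZMod 2) V] :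
    IsScalarTower (ZMod 2) (DualPart V) (DualPart V) where
  smul_assoc c _ _ := (smul_zero c : c • (0 : V) = 0).symm

instance DualPart.instSMulCommClass (V : Type*) [AddCommGroup V] [Module (ZMod 2) V] :
    SMulCommClass (ZMod 2) (DualPart V) (DualPart V) where
  smul_comm c _ _ := (smul_zero c : c • (0 : V) = 0)

/-- `V` sits in degree one. -/
def dualPartGrading (V : Type*) [AddCommGroup V] [Module (ZMod 2) V] (n : ℕ+) :
    Submodule (ZMod 2) (DualPart V) :=
  if n = 1 then ⊤ else ⊥

/-! ### Boolean graded algebras -/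

instance Subring.instBooleanRing {B : Type*} [BooleanRing B] (A : Subring B) : BooleanRing A where
  isIdempotentElem a := Subtype.ext (BooleanRing.isIdempotentElem (a : B))

/-- The positive part `⨁_{n > 0} Bₙ`, `Bₙ = B`, of the Boolean graded algebra `B_*`: finite formal
sums of `b ∈ Bₙ`, where the product of `b ∈ Bₘ` and `b' ∈ Bₙ` is `b b' ∈ Bₘ₊ₙ`. -/
def BooleanPart (B : Type*) [BooleanRing B] : Type _ := AddMonoidAlgebra B ℕ+

namespace BooleanPart

noncomputable instance instNonUnitalCommRing (B : Type*) [BooleanRing B] :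
    NonUnitalCommRing (BooleanPart B) :=
  inferInstanceAs (NonUnitalCommRing (AddMonoidAlgebra B ℕ+))

/-- The component in degree `n`. -/
def coeff {B : Type*} [BooleanRing B] (p : BooleanPart B) (n : ℕ+) : B :=
  AddMonoidAlgebra.coeff p n

theorem coeff_zero {B : Type*} [BooleanRing B] (n : ℕ+) : coeff (0 : BooleanPart B) n = 0 := rfl

theorem coeff_add {B : Type*} [BooleanRing B] (p q : BooleanPart B) (n : ℕ+) :
    coeff (p + q) n = coeff p n + coeff q n := rfl

theorem two_nsmul_eq_zero {B : Type*} [BooleanRing B] (p : BooleanPart B) : 2 • p = 0 := by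
  rw [two_nsmul]
  apply AddMonoidAlgebra.coeff_injective
  ext n
  exact BooleanRing.add_self (coeff p n)

/-- The structure of an `𝔽₂`-vector space (there is only one). -/
noncomputable instance instModule (B : Type*) [BooleanRing B] : Module (ZMod 2) (BooleanPart B) :=
  AddCommGroup.zmodModule two_nsmul_eq_zero

instance instIsScalarTower (B : Type*) [BooleanRing B] :
    IsScalarTower (ZMod 2) (BooleanPart B) (BooleanPart B) where
  smul_assoc c p q := ZMod.map_smul (AddMonoidHom.mulRight q) c p

instance instSMulCommClass (B : Type*) [BooleanRing B] :
    SMulCommClass (ZMod 2) (BooleanPart B) (BooleanPart B) where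
  smul_comm c p q := (ZMod.map_smul (AddMonoidHom.mulLeft p) c q).symm

/-- `Bₙ` sits in degree `n`. -/
noncomputable def grading (B : Type*) [BooleanRing B] (n : ℕ+) : Submodule (ZMod 2) (BooleanPart B) :=
  AddSubgroup.toZModSubmodule 2
    { carrier := {p | ∀ m, m ≠ n → coeff p m = 0}
      add_mem' := fun {p q} hp hq m hm => by rw [coeff_add, hp m hm, hq m hm, add_zero]
      zero_mem' := fun m _ => coeff_zero m
      neg_mem' := fun {p} hp m hm => by
        change -(coeff p m) = 0
        rw [hp m hm, neg_zero] }

/-- The map `⨁ Aₙ → ⨁ Bₙ` induced by a ring homomorphism `A → B`. -/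
noncomputable def map {A B : Type*} [BooleanRing A] [BooleanRing B] (φ : A →+* B) :
    BooleanPart A →ₙₐ[ZMod 2] BooleanPart B where
  toFun p := AddMonoidAlgebra.map (φ : A →+ B) p
  map_zero' := AddMonoidAlgebra.map_zero _
  map_add' := AddMonoidAlgebra.map_add _
  map_mul' := AddMonoidAlgebra.map_mul φ
  map_smul' c p := ZMod.map_smul
    (⟨⟨AddMonoidAlgebra.map (φ : A →+ B), AddMonoidAlgebra.map_zero _⟩,
      AddMonoidAlgebra.map_add _⟩ : BooleanPart A →+ BooleanPart B) c p

end BooleanPart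

/-! ### The algebra `V_* ⊓ B_*` -/

/-- The connected sum `V_* ⊓ B_*` of the dual algebra of `V` and the Boolean graded algebra of
`B`. -/
abbrev DualBoolean (V B : Type*) [AddCommGroup V] [Module (ZMod 2) V] [BooleanRing B] : Type _ :=
  ConnectedSum (ZMod 2) (DualPart V) (BooleanPart B)

namespace DualBoolean

/-- The grading of `V_* ⊓ B_*`. -/
noncomputable def grading (V B : Type*) [AddCommGroup V] [Module (ZMod 2) V] [BooleanRing B] :
    ℕ → Submodule (ZMod 2) (DualBoolean V B) :=
  connectedSumGrading (dualPartGrading V) (BooleanPart.grading B)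

/-- The map `V_* ⊓ A_* → V_* ⊓ B_*` induced by a homomorphism `A → B` of Boolean rings. -/
noncomputable def map (V : Type*) {A B : Type*} [AddCommGroup V] [Module (ZMod 2) V]
    [BooleanRing A] [BooleanRing B] (φ : A →+* B) :
    DualBoolean V A →ₐ[ZMod 2] DualBoolean V B :=
  Unitization.lift ((Unitization.inrNonUnitalAlgHom (ZMod 2) (DualPart V × BooleanPart B)).comp
    ((NonUnitalAlgHom.fst (ZMod 2) (DualPart V) (BooleanPart A)).prod
      ((BooleanPart.map φ).comp (NonUnitalAlgHom.snd (ZMod 2) (DualPart V) (BooleanPart A)))))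

/-- For a subring `A ⊆ B`, the inclusion makes `V_* ⊓ B_*` a `V_* ⊓ A_*`-algebra, in particular a
`V_* ⊓ A_*`-module. -/
noncomputable instance instAlgebra (V : Type*) {B : Type*} [AddCommGroup V] [Module (ZMod 2) V]
    [BooleanRing B] (A : Subring B) : Algebra (DualBoolean V A) (DualBoolean V B) :=
  (map V A.subtype).toRingHom.toAlgebra

instance instIsScalarTower (V : Type*) {B : Type*} [AddCommGroup V] [Module (ZMod 2) V]
    [BooleanRing B] (A : Subring B) :
    IsScalarTower (ZMod 2) (DualBoolean V A) (DualBoolean V B) :=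
  IsScalarTower.of_algebraMap_eq fun c => ((map V A.subtype).commutes c).symm

end DualBoolean

/-!
Write `P` for the positive part of `Q = V_* ⊓ A_*`, and `M = V_* ⊓ B_*`. Subtracting
coboundaries one argument at a time makes a cocycle normalized (`exists_normalization`), that
is, a function on powers of `P`. If `S` is a commutative ring on which `P` acts by a character
`ε`, cochains with values in an `S`-module are the `S`-linear forms on the bar complex of `P`
with coefficients in `S`, here realized as the free module `BarWords` on the words in a
homogeneous basis of `P`. Where this complex of free modules is exact, it has contractions
(`BarWords.exists_contraction`), and so all cocycles on it are coboundaries. After that a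
cochain is made homogeneous by projecting its values (`BarWords.exists_hochschildD_eq`). There
are two cases.

If `k + s ≥ 2`, a normalized cocycle takes its values in degrees at least two, where `M` agrees
with `B`, and one may replace `M` by `B`, on which `v ∈ V` acts as zero and `a tⁿ` (`a ∈ A` in
degree `n`) as `a`. With these coefficients the bar complex is exact in lengths at least two
(`BarWords.bar_character_exact`). Indeed prefixing `t` to words is a homotopy between zero and
`μ_t + 1`, up to the coefficient action of the first letter, where `μ_t` multiplies the first
letter by `t`; prefixing the elements `a t` and `(1 + a) t`, weighted by their images in `B`,
removes that coefficient action; and `μ_t + 1` is injective, because `μ_t` raises the degree of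
the first letter. In the lowest lengths the complex is not exact; the derivation `a tⁿ ↦ n a`
accounts for what is left, and this is enough to start the contraction
(`BarWords.exists_bar_eq_add`, `BarWords.exists_comp_bar_character`). This case contains
Kadeishvili's vanishing, where `k + s = 2`, and does not need any condition on the size of `A`.

If `k + s ≤ 0`, a cocycle vanishes on words of weight (total degree) less than `-s`, as its
values would have negative degree. Filter the bar complex with coefficients in `Q` by weight. On
the associated graded complex `P` acts trivially on the coefficients, and its homology is
concentrated in words of weight equal to the length (`BarWords.exists_barEnd_zero_eq`, by
dividing a first letter by `t`): this is the Koszul property of `Q`. So the cocycle is a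
coboundary (`BarWords.exists_comp_bar_of_weight`), unless `k = -s`, when it is also necessary
that it vanishes on the Koszul cycles of weight `k`, on which its values are in degree zero. For
this three nonzero orthogonal idempotents `e` of `A` with sum `1` are used; they exist as `A`
has at least eight elements (`exists_orthogonal`). They and `V` split a cycle according to its
first and last letters, and for each part some `e t` annihilates both of these letters.
Prefixing `e t` to that part gives a combination of words whose boundary, multiplied by `e t`,
is the part multiplied by `(e t)²`, so that `(e t)²` annihilates the value of the cocycle on it.
Being a multiple of `1`, this value is zero (`BarWords.eq_zero_of_orthogonal`).

When `k + s = 1` and `k > 0` neither argument applies, and this is the excluded case; for `k =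
0` there are no nonzero cochains of negative degree.
-/

set_option linter.unusedSectionVars false

/-! ### The bar complex on words in a basis -/

/-- The free `S`-module on the words in the alphabet `ι`. When `ι` indexes a basis of a
non-unital algebra `P` over `𝔽₂`, this is `S ⊗ ⨁ₙ P^{⊗ n}`, the word `[i₁, …, iₙ]` standing for
`β i₁ ⊗ ⋯ ⊗ β iₙ`. -/
abbrev BarWords (ι S : Type*) [CommRing S] : Type _ := List ι →₀ S

namespace BarWords

variable {P ι S : Type*} [NonUnitalCommRing P] [Module (ZMod 2) P] [IsScalarTower (ZMod 2) P P]
  [SMulCommClass (ZMod 2) P P] [CommRing S] [Algebra (ZMod 2) S]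

section Operators

variable (S) (β : Module.Basis ι (ZMod 2) P)

/-- Tensoring with `p ∈ P` on the left. -/
noncomputable def cons : P →ₗ[ZMod 2] (BarWords ι S →ₗ[S] BarWords ι S) :=
  β.constr (ZMod 2) fun i => Finsupp.lmapDomain S S (List.cons i)

theorem cons_basis_single (i : ι) (w : List ι) (s : S) :
    cons S β (β i) (Finsupp.single w s) = Finsupp.single (i :: w) s := by
  simp [cons, Module.Basis.constr_basis]

variable {S}

/-- Linear maps out of `BarWords` are determined by their values on the empty word and on words
with a separated first letter. -/
theorem linearMap_ext {M : Type*} [AddCommMonoid M] [Module S M] {f g : BarWords ι S →ₗ[S] M}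
    (h0 : f (Finsupp.single [] 1) = g (Finsupp.single [] 1))
    (h1 : ∀ i w, f (cons S β (β i) (Finsupp.single w 1)) =
      g (cons S β (β i) (Finsupp.single w 1))) : f = g := by
  refine Finsupp.lhom_ext' fun w => LinearMap.ext_ring ?_
  cases w with
  | nil => exact h0
  | cons i w => simpa [cons_basis_single] using h1 i w

/-- An identity between the values of linear maps on `cons p w` can be checked for `p` in the
basis and `w` a word. -/
theorem cons_ext {M : Type*} [AddCommGroup M] [Module (ZMod 2) M] [Module S M]
    [IsScalarTower (ZMod 2) S M]
    {f g : P →ₗ[ZMod 2] (BarWords ι S →ₗ[S] M)}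
    (h : ∀ i w, f (β i) (Finsupp.single w 1) = g (β i) (Finsupp.single w 1)) : f = g :=
  β.ext fun i => Finsupp.lhom_ext' fun w => LinearMap.ext_ring (h i w)

variable (ε : P →ₙₐ[ZMod 2] S)

/-- The value on a word of the multiplication of its first letter by `p ∈ P`; on the empty word
`p` acts on the coefficients. -/
noncomputable def mulHeadWord : List ι → (P →ₗ[ZMod 2] BarWords ι S)
  | [] => (Finsupp.lsingle [] : S →ₗ[ZMod 2] BarWords ι S) ∘ₗ (ε : P →ₗ[ZMod 2] S)
  | i :: w => ((cons S β).flip (Finsupp.single w 1)) ∘ₗ LinearMap.mulRight (ZMod 2) (β i)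

/-- Multiplication of the first letter by `p ∈ P`. -/
noncomputable def mulHead : P →ₗ[ZMod 2] (BarWords ι S →ₗ[S] BarWords ι S) where
  toFun p := Finsupp.linearCombination S fun w => mulHeadWord β ε w p
  map_add' p q := by
    refine Finsupp.lhom_ext' fun w => LinearMap.ext_ring ?_
    simp
  map_smul' c p := by
    refine Finsupp.lhom_ext' fun w => LinearMap.ext_ring ?_
    simp

@[simp]
theorem mulHead_nil (p : P) :
    mulHead β ε p (Finsupp.single [] 1) = Finsupp.single [] (ε p) := by
  simp [mulHead, mulHeadWord]

@[simp]
theorem mulHead_cons (p q : P) (w : BarWords ι S) :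
    mulHead β ε p (cons S β q w) = cons S β (p * q) w := by
  have : (LinearMap.llcomp S _ _ _ (mulHead β ε p)).restrictScalars (ZMod 2) ∘ₗ cons S β =
      cons S β ∘ₗ LinearMap.mulLeft (ZMod 2) p := by
    refine cons_ext β fun i w => ?_
    simp only [LinearMap.comp_apply, LinearMap.restrictScalars_apply, LinearMap.llcomp_apply,
      LinearMap.mulLeft_apply]
    rw [cons_basis_single]
    simp [mulHead, mulHeadWord]
  exact LinearMap.congr_fun (LinearMap.congr_fun this q) w

/-- The value on a word of `barEnd`. -/
noncomputable def barEndWord : List ι → BarWords ι S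
  | [] => 0
  | i :: w => mulHead β ε (β i) (Finsupp.single w 1) + cons S β (β i) (barEndWord w)

/-- The part of the bar differential consisting of the products of neighbouring letters and of the
action of the last letter on the coefficients. -/
noncomputable def barEnd : BarWords ι S →ₗ[S] BarWords ι S :=
  Finsupp.linearCombination S (barEndWord β ε)

@[simp]
theorem barEnd_nil (s : S) : barEnd β ε (Finsupp.single [] s) = 0 := by
  simp [barEnd, barEndWord]

@[simp]
theorem barEnd_cons (p : P) (w : BarWords ι S) :
    barEnd β ε (cons S β p w) = mulHead β ε p w + cons S β p (barEnd β ε w) := by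
  have : (LinearMap.llcomp S _ _ _ (barEnd β ε)).restrictScalars (ZMod 2) ∘ₗ cons S β =
      mulHead β ε + (LinearMap.lcomp S _ (barEnd β ε)).restrictScalars (ZMod 2) ∘ₗ
        cons S β := by
    refine cons_ext β fun i w => ?_
    simp only [LinearMap.comp_apply, LinearMap.restrictScalars_apply, LinearMap.llcomp_apply,
      LinearMap.add_apply, LinearMap.lcomp_apply]
    rw [cons_basis_single]
    simp [barEnd, barEndWord]
  exact LinearMap.congr_fun (LinearMap.congr_fun this p) w

/-- The part of the bar differential in which the first letter acts on the coefficients. -/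
noncomputable def barStart : BarWords ι S →ₗ[S] BarWords ι S :=
  Finsupp.linearCombination S fun w => match w with
    | [] => 0
    | i :: w => Finsupp.single w (ε (β i))

@[simp]
theorem barStart_nil (s : S) : barStart β ε (Finsupp.single [] s) = 0 := by
  simp [barStart]

@[simp]
theorem barStart_cons (p : P) (w : BarWords ι S) :
    barStart β ε (cons S β p w) = ε p • w := by
  have : (LinearMap.llcomp S _ _ _ (barStart β ε)).restrictScalars (ZMod 2) ∘ₗ cons S β =
      (LinearMap.lsmul S (BarWords ι S)).restrictScalars (ZMod 2) ∘ₗ (ε : P →ₗ[ZMod 2] S) := by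
    refine cons_ext β fun i w => ?_
    simp only [LinearMap.comp_apply, LinearMap.restrictScalars_apply, LinearMap.llcomp_apply]
    rw [cons_basis_single]
    simp [barStart]
  exact LinearMap.congr_fun (LinearMap.congr_fun this p) w

/-- The differential of the bar complex of `P` with coefficients in `S`, on which `P` acts on both
sides through `ε`. -/
noncomputable def bar : BarWords ι S →ₗ[S] BarWords ι S := barEnd β ε + barStart β ε

theorem bar_apply (w : BarWords ι S) : bar β ε w = barEnd β ε w + barStart β ε w := rfl

theorem bar_cons (p : P) (w : BarWords ι S) :
    bar β ε (cons S β p w) = mulHead β ε p w + cons S β p (barEnd β ε w) + ε p • w := by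
  simp [bar_apply]

theorem mulHead_mul (p q : P) (w : BarWords ι S) :
    mulHead β ε (p * q) w = mulHead β ε p (mulHead β ε q w) := by
  have : mulHead β ε (p * q) = mulHead β ε p ∘ₗ mulHead β ε q := by
    refine linearMap_ext β ?_ fun i w => ?_
    · have h : ∀ s : S, Finsupp.single ([] : List ι) s = s • Finsupp.single [] 1 := by simp
      simp only [mulHead_nil, map_mul, LinearMap.comp_apply]
      rw [h (ε q), map_smul, mulHead_nil]
      simp [mul_comm]
    · simp [mul_assoc]
  exact LinearMap.congr_fun this w

theorem mulHead_comm (p q : P) (w : BarWords ι S) :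
    mulHead β ε p (mulHead β ε q w) = mulHead β ε q (mulHead β ε p w) := by
  rw [← mulHead_mul, ← mulHead_mul, mul_comm]

theorem barEnd_mulHead (p : P) (w : BarWords ι S) :
    barEnd β ε (mulHead β ε p w) = mulHead β ε p (barEnd β ε w) := by
  have : barEnd β ε ∘ₗ mulHead β ε p = mulHead β ε p ∘ₗ barEnd β ε := by
    refine linearMap_ext β ?_ fun i w => ?_
    · simp
    · simp [mulHead_mul]
  exact LinearMap.congr_fun this w

theorem barStart_mulHead (p : P) (w : BarWords ι S) :
    barStart β ε (mulHead β ε p w) = ε p • barStart β ε w := by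
  have : barStart β ε ∘ₗ mulHead β ε p = ε p • barStart β ε := by
    refine linearMap_ext β ?_ fun i w => ?_
    · simp
    · simp [mul_smul]
  exact LinearMap.congr_fun this w

theorem barEnd_barEnd (w : BarWords ι S) : barEnd β ε (barEnd β ε w) = 0 := by
  have : barEnd β ε ∘ₗ barEnd β ε = 0 := by
    refine Finsupp.lhom_ext' fun w => LinearMap.ext_ring ?_
    simp only [LinearMap.comp_apply, Finsupp.lsingle_apply, LinearMap.zero_apply]
    induction w with
    | nil => simp
    | cons i w ih =>
      rw [← cons_basis_single (S := S) β, barEnd_cons, map_add, barEnd_mulHead, barEnd_cons, ih,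
        map_zero, add_zero, ZModModule.add_self]
  exact LinearMap.congr_fun this w

theorem bar_bar (w : BarWords ι S) : bar β ε (bar β ε w) = 0 := by
  have : bar β ε ∘ₗ bar β ε = 0 := by
    refine linearMap_ext β ?_ fun i w => ?_
    · simp [bar_apply]
    · simp only [LinearMap.comp_apply, LinearMap.zero_apply]
      rw [bar_cons, map_add, map_add, map_smul, bar_cons, bar_apply, bar_apply, barEnd_mulHead,
        barStart_mulHead, barEnd_barEnd, map_zero, smul_add]
      generalize mulHead β ε (β i) _ = x
      generalize ε (β i) • barStart β ε _ = y
      generalize ε (β i) • barEnd β ε _ = z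
      have h : x + y + (x + 0 + z) + (z + y) = (x + x) + (y + y) + (z + z) := by abel
      rw [h]
      simp only [ZModModule.add_self]
  exact LinearMap.congr_fun this w

end Operators

end BarWords

section ContractNth

variable {α : Type*} {n : ℕ} (op : α → α → α) (a : Fin (n + 2) → α)

theorem contractNth_zero_zero : Fin.contractNth 0 op a 0 = op (a 0) (a 1) := by
  simp [Fin.contractNth]

theorem contractNth_zero_succ (k : Fin n) : Fin.contractNth 0 op a k.succ = a k.succ.succ := by
  simp [Fin.contractNth]

theorem contractNth_succ_zero (j : Fin (n + 1)) : Fin.contractNth j.succ op a 0 = a 0 := by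
  simp [Fin.contractNth]

theorem contractNth_succ_succ (j : Fin (n + 1)) (k : Fin n) :
    Fin.contractNth j.succ op a k.succ = Fin.contractNth j op (fun i => a i.succ) k := by
  simp [Fin.contractNth]

end ContractNth

namespace BarWords

/-! ### Lengths and supports of words -/

section Supports

variable {ι S : Type*} [CommRing S]

theorem map_mem_of_single {M : Type*} [AddCommGroup M] [Module S M] (L : BarWords ι S →ₗ[S] M)
    {X : Set (List ι)} {N : Submodule S M} (h : ∀ w ∈ X, L (Finsupp.single w 1) ∈ N)
    {z : BarWords ι S} (hz : z ∈ Finsupp.supported S S X) : L z ∈ N := by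
  rw [Finsupp.supported_eq_span_single, ← Submodule.mem_comap] at *
  refine (Submodule.span_le.2 ?_ : _ ≤ N.comap L) hz
  rintro _ ⟨w, hw, rfl⟩
  exact h w hw

/-- Combinations of words of length `n`, that is, `S ⊗ P^{⊗ n}`. -/
noncomputable def ofLength (ι S : Type*) [CommRing S] (n : ℕ) : Submodule S (BarWords ι S) :=
  Finsupp.supported S S {w | w.length = n}

theorem single_mem_ofLength {w : List ι} (s : S) : Finsupp.single w s ∈ ofLength ι S w.length :=
  Finsupp.single_mem_supported _ _ rfl

theorem map_mem_of_length {M : Type*} [AddCommGroup M] [Module S M] (L : BarWords ι S →ₗ[S] M)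
    {n : ℕ} {N : Submodule S M} (h : ∀ w : List ι, w.length = n → L (Finsupp.single w 1) ∈ N)
    {z : BarWords ι S} (hz : z ∈ ofLength ι S n) : L z ∈ N :=
  map_mem_of_single L h hz

end Supports

/-! ### Tensors as words -/

variable {P ι S : Type*} [NonUnitalCommRing P] [Module (ZMod 2) P] [IsScalarTower (ZMod 2) P P]
  [SMulCommClass (ZMod 2) P P] [CommRing S] [Algebra (ZMod 2) S]

variable (S) (β : Module.Basis ι (ZMod 2) P)

/-- The pure tensor `1 ⊗ a₀ ⊗ ⋯ ⊗ aₙ₋₁`, as a multilinear function of the `aᵢ`. -/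
noncomputable def tensor : (n : ℕ) → MultilinearMap (ZMod 2) (fun _ : Fin n => P) (BarWords ι S)
  | 0 => MultilinearMap.constOfIsEmpty _ _ (Finsupp.single [] 1)
  | n + 1 => LinearMap.uncurryLeft
      { toFun := fun p => ((cons S β p).restrictScalars (ZMod 2)).compMultilinearMap (tensor n)
        map_add' := fun p q => by ext; simp
        map_smul' := fun c p => by ext; simp }

theorem tensor_zero (a : Fin 0 → P) : tensor S β 0 a = Finsupp.single [] 1 := rfl

theorem tensor_succ (n : ℕ) (a : Fin (n + 1) → P) :
    tensor S β (n + 1) a = cons S β (a 0) (tensor S β n fun i => a i.succ) := rfl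

theorem tensor_basis (n : ℕ) (v : Fin n → ι) :
    tensor S β n (fun i => β (v i)) = Finsupp.single (List.ofFn v) 1 := by
  induction n with
  | zero => simp [tensor_zero]
  | succ n ih => rw [tensor_succ, ih fun i => v i.succ, cons_basis_single, List.ofFn_succ]

variable {S} (ε : P →ₙₐ[ZMod 2] S)

theorem barEnd_tensor (n : ℕ) (a : Fin (n + 1) → P) :
    barEnd β ε (tensor S β (n + 1) a) =
      ∑ i : Fin n, tensor S β n (Fin.contractNth i.castSucc (· * ·) a) +
        ε (a (Fin.last n)) • tensor S β n fun i => a i.castSucc := by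
  induction n with
  | zero => simp [tensor_succ, tensor_zero]
  | succ n ih =>
    rw [tensor_succ, barEnd_cons, ih, map_add, map_sum, map_smul, Fin.sum_univ_succ,
      tensor_succ _ _ n fun i => a i.succ, mulHead_cons]
    have h0 : tensor S β (n + 1) (Fin.contractNth (Fin.castSucc 0) (· * ·) a) =
        cons S β (a 0 * a (Fin.succ 0)) (tensor S β n fun i => a i.succ.succ) := by
      rw [tensor_succ]
      simp [contractNth_zero_succ]
      simp [Fin.contractNth]
    have h1 (i : Fin n) : tensor S β (n + 1) (Fin.contractNth i.succ.castSucc (· * ·) a) =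
        cons S β (a 0) (tensor S β n (Fin.contractNth i.castSucc (· * ·) fun i => a i.succ)) := by
      rw [tensor_succ, ← Fin.succ_castSucc, contractNth_succ_zero]
      simp only [contractNth_succ_succ]
    rw [h0, Finset.sum_congr rfl fun i _ => h1 i, tensor_succ _ _ n fun i => a i.castSucc]
    simp only [← Fin.succ_castSucc, Fin.succ_last, Fin.castSucc_zero]
    abel

theorem bar_tensor (n : ℕ) (a : Fin (n + 1) → P) :
    bar β ε (tensor S β (n + 1) a) =
      ε (a 0) • tensor S β n (fun i => a i.succ) +
      ∑ i : Fin n, tensor S β n (Fin.contractNth i.castSucc (· * ·) a) +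
        ε (a (Fin.last n)) • tensor S β n fun i => a i.castSucc := by
  rw [bar_apply, barEnd_tensor, tensor_succ, barStart_cons]
  abel

/-- Words in `X` are sent to combinations of words in `Y` by prefixing `p`, when this is so for
the letters occurring in `p`. -/
theorem cons_mem {X Y : Set (List ι)} {p : P}
    (h : ∀ i, β.repr p i ≠ 0 → ∀ w ∈ X, i :: w ∈ Y) {z : BarWords ι S}
    (hz : z ∈ Finsupp.supported S S X) : cons S β p z ∈ Finsupp.supported S S Y := by
  refine map_mem_of_single _ (fun w hw => ?_) hz
  rw [← β.linearCombination_repr p, Finsupp.linearCombination_apply, Finsupp.sum, map_sum,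
    LinearMap.sum_apply]
  refine Submodule.sum_mem _ fun i hi => ?_
  rw [map_smul, LinearMap.smul_apply, cons_basis_single]
  rw [← algebraMap_smul S]
  exact Submodule.smul_mem _ _ (Finsupp.single_mem_supported _ _
    (h i (Finsupp.mem_support_iff.1 hi) w hw))

theorem cons_mem_ofLength (p : P) {n : ℕ} {z : BarWords ι S} (hz : z ∈ ofLength ι S n) :
    cons S β p z ∈ ofLength ι S (n + 1) :=
  cons_mem β (fun i _ w hw => by simpa using hw) hz

theorem mulHead_mem_ofLength (p : P) {n : ℕ} {z : BarWords ι S} (hz : z ∈ ofLength ι S n) :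
    mulHead β ε p z ∈ ofLength ι S n := by
  refine map_mem_of_length _ (fun w hw => ?_) hz
  cases w with
  | nil => rw [mulHead_nil, ← hw]; exact single_mem_ofLength _
  | cons i w =>
    rw [← cons_basis_single S β, mulHead_cons, ← hw]
    exact cons_mem_ofLength β _ (single_mem_ofLength _)

theorem barEnd_mem_ofLength {n : ℕ} {z : BarWords ι S} (hz : z ∈ ofLength ι S (n + 1)) :
    barEnd β ε z ∈ ofLength ι S n := by
  induction n generalizing z with
  | zero =>
    refine map_mem_of_length _ (fun w hw => ?_) hz
    obtain ⟨i, rfl⟩ := List.length_eq_one_iff.1 hw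
    rw [← cons_basis_single S β, barEnd_cons]
    simpa using single_mem_ofLength (ι := ι) (w := []) (ε (β i))
  | succ n ih =>
    refine map_mem_of_length _ (fun w hw => ?_) hz
    cases w with
    | nil => simp at hw
    | cons i w =>
      have hw' : Finsupp.single w (1 : S) ∈ ofLength ι S (n + 1) := by
        simp only [List.length_cons, add_left_inj] at hw
        rw [← hw]
        exact single_mem_ofLength _
      rw [← cons_basis_single S β, barEnd_cons]
      exact add_mem (mulHead_mem_ofLength β ε _ hw') (cons_mem_ofLength β _ (ih hw'))

theorem barStart_mem_ofLength {n : ℕ} {z : BarWords ι S} (hz : z ∈ ofLength ι S (n + 1)) :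
    barStart β ε z ∈ ofLength ι S n := by
  refine map_mem_of_length _ (fun w hw => ?_) hz
  cases w with
  | nil => simp at hw
  | cons i w =>
    simp only [List.length_cons, add_left_inj] at hw
    rw [← cons_basis_single S β, barStart_cons, ← hw]
    exact Submodule.smul_mem _ _ (single_mem_ofLength _)

theorem bar_mem_ofLength {n : ℕ} {z : BarWords ι S} (hz : z ∈ ofLength ι S (n + 1)) :
    bar β ε z ∈ ofLength ι S n :=
  add_mem (barEnd_mem_ofLength β ε hz) (barStart_mem_ofLength β ε hz)

theorem tensor_mem_ofLength (n : ℕ) (a : Fin n → P) : tensor S β n a ∈ ofLength ι S n := by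
  induction n with
  | zero => exact single_mem_ofLength (ι := ι) (w := []) 1
  | succ n ih => exact cons_mem_ofLength β _ (ih _)

/-- Every multilinear map on `P^n` extends to an `S`-linear map on words. -/
theorem exists_linearMap_tensor {M : Type*} [AddCommGroup M] [Module (ZMod 2) M] [Module S M]
    [IsScalarTower (ZMod 2) S M] (n : ℕ) (f : MultilinearMap (ZMod 2) (fun _ : Fin n => P) M) :
    ∃ F : BarWords ι S →ₗ[S] M, (∀ a, F (tensor S β n a) = f a) ∧
      ∀ v : Fin n → ι, F (Finsupp.single (List.ofFn v) 1) = f fun i => β (v i) := by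
  let F : BarWords ι S →ₗ[S] M := Finsupp.linearCombination S fun w =>
    if h : w.length = n then f fun i => β (w.get (i.cast h.symm)) else 0
  have hF (v : Fin n → ι) : F (Finsupp.single (List.ofFn v) 1) = f fun i => β (v i) := by
    simp [F]
  refine ⟨F, fun a => ?_, hF⟩
  have : (F.restrictScalars (ZMod 2)).compMultilinearMap (tensor S β n) = f := by
    refine Module.Basis.ext_multilinear (fun _ => β) fun v => ?_
    simp [tensor_basis, hF]
  exact congrArg (fun f => f a) this

/-! ### Contractions -/

/-- Suppose that the bar complex modulo the combinations of words in `X` is exact in the lengths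
`n` with `m < n ≤ N` and that its differential in length `m + 1` is regular in von Neumann's
sense. Then it has a contraction in these lengths: the complex consists of free modules. -/
theorem exists_contraction (X : Set (List ι)) (m N : ℕ)
    (hX : ∀ z ∈ Finsupp.supported S S X, bar β ε z ∈ Finsupp.supported S S X)
    (h0 : ∃ σ : BarWords ι S →ₗ[S] BarWords ι S,
      (∀ z ∈ ofLength ι S m, σ z ∈ ofLength ι S (m + 1)) ∧
      (∀ z ∈ Finsupp.supported S S X, σ z ∈ Finsupp.supported S S X) ∧
      ∀ z ∈ ofLength ι S (m + 1),
        bar β ε (z - σ (bar β ε z)) ∈ Finsupp.supported S S X)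
    (hex : ∀ n, m < n → n ≤ N → ∀ z ∈ ofLength ι S n, bar β ε z ∈ Finsupp.supported S S X →
      ∃ y ∈ ofLength ι S (n + 1), z - bar β ε y ∈ Finsupp.supported S S X)
    (n : ℕ) (hmn : m ≤ n) (hn : n ≤ N) :
    ∃ σ : BarWords ι S →ₗ[S] BarWords ι S,
      (∀ z ∈ ofLength ι S n, σ z ∈ ofLength ι S (n + 1)) ∧
      (∀ z ∈ Finsupp.supported S S X, σ z ∈ Finsupp.supported S S X) ∧
      ∀ z ∈ ofLength ι S (n + 1),
        bar β ε (z - σ (bar β ε z)) ∈ Finsupp.supported S S X := by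
  classical
  induction n, hmn using Nat.le_induction with
  | base => exact h0
  | succ n hmn ih =>
    obtain ⟨σ, hσ, hσX, hb⟩ := ih (by omega)
    have key (w : List ι) : ∃ y : BarWords ι S, w.length = n + 1 →
        y ∈ ofLength ι S (n + 2) ∧
          Finsupp.single w (1 : S) - σ (bar β ε (Finsupp.single w 1)) - bar β ε y ∈
            Finsupp.supported S S X := by
      by_cases hw : w.length = n + 1
      · have hw' : Finsupp.single w (1 : S) ∈ ofLength ι S (n + 1) := by
          rw [← hw]; exact single_mem_ofLength _
        obtain ⟨y, hy⟩ := hex (n + 1) (by omega) hn _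
          (sub_mem hw' (hσ _ (bar_mem_ofLength β ε hw'))) (hb _ hw')
        exact ⟨y, fun _ => hy⟩
      · exact ⟨0, fun h => absurd h hw⟩
    choose y hy using key
    let τ : BarWords ι S →ₗ[S] BarWords ι S :=
      Finsupp.linearCombination S fun w => if w ∈ X then 0 else y w
    have hτ (z) (hz : z ∈ ofLength ι S (n + 1)) :
        z - σ (bar β ε z) - bar β ε (τ z) ∈ Finsupp.supported S S X := by
      refine map_mem_of_length (LinearMap.id - σ ∘ₗ bar β ε - bar β ε ∘ₗ τ) (fun w hw => ?_) hz
      by_cases hwX : w ∈ X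
      · have h1 : Finsupp.single w (1 : S) ∈ Finsupp.supported S S X :=
          Finsupp.single_mem_supported _ _ hwX
        simpa [τ, hwX] using sub_mem h1 (hσX _ (hX _ h1))
      · simpa [τ, hwX] using (hy w hw).2
    refine ⟨τ, fun z hz => ?_, fun z hz => ?_, fun z hz => ?_⟩
    · refine map_mem_of_length _ (fun w hw => ?_) hz
      simp only [τ, Finsupp.linearCombination_single, one_smul]
      split_ifs
      · exact zero_mem _
      · exact (hy w hw).1
    · refine map_mem_of_single _ (fun w hw => ?_) hz
      simp [τ, hw]
    · have h1 := hτ _ (bar_mem_ofLength β ε hz)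
      rw [bar_bar, map_zero, sub_zero] at h1
      rwa [map_sub]

end BarWords

/-! ### The positive part of `V_* ⊓ A_*` -/

/-- A Boolean ring is an algebra over `𝔽₂`. -/
noncomputable instance BooleanRing.instAlgebraZModTwo (A : Type*) [BooleanRing A] :
    Algebra (ZMod 2) A :=
  letI : Module (ZMod 2) A :=
    AddCommGroup.zmodModule fun a => by rw [two_nsmul, BooleanRing.add_self]
  Algebra.ofModule (fun c x y => ZMod.map_smul (AddMonoidHom.mulRight y) c x)
    fun c x y => ZMod.map_smul (AddMonoidHom.mulLeft x) c y

namespace BooleanPart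

variable {A : Type*} [BooleanRing A]

@[ext]
theorem ext {p q : BooleanPart A} (h : ∀ n, coeff p n = coeff q n) : p = q :=
  AddMonoidAlgebra.coeff_injective (Finsupp.ext h)

/-- The element `a` of degree `n`. -/
noncomputable def mono (n : ℕ+) : A →ₗ[ZMod 2] BooleanPart A :=
  AddMonoidHom.toZModLinearMap 2
    (AddMonoidAlgebra.singleAddHom n : A →+ AddMonoidAlgebra A ℕ+)

theorem mono_mul_mono (m n : ℕ+) (a b : A) : mono m a * mono n b = mono (m + n) (a * b) :=
  AddMonoidAlgebra.single_mul_single m n a b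

theorem coeff_mono (m n : ℕ+) (a : A) : coeff (mono m a) n = if m = n then a else 0 :=
  Finsupp.single_apply

@[elab_as_elim]
theorem induction_mono {motive : BooleanPart A → Prop} (p : BooleanPart A) (zero : motive 0)
    (add : ∀ p q, motive p → motive q → motive (p + q)) (mono : ∀ n a, motive (mono n a)) :
    motive p :=
  AddMonoidAlgebra.induction_linear (R := A) (M := ℕ+) (motive := motive) p zero add mono

theorem mono_mem_grading (n : ℕ+) (a : A) : mono n a ∈ grading A n := fun m hm => by
  rw [coeff_mono, if_neg hm.symm]

theorem eq_mono_of_mem_grading {n : ℕ+} {p : BooleanPart A} (hp : p ∈ grading A n) :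
    p = mono n (coeff p n) := by
  ext m
  rw [coeff_mono]
  split_ifs with h
  · rw [h]
  · exact hp m fun h' => h h'.symm

theorem mul_mem_grading {m n : ℕ+} {p q : BooleanPart A} (hp : p ∈ grading A m)
    (hq : q ∈ grading A n) : p * q ∈ grading A (m + n) := by
  rw [eq_mono_of_mem_grading hp, eq_mono_of_mem_grading hq, mono_mul_mono]
  exact mono_mem_grading _ _

/-- Coefficients, as a linear equivalence. -/
noncomputable def coeffEquiv (A : Type*) [BooleanRing A] :
    BooleanPart A ≃ₗ[ZMod 2] (ℕ+ →₀ A) :=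
  { (AddMonoidAlgebra.coeffAddEquiv : AddMonoidAlgebra A ℕ+ ≃+ (ℕ+ →₀ A)) with
    map_smul' := fun c p => ZMod.map_smul
      (AddMonoidAlgebra.coeffAddEquiv : AddMonoidAlgebra A ℕ+ ≃+ (ℕ+ →₀ A)).toAddMonoidHom c p }

theorem coeffEquiv_apply (p : BooleanPart A) (n : ℕ+) : coeffEquiv A p n = coeff p n := rfl

theorem coeffEquiv_mono (n : ℕ+) (a : A) : coeffEquiv A (mono n a) = Finsupp.single n a := rfl

/-- The linear map which is `φ n` in degree `n`. -/
noncomputable def sumHom {M : Type*} [AddCommGroup M] [Module (ZMod 2) M]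
    (φ : ℕ+ → A →ₗ[ZMod 2] M) : BooleanPart A →ₗ[ZMod 2] M :=
  Finsupp.lsum (ZMod 2) φ ∘ₗ (coeffEquiv A).toLinearMap

theorem sumHom_mono {M : Type*} [AddCommGroup M] [Module (ZMod 2) M]
    (φ : ℕ+ → A →ₗ[ZMod 2] M) (n : ℕ+) (a : A) : sumHom φ (mono n a) = φ n a := by
  simp [sumHom, coeffEquiv_mono]

theorem map_mono {B : Type*} [BooleanRing B] (φ : A →+* B) (n : ℕ+) (a : A) :
    map φ (mono n a) = mono n (φ a) :=
  AddMonoidAlgebra.map_single _ _ _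

end BooleanPart

/-- A homomorphism of Boolean rings, as an `𝔽₂`-linear map. -/
noncomputable def booleanLinearMap {A B : Type*} [BooleanRing A] [BooleanRing B] (φ : A →+* B) :
    A →ₗ[ZMod 2] B :=
  AddMonoidHom.toZModLinearMap 2 φ.toAddMonoidHom

theorem booleanLinearMap_apply {A B : Type*} [BooleanRing A] [BooleanRing B] (φ : A →+* B)
    (a : A) : booleanLinearMap φ a = φ a := rfl

/-- The positive part of `V_* ⊓ A_*`. -/
abbrev PositivePart (V A : Type*) [BooleanRing A] : Type _ := DualPart V × BooleanPart A

namespace PositivePart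

variable {V A : Type*} [AddCommGroup V] [Module (ZMod 2) V] [BooleanRing A]

theorem dual_mul (x y : DualPart V) : x * y = 0 := rfl

/-- The element `a ∈ A` in degree `n`. -/
noncomputable def mono (V : Type*) {A : Type*} [AddCommGroup V] [Module (ZMod 2) V]
    [BooleanRing A] (n : ℕ+) : A →ₗ[ZMod 2] PositivePart V A :=
  LinearMap.inr (ZMod 2) (DualPart V) (BooleanPart A) ∘ₗ BooleanPart.mono n

theorem mono_apply (n : ℕ+) (a : A) : mono V n a = (0, BooleanPart.mono n a) := rfl

theorem mono_mul_mono (m n : ℕ+) (a b : A) :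
    mono V m a * mono V n b = mono V (m + n) (a * b) := by
  rw [mono_apply, mono_apply, Prod.mk_mul_mk, BooleanPart.mono_mul_mono, mono_apply, dual_mul]

theorem mul_fst (p q : PositivePart V A) : (p * q).1 = 0 := rfl

theorem inl_mul (v : DualPart V) (q : PositivePart V A) : ((v, 0) : PositivePart V A) * q = 0 := by
  ext1
  · rfl
  · exact zero_mul _

theorem mul_inl (v : DualPart V) (q : PositivePart V A) : q * ((v, 0) : PositivePart V A) = 0 := by
  rw [mul_comm, inl_mul]

@[elab_as_elim]
theorem induction_mono {motive : PositivePart V A → Prop} (p : PositivePart V A)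
    (add : ∀ p q, motive p → motive q → motive (p + q)) (inl : ∀ v, motive (v, 0))
    (mono : ∀ n a, motive (mono V n a)) : motive p := by
  obtain ⟨v, x⟩ := p
  have h : ((v, x) : PositivePart V A) = (v, 0) + (0, x) := by simp
  rw [h]
  clear h
  refine add _ _ (inl v) ?_
  induction x using BooleanPart.induction_mono with
  | zero => exact inl 0
  | add p q hp hq =>
    have h : ((0, p + q) : PositivePart V A) = (0, p) + (0, q) := by simp
    rw [h]
    exact add _ _ hp hq
  | mono n a => exact mono n a

variable (V A)

/-- The component of degree `n` of the positive part. -/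
noncomputable def grading (n : ℕ+) : Submodule (ZMod 2) (PositivePart V A) :=
  (dualPartGrading V n).prod (BooleanPart.grading A n)

/-- The indices of a homogeneous basis of the positive part: those of a basis of `V`, and the
pairs of a degree and an index of a basis of `A`. -/
abbrev Idx : Type _ :=
  Module.Basis.ofVectorSpaceIndex (ZMod 2) (DualPart V) ⊕
    (_ : ℕ+) × Module.Basis.ofVectorSpaceIndex (ZMod 2) A

/-- A homogeneous basis of the positive part. -/
noncomputable def basis : Module.Basis (Idx V A) (ZMod 2) (PositivePart V A) :=
  (Module.Basis.ofVectorSpace (ZMod 2) (DualPart V)).prod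
    ((Finsupp.basis fun _ : ℕ+ => Module.Basis.ofVectorSpace (ZMod 2) A).map
      (BooleanPart.coeffEquiv A).symm)

variable {V A}

/-- The degree of a basis element. -/
def deg : Idx V A → ℕ
  | Sum.inl _ => 1
  | Sum.inr ⟨n, _⟩ => n

theorem deg_pos (i : Idx V A) : 0 < deg i := by
  cases i with
  | inl j => exact Nat.one_pos
  | inr x => exact x.1.pos

theorem basis_inl (j) : ∃ v, basis V A (Sum.inl j) = (v, 0) :=
  ⟨Module.Basis.ofVectorSpace (ZMod 2) (DualPart V) j, by ext1 <;> simp [basis]⟩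

theorem basis_inr (j) : ∃ a, ∀ n, basis V A (Sum.inr ⟨n, j⟩) = mono V n a := by
  refine ⟨Module.Basis.ofVectorSpace (ZMod 2) A j, fun n => ?_⟩
  ext1
  · simp [basis, mono_apply]
  · simp only [basis, Module.Basis.prod_apply_inr_snd, Module.Basis.map_apply, Finsupp.coe_basis,
      mono_apply]
    rw [← BooleanPart.coeffEquiv_mono, LinearEquiv.symm_apply_apply]

theorem basis_repr_inl (p : PositivePart V A) (j) : (basis V A).repr p (Sum.inl j) =
    (Module.Basis.ofVectorSpace (ZMod 2) (DualPart V)).repr p.1 j := by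
  simp [basis]

theorem basis_repr_inr (p : PositivePart V A) (n j) : (basis V A).repr p (Sum.inr ⟨n, j⟩) =
    (Module.Basis.ofVectorSpace (ZMod 2) A).repr (BooleanPart.coeff p.2 n) j := by
  simp [basis, BooleanPart.coeffEquiv_apply]

/-- Products have no component in `V`. -/
theorem repr_mul_inl (p q : PositivePart V A) (j) : (basis V A).repr (p * q) (Sum.inl j) = 0 := by
  rw [basis_repr_inl, mul_fst, map_zero, Finsupp.zero_apply]

theorem deg_eq_of_repr_ne_zero {n : ℕ+} {p : PositivePart V A} (hp : p ∈ grading V A n)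
    {i : Idx V A}
    (hi : (basis V A).repr p i ≠ 0) : deg i = n := by
  cases i with
  | inl j =>
    rw [basis_repr_inl] at hi
    by_contra hn
    have h1 : n ≠ 1 := fun h => hn (by rw [h]; rfl)
    have h2 : p.1 = 0 := by
      have := hp.1
      rwa [SetLike.mem_coe, dualPartGrading, if_neg h1, Submodule.mem_bot] at this
    exact hi (by rw [h2, map_zero, Finsupp.zero_apply])
  | inr x =>
    obtain ⟨m, j⟩ := x
    rw [basis_repr_inr] at hi
    by_contra hn
    refine hi ?_
    rw [hp.2 m fun h => hn (by rw [h]; rfl), map_zero, Finsupp.zero_apply]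

theorem mono_mem_grading (n : ℕ+) (a : A) : mono V n a ∈ grading V A n :=
  ⟨zero_mem _, BooleanPart.mono_mem_grading n a⟩

theorem inl_mem_grading (v : DualPart V) : ((v, 0) : PositivePart V A) ∈ grading V A 1 :=
  ⟨by simp [dualPartGrading], zero_mem _⟩

theorem basis_mem_grading (i : Idx V A) : basis V A i ∈ grading V A ⟨deg i, deg_pos i⟩ := by
  cases i with
  | inl j =>
    obtain ⟨v, hv⟩ := basis_inl (A := A) j
    rw [hv]
    exact inl_mem_grading v
  | inr x =>
    obtain ⟨n, j⟩ := x
    obtain ⟨a, ha⟩ := basis_inr (V := V) j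
    rw [ha]
    exact mono_mem_grading n a

theorem mul_mem_grading {m n : ℕ+} {p q : PositivePart V A} (hp : p ∈ grading V A m)
    (hq : q ∈ grading V A n) : p * q ∈ grading V A (m + n) :=
  ⟨zero_mem _, BooleanPart.mul_mem_grading hp.2 hq.2⟩

theorem deg_eq_of_repr_mul_ne_zero {i j l : Idx V A}
    (h : (basis V A).repr (basis V A i * basis V A j) l ≠ 0) : deg l = deg i + deg j :=
  deg_eq_of_repr_ne_zero (mul_mem_grading (basis_mem_grading i) (basis_mem_grading j)) h

/-- The unit of `A`, in degree one. -/
noncomputable def t (V A : Type*) [AddCommGroup V] [Module (ZMod 2) V] [BooleanRing A] :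
    PositivePart V A := mono V 1 1

theorem t_mul_mono (n : ℕ+) (a : A) : t V A * mono V n a = mono V (n + 1) a := by
  rw [t, mono_mul_mono, one_mul, add_comm]

theorem t_mul_basis_inr (n j) :
    t V A * basis V A (Sum.inr ⟨n, j⟩) = basis V A (Sum.inr ⟨n + 1, j⟩) := by
  obtain ⟨a, ha⟩ := basis_inr (V := V) j
  rw [ha, ha, t_mul_mono]

theorem t_mul_basis_inl (j) : t V A * basis V A (Sum.inl j) = 0 := by
  obtain ⟨v, hv⟩ := basis_inl (A := A) j
  rw [hv, mul_inl]

theorem repr_t_ne_zero {i : Idx V A} (h : (basis V A).repr (t V A) i ≠ 0) : deg i = 1 :=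
  deg_eq_of_repr_ne_zero (mono_mem_grading 1 1) h

end PositivePart

/-! ### Exactness for the localized coefficients -/

namespace BarWords

open PositivePart

variable {V A B : Type*} [AddCommGroup V] [Module (ZMod 2) V] [BooleanRing A] [BooleanRing B]

/-- The character `V_* ⊓ A_* → B` which kills `V` and sends `a ∈ A` in any degree to `φ a`. -/
noncomputable def character (V : Type*) [AddCommGroup V] [Module (ZMod 2) V] (φ : A →+* B) :
    PositivePart V A →ₙₐ[ZMod 2] B :=
  { BooleanPart.sumHom (fun _ => booleanLinearMap φ) ∘ₗ
      LinearMap.snd (ZMod 2) (DualPart V) (BooleanPart A) with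
    map_zero' := map_zero _
    map_mul' := fun p q => by
      simp only [LinearMap.coe_toAddHom, AddHom.toFun_eq_coe, LinearMap.comp_apply,
        LinearMap.snd_apply, Prod.snd_mul]
      induction p.2 using BooleanPart.induction_mono with
      | zero => simp
      | add x y hx hy => rw [add_mul, map_add, hx, hy, map_add, add_mul]
      | mono m a =>
        induction q.2 using BooleanPart.induction_mono with
        | zero => simp
        | add x y hx hy => rw [mul_add, map_add, hx, hy, map_add, mul_add]
        | mono n b =>
          simp only [BooleanPart.mono_mul_mono, BooleanPart.sumHom_mono, booleanLinearMap_apply,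
            map_mul] }

variable (φ : A →+* B)

theorem character_inl (v : DualPart V) : character V φ (v, 0) = 0 :=
  map_zero (BooleanPart.sumHom fun _ => booleanLinearMap φ)

theorem character_mono (n : ℕ+) (a : A) : character V φ (mono V n a) = φ a :=
  BooleanPart.sumHom_mono (fun _ => booleanLinearMap φ) n a

theorem character_t : character V φ (t V A) = 1 := by rw [t, character_mono, map_one]

local notation "β" => basis V A
local notation "ε" => character V φ

/-- `μ_t + 1` is injective on the combinations of nonempty words: the multiplication `μ_t` of the
first letter by `t` raises the degree of that letter. -/
theorem eq_zero_of_mulHead_t_eq_self {n : ℕ} {z : BarWords (Idx V A) B}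
    (hz : z ∈ ofLength (Idx V A) B (n + 1)) (h : mulHead β ε (t V A) z = z) : z = 0 := by
  have key (N : ℕ) : z ∈ Finsupp.supported B B
      {w : List (Idx V A) | ∃ i u, w = i :: u ∧ N ≤ deg i} := by
    induction N with
    | zero =>
      refine Finsupp.supported_mono (fun w hw => ?_) hz
      cases w with
      | nil => simp at hw
      | cons i w => exact ⟨i, w, rfl, Nat.zero_le _⟩
    | succ N ih =>
      rw [← h]
      refine map_mem_of_single _ ?_ ih
      rintro _ ⟨i, u, rfl, hi⟩
      rw [← cons_basis_single B β, mulHead_cons]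
      cases i with
      | inl j => rw [t_mul_basis_inl, map_zero, LinearMap.zero_apply]; exact zero_mem _
      | inr x =>
        obtain ⟨m, j⟩ := x
        rw [t_mul_basis_inr, cons_basis_single]
        exact Finsupp.single_mem_supported _ _ ⟨_, u, rfl, Nat.succ_le_succ hi⟩
  rw [← Finsupp.support_eq_empty, Finset.eq_empty_iff_forall_notMem]
  intro w hw
  obtain ⟨i, u, rfl, _⟩ := (Finsupp.mem_supported _ _).1 (key 0) hw
  obtain ⟨i', u', h', hi'⟩ := (Finsupp.mem_supported _ _).1 (key (deg i + 1)) hw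
  obtain ⟨rfl, -⟩ := List.cons.inj h'
  omega

/-- The endomorphism `φ(a) μ_{at} + (1 + φ(a)) μ_{(1+a)t}`. It acts as the identity on homology,
and after applying it the letter `a` can be exchanged for the coefficient `φ(a)`. -/
noncomputable def exchange (a : A) : BarWords (Idx V A) B →ₗ[B] BarWords (Idx V A) B :=
  φ a • mulHead β ε (mono V 1 a) + (1 + φ a) • mulHead β ε (mono V 1 (1 + a))

theorem exchange_apply (a : A) (z : BarWords (Idx V A) B) : exchange φ a z =
    φ a • mulHead β ε (mono V 1 a) z + (1 + φ a) • mulHead β ε (mono V 1 (1 + a)) z := rfl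

theorem mulHead_exchange (p : PositivePart V A) (a : A) (z : BarWords (Idx V A) B) :
    mulHead β ε p (exchange φ a z) = exchange φ a (mulHead β ε p z) := by
  simp only [exchange_apply, map_add, map_smul, LinearMap.add_apply, mulHead_comm β ε p]

theorem exchange_mem_ofLength (a : A) {n : ℕ} {z : BarWords (Idx V A) B}
    (hz : z ∈ ofLength (Idx V A) B n) : exchange φ a z ∈ ofLength (Idx V A) B n :=
  add_mem (Submodule.smul_mem _ _ (mulHead_mem_ofLength _ _ _ hz))
    (Submodule.smul_mem _ _ (mulHead_mem_ofLength _ _ _ hz))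

theorem exchange_cons_mono (a : A) (n : ℕ+) (z : BarWords (Idx V A) B) :
    exchange φ a (cons B β (mono V n a) z) = φ a • cons B β (mono V (n + 1) a) z := by
  have h : (1 + a) * a = 0 := by
    rw [add_mul, one_mul, BooleanRing.mul_self, BooleanRing.add_self]
  rw [exchange_apply, mulHead_cons, mulHead_cons, mono_mul_mono, mono_mul_mono, h,
    BooleanRing.mul_self, map_zero, map_zero, LinearMap.zero_apply, smul_zero, add_zero, add_comm]

theorem exchange_cons_t (a : A) (z : BarWords (Idx V A) B) :
    exchange φ a (cons B β (t V A) (φ a • z)) = φ a • cons B β (mono V 2 a) z := by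
  have h : (1 + φ a) * φ a = 0 := by
    rw [add_mul, one_mul, BooleanRing.mul_self, BooleanRing.add_self]
  rw [exchange_apply, mulHead_cons, mulHead_cons, t, mono_mul_mono, mono_mul_mono, map_smul,
    map_smul, smul_smul, smul_smul, h, zero_smul, add_zero, BooleanRing.mul_self, mul_one]
  rfl

/-- The composite of the endomorphisms `exchange φ a` for `a` in a list. -/
noncomputable def exchanges : List A → (BarWords (Idx V A) B →ₗ[B] BarWords (Idx V A) B)
  | [] => LinearMap.id
  | a :: l => exchange φ a ∘ₗ exchanges l

theorem exchanges_append (l l' : List A) (z : BarWords (Idx V A) B) :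
    exchanges φ (l ++ l') z = exchanges φ l (exchanges φ l' z) := by
  induction l with
  | nil => rfl
  | cons a l ih => exact congrArg (exchange φ a) ih

theorem mulHead_exchanges (p : PositivePart V A) (l : List A) (z : BarWords (Idx V A) B) :
    mulHead β ε p (exchanges φ l z) = exchanges φ l (mulHead β ε p z) := by
  induction l with
  | nil => rfl
  | cons a l ih => simp only [exchanges, LinearMap.comp_apply, mulHead_exchange, ih]

theorem exchange_exchanges (a : A) (l : List A) (z : BarWords (Idx V A) B) :
    exchange φ a (exchanges φ l z) = exchanges φ l (exchange φ a z) := by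
  simp only [exchange_apply, map_add, map_smul, LinearMap.add_apply, mulHead_exchanges]

theorem exchanges_comm (l l' : List A) (z : BarWords (Idx V A) B) :
    exchanges φ l (exchanges φ l' z) = exchanges φ l' (exchanges φ l z) := by
  induction l with
  | nil => rfl
  | cons a l ih => simp only [exchanges, LinearMap.comp_apply, ih, exchange_exchanges]

theorem exchanges_mem_ofLength (l : List A) {n : ℕ} {z : BarWords (Idx V A) B}
    (hz : z ∈ ofLength (Idx V A) B n) : exchanges φ l z ∈ ofLength (Idx V A) B n := by
  induction l with
  | nil => exact hz
  | cons a l ih => exact exchange_mem_ofLength φ a ih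

/-- In the cokernel of `μ_t + 1`, all degrees of a first letter `a ∈ A` are identified. -/
theorem exists_cons_mono_add (a : A) (m : ℕ+) {n : ℕ} {u : BarWords (Idx V A) B}
    (hu : u ∈ ofLength (Idx V A) B n) : ∃ x ∈ ofLength (Idx V A) B (n + 1),
      cons B β (mono V (m + 1) a) u + cons B β (mono V 2 a) u = mulHead β ε (t V A) x + x := by
  induction m using PNat.recOn with
  | one => exact ⟨0, zero_mem _, by
      rw [map_zero, add_zero]; exact ZModModule.add_self _⟩
  | succ m ih =>
    obtain ⟨x, hx, h⟩ := ih
    refine ⟨x + cons B β (mono V (m + 1) a) u, add_mem hx (cons_mem_ofLength _ _ hu), ?_⟩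
    rw [map_add, mulHead_cons, t_mul_mono]
    have h' : mulHead β ε (t V A) x + cons B β (mono V (m + 1 + 1) a) u +
        (x + cons B β (mono V (m + 1) a) u) = (mulHead β ε (t V A) x + x) +
          (cons B β (mono V (m + 1 + 1) a) u + cons B β (mono V (m + 1) a) u) := by abel
    rw [h', ← h]
    have h2 := ZModModule.add_self (cons B β (mono V (m + 1) a) u)
    generalize cons B β (mono V (m + 1) a) u = y at *
    generalize cons B β (mono V (m + 1 + 1) a) u = y' at *
    generalize cons B β (mono V 2 a) u = y''
    calc y' + y'' = y' + y'' + (y + y) := by rw [h2, add_zero]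
      _ = _ := by abel

/-- After finitely many exchanges, the identity is homotopic modulo `μ_t + 1` to the operation of
moving the first letter to the coefficients. -/
theorem exists_exchanges {n : ℕ} (z : BarWords (Idx V A) B)
    (hz : z ∈ ofLength (Idx V A) B (n + 1)) :
    ∃ l : List A, ∃ x ∈ ofLength (Idx V A) B (n + 1),
      exchanges φ l (z + cons B β (t V A) (barStart β ε z)) = mulHead β ε (t V A) x + x := by
  rw [ofLength, Finsupp.supported_eq_span_single] at hz
  induction hz using Submodule.span_induction with
  | zero => exact ⟨[], 0, zero_mem _, by simp⟩
  | add z z' _ _ hz hz' =>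
    obtain ⟨l, x, hx, h⟩ := hz
    obtain ⟨l', x', hx', h'⟩ := hz'
    refine ⟨l ++ l', exchanges φ l' x + exchanges φ l x',
      add_mem (exchanges_mem_ofLength φ _ hx) (exchanges_mem_ofLength φ _ hx'), ?_⟩
    have h1 : z + z' + cons B β (t V A) (barStart β ε (z + z')) =
        (z + cons B β (t V A) (barStart β ε z)) + (z' + cons B β (t V A) (barStart β ε z')) := by
      rw [map_add, map_add]; abel
    rw [h1, map_add, exchanges_append, exchanges_comm, h, exchanges_append, h']
    simp only [map_add, mulHead_exchanges]
    abel
  | smul b z _ hz =>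
    obtain ⟨l, x, hx, h⟩ := hz
    exact ⟨l, b • x, Submodule.smul_mem _ _ hx, by simp only [map_smul, ← smul_add, h]⟩
  | mem z hz =>
    obtain ⟨w, hw, rfl⟩ := hz
    cases w with
    | nil => simp at hw
    | cons i u =>
      have hu : Finsupp.single u (1 : B) ∈ ofLength (Idx V A) B n := by
        simp only [Set.mem_ofPred_eq, List.length_cons, add_left_inj] at hw
        rw [← hw]
        exact single_mem_ofLength _
      beta_reduce
      rw [← cons_basis_single B β, barStart_cons]
      cases i with
      | inl j =>
        refine ⟨[], _, cons_mem_ofLength β (β (Sum.inl j)) hu, ?_⟩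
        obtain ⟨v, hv⟩ := basis_inl (A := A) j
        rw [mulHead_cons, t_mul_basis_inl, hv, character_inl, zero_smul, map_zero, map_zero,
          LinearMap.zero_apply, add_zero, zero_add]
        rfl
      | inr x =>
        obtain ⟨m, j⟩ := x
        obtain ⟨a, ha⟩ := basis_inr (V := V) j
        obtain ⟨x, hx, h⟩ := exists_cons_mono_add φ a m hu
        refine ⟨[a], φ a • x, Submodule.smul_mem _ _ hx, ?_⟩
        rw [ha, character_mono]
        simp only [exchanges, LinearMap.comp_apply, LinearMap.id_apply]
        rw [map_add, exchange_cons_mono, exchange_cons_t, ← smul_add, h, map_smul, smul_add]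

/-- Modulo boundaries, `z` agrees with `μ_p z` when `ε p = 1` and the part `barStart` of the
differential vanishes on `z`; a homotopy is given by prefixing `p`. -/
theorem bar_cons_of_cycle (p : PositivePart V A) {z : BarWords (Idx V A) B}
    (hz : bar β ε z = 0) : bar β ε (cons B β p z) =
      mulHead β ε p z + cons B β p (barStart β ε z) + character V φ p • z := by
  have h : barEnd β ε z = barStart β ε z := by
    rw [bar_apply] at hz
    exact eq_of_sub_eq_zero (by rw [ZModModule.sub_eq_add]; exact hz)
  rw [bar_cons, h]

/-- A cycle is homologous to its image under an exchange. -/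
theorem exists_exchange_homologous (a : A) {n : ℕ} {z : BarWords (Idx V A) B}
    (hz : z ∈ ofLength (Idx V A) B n) (hE : barEnd β ε z = 0) :
    ∃ y ∈ ofLength (Idx V A) B (n + 1), bar β ε y = exchange φ a z + z := by
  refine ⟨φ a • cons B β (mono V 1 a) z + (1 + φ a) • cons B β (mono V 1 (1 + a)) z,
    add_mem (Submodule.smul_mem _ _ (cons_mem_ofLength _ _ hz))
      (Submodule.smul_mem _ _ (cons_mem_ofLength _ _ hz)), ?_⟩
  have hφ : φ (1 + a) = 1 + φ a := by rw [map_add, map_one]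
  rw [map_add, map_smul, map_smul, bar_cons, bar_cons, hE, map_zero, map_zero, character_mono,
    character_mono, exchange_apply, add_zero, add_zero, hφ, smul_add, smul_add,
    smul_smul, smul_smul, BooleanRing.mul_self, BooleanRing.mul_self]
  generalize mulHead β ε (mono V 1 a) z = x
  generalize mulHead β ε (mono V 1 (1 + a)) z = y
  have h : φ a • z + (1 + φ a) • z = z := by
    rw [← add_smul, add_comm, add_assoc, BooleanRing.add_self, add_zero, one_smul]
  calc _ = φ a • x + (1 + φ a) • y + (φ a • z + (1 + φ a) • z) := by abel
    _ = _ := by rw [h]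

theorem exists_exchanges_homologous (l : List A) {n : ℕ} {z : BarWords (Idx V A) B}
    (hz : z ∈ ofLength (Idx V A) B n) (hE : barEnd β ε z = 0) (hS : barStart β ε z = 0) :
    barEnd β ε (exchanges φ l z) = 0 ∧ barStart β ε (exchanges φ l z) = 0 ∧
    ∃ y ∈ ofLength (Idx V A) B (n + 1), bar β ε y = exchanges φ l z + z := by
  induction l with
  | nil => exact ⟨hE, hS, 0, zero_mem _, by rw [map_zero]; exact (ZModModule.add_self z).symm⟩
  | cons a l ih =>
    obtain ⟨h1, h2, y, hy, h⟩ := ih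
    obtain ⟨y', hy', h'⟩ :=
      exists_exchange_homologous φ a (exchanges_mem_ofLength φ l hz) h1
    refine ⟨?_, ?_, y + y', add_mem hy hy', ?_⟩
    · simp only [exchanges, LinearMap.comp_apply, exchange_apply, map_add, LinearMap.add_apply,
        map_smul, barEnd_mulHead, h1, map_zero, smul_zero, add_zero]
    · simp only [exchanges, LinearMap.comp_apply, exchange_apply, map_add, LinearMap.add_apply,
        map_smul, barStart_mulHead, h2, smul_zero, add_zero]
    · rw [map_add, h, h']
      have h3 := ZModModule.add_self (exchanges φ l z)
      simp only [exchanges, LinearMap.comp_apply]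
      calc _ = exchange φ a (exchanges φ l z) + z + (exchanges φ l z + exchanges φ l z) := by abel
        _ = _ := by rw [h3, add_zero]

/-- Every cycle of positive length is homologous to one of the form `μ_t x + x`. -/
theorem exists_homologous_mulHead_t_add {n : ℕ} {z : BarWords (Idx V A) B}
    (hz : z ∈ ofLength (Idx V A) B (n + 1)) (hb : bar β ε z = 0) :
    ∃ x ∈ ofLength (Idx V A) B (n + 1), ∃ y ∈ ofLength (Idx V A) B (n + 2),
      z = mulHead β ε (t V A) x + x + bar β ε y ∧
      barEnd β ε (mulHead β ε (t V A) x + x) = 0 := by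
  set z₁ := mulHead β ε (t V A) z + cons B β (t V A) (barStart β ε z) with hz₁
  have hy₁ : bar β ε (cons B β (t V A) z) = z₁ + z := by
    rw [bar_cons_of_cycle φ _ hb, character_t, one_smul]
  have h1 : z₁ ∈ ofLength (Idx V A) B (n + 1) :=
    add_mem (mulHead_mem_ofLength _ _ _ hz)
      (cons_mem_ofLength _ _ (barStart_mem_ofLength _ _ hz))
  have hS : barStart β ε z₁ = 0 := by
    rw [hz₁, map_add, barStart_mulHead, barStart_cons, character_t, one_smul,
      ZModModule.add_self]
  have hE : barEnd β ε z₁ = 0 := by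
    have := bar_bar β ε (cons B β (t V A) z)
    rwa [hy₁, map_add, hb, add_zero, bar_apply, hS, add_zero] at this
  obtain ⟨l, x, hx, h⟩ := exists_exchanges φ z₁ h1
  rw [hS, map_zero, add_zero] at h
  obtain ⟨hE', -, y, hy, h'⟩ := exists_exchanges_homologous φ l h1 hE hS
  refine ⟨x, hx, y + cons B β (t V A) z, add_mem hy (cons_mem_ofLength _ _ hz), ?_, ?_⟩
  · rw [map_add, hy₁, h', ← h]
    have h3 := ZModModule.add_self (exchanges φ l z₁)
    have h4 := ZModModule.add_self z₁
    calc z = z + (exchanges φ l z₁ + exchanges φ l z₁) + (z₁ + z₁) := by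
          rw [h3, h4, add_zero, add_zero]
      _ = _ := by abel
  · rw [← h, hE']

theorem bar_cons_t (x : BarWords (Idx V A) B) : bar β ε (cons B β (t V A) x) =
    mulHead β ε (t V A) x + x + cons B β (t V A) (barEnd β ε x) := by
  rw [bar_cons, character_t, one_smul]
  abel

/-- The bar complex with coefficients in `B`, on which `t` acts as the identity, is exact in
lengths at least two. -/
theorem bar_character_exact {n : ℕ} {z : BarWords (Idx V A) B}
    (hz : z ∈ ofLength (Idx V A) B (n + 2)) (hb : bar β ε z = 0) :
    ∃ y ∈ ofLength (Idx V A) B (n + 3), bar β ε y = z := by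
  obtain ⟨x, hx, y, hy, h, hE⟩ := exists_homologous_mulHead_t_add φ hz hb
  have hx0 : barEnd β ε x = 0 := by
    refine eq_zero_of_mulHead_t_eq_self φ (barEnd_mem_ofLength _ _ hx) ?_
    rw [map_add, barEnd_mulHead] at hE
    exact eq_of_sub_eq_zero (by rw [ZModModule.sub_eq_add]; exact hE)
  refine ⟨cons B β (t V A) x + y, add_mem (cons_mem_ofLength _ _ hx) hy, ?_⟩
  rw [map_add, bar_cons_t, hx0, map_zero, add_zero, h]

/-- The derivation `a tⁿ ↦ n a` over the character `ε`. -/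
noncomputable def derivation (V : Type*) [AddCommGroup V] [Module (ZMod 2) V] (φ : A →+* B) :
    PositivePart V A →ₗ[ZMod 2] B :=
  BooleanPart.sumHom (fun n : ℕ+ => (n : ZMod 2) • booleanLinearMap φ) ∘ₗ
    LinearMap.snd (ZMod 2) (DualPart V) (BooleanPart A)

theorem derivation_mono (n : ℕ+) (a : A) :
    derivation V φ (mono V n a) = ((n : ℕ) : ZMod 2) • φ a :=
  BooleanPart.sumHom_mono (fun n : ℕ+ => (n : ZMod 2) • booleanLinearMap φ) n a

theorem derivation_inl (v : DualPart V) : derivation V φ ((v, 0) : PositivePart V A) = 0 :=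
  map_zero (BooleanPart.sumHom fun n : ℕ+ => (n : ZMod 2) • booleanLinearMap φ)

theorem derivation_mul (p q : PositivePart V A) : derivation V φ (p * q) =
    character V φ p * derivation V φ q + character V φ q * derivation V φ p := by
  induction p using PositivePart.induction_mono with
  | add p p' hp hp' => rw [add_mul, map_add, hp, hp', map_add, map_add, add_mul, mul_add]; abel
  | inl v => rw [inl_mul, map_zero, derivation_inl, character_inl]; simp
  | mono m a =>
    induction q using PositivePart.induction_mono with
    | add p p' hp hp' => rw [mul_add, map_add, hp, hp', map_add, map_add, add_mul, mul_add]; abel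
    | inl v => rw [mul_inl, map_zero, derivation_inl, character_inl]; simp
    | mono n b =>
      rw [mono_mul_mono, derivation_mono, derivation_mono, derivation_mono, character_mono,
        character_mono, map_mul, PNat.add_coe, Nat.cast_add, add_smul, mul_smul_comm,
        mul_smul_comm, mul_comm (φ b), add_comm]

/-- The derivation vanishes on boundaries. -/
theorem derivation_bar (D : BarWords (Idx V A) B →ₗ[B] B)
    (hD : ∀ a, D (tensor B β 1 a) = derivation V φ (a 0))
    {y : BarWords (Idx V A) B} (hy : y ∈ ofLength (Idx V A) B 2) : D (bar β ε y) = 0 := by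
  rw [← Submodule.mem_bot B]
  refine map_mem_of_length (D ∘ₗ bar β ε) (fun w hw => ?_) hy
  obtain ⟨i, j, rfl⟩ := List.length_eq_two.1 hw
  have h1 (i) : Finsupp.single [i] (1 : B) = tensor B β 1 fun _ => β i := by
    simp [tensor_succ, tensor_zero, cons_basis_single]
  have h2 (p) : cons B β p (Finsupp.single [] 1) = tensor B β 1 fun _ => p := rfl
  rw [Submodule.mem_bot, LinearMap.comp_apply, ← cons_basis_single B β, bar_cons,
    ← cons_basis_single B β, mulHead_cons, barEnd_cons, mulHead_nil, barEnd_nil, map_zero,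
    add_zero]
  have h3 : Finsupp.single ([] : List (Idx V A)) (ε (β j)) = ε (β j) • Finsupp.single [] 1 := by
    simp
  rw [h3, map_smul, map_add, map_add, map_smul, map_smul, h2, h2, h2, hD, hD, hD,
    derivation_mul, smul_eq_mul, smul_eq_mul]
  generalize ε (β i) * derivation V φ (β j) = x
  generalize ε (β j) * derivation V φ (β i) = y
  calc x + y + y + x = (x + x) + (y + y) := by abel
    _ = 0 := by rw [BooleanRing.add_self, BooleanRing.add_self, add_zero]

/-- The bar complex in lengths `1` and `2`: the cokernel of its differential is free of rank one,
generated by the word `t`. -/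
theorem exists_bar_eq_add (D : BarWords (Idx V A) B →ₗ[B] B)
    (hD : ∀ a, D (tensor B β 1 a) = derivation V φ (a 0))
    {z : BarWords (Idx V A) B} (hz : z ∈ ofLength (Idx V A) B 1) :
    ∃ y ∈ ofLength (Idx V A) B 2,
      bar β ε y = z + D z • cons B β (t V A) (Finsupp.single [] 1) := by
  have hb1 (z) (hz : z ∈ ofLength (Idx V A) B 1) : bar β ε z = 0 := by
    rw [← Submodule.mem_bot B]
    refine map_mem_of_length _ (fun w hw => ?_) hz
    obtain ⟨i, rfl⟩ := List.length_eq_one_iff.1 hw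
    rw [Submodule.mem_bot, ← cons_basis_single B β, bar_cons, mulHead_nil, barEnd_nil, map_zero,
      add_zero, Finsupp.smul_single, smul_eq_mul, mul_one, ZModModule.add_self]
  obtain ⟨x, hx, y, hy, h, -⟩ := exists_homologous_mulHead_t_add φ hz (hb1 z hz)
  have hx0 := barEnd_mem_ofLength β ε hx
  obtain ⟨s, hs⟩ : ∃ s : B, barEnd β ε x = s • Finsupp.single [] 1 := by
    refine ⟨barEnd β ε x [], ?_⟩
    ext w
    cases w with
    | nil => simp
    | cons i w =>
      rw [ofLength, Finsupp.mem_supported'] at hx0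
      rw [hx0 _ (by simp)]
      simp
  have hDt : D (cons B β (t V A) (Finsupp.single [] 1)) = 1 := by
    have h2 : cons B β (t V A) (Finsupp.single [] 1) = tensor B β 1 fun _ => t V A := rfl
    rw [h2, hD, t, derivation_mono]
    simp
  refine ⟨cons B β (t V A) x + y, add_mem (cons_mem_ofLength _ _ hx) hy, ?_⟩
  have hy' : cons B β (t V A) x + y ∈ ofLength (Idx V A) B 2 :=
    add_mem (cons_mem_ofLength _ _ hx) hy
  have h5 : bar β ε (cons B β (t V A) x + y) =
      z + s • cons B β (t V A) (Finsupp.single [] 1) := by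
    rw [map_add, bar_cons_t, hs, map_smul, h]
    abel
  have h6 := derivation_bar φ D hD hy'
  rw [h5, map_add, map_smul, hDt, smul_eq_mul, mul_one] at h6
  have h7 : D z = s := eq_of_sub_eq_zero (by rw [ZModModule.sub_eq_add]; exact h6)
  rw [h5, h7]

/-- A `B`-linear form on the words of length `n + 3` which vanishes on the boundaries is a
coboundary. -/
theorem exists_comp_bar_character {n : ℕ} (F : BarWords (Idx V A) B →ₗ[B] B)
    (hF : ∀ z ∈ ofLength (Idx V A) B (n + 4), F (bar β ε z) = 0) :
    ∃ G : BarWords (Idx V A) B →ₗ[B] B,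
      ∀ z ∈ ofLength (Idx V A) B (n + 3), F z = G (bar β ε z) := by
  have h0 {z : BarWords (Idx V A) B} : z ∈ Finsupp.supported B B (∅ : Set (List (Idx V A))) ↔
      z = 0 := by
    rw [Finsupp.supported_empty, Submodule.mem_bot]
  obtain ⟨D, hD, -⟩ := exists_linearMap_tensor (S := B) β 1
    (MultilinearMap.ofSubsingleton (ZMod 2) (PositivePart V A) B (0 : Fin 1) (derivation V φ))
  have hD' (a) : D (tensor B β 1 a) = derivation V φ (a 0) := by rw [hD]; rfl
  have hy (w : List (Idx V A)) : ∃ y : BarWords (Idx V A) B, w.length = 1 →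
      y ∈ ofLength (Idx V A) B 2 ∧ bar β ε y = Finsupp.single w 1 +
        D (Finsupp.single w 1) • cons B β (t V A) (Finsupp.single [] 1) := by
    by_cases hw : w.length = 1
    · obtain ⟨y, hy⟩ := exists_bar_eq_add φ D hD'
        (hw ▸ single_mem_ofLength 1 : Finsupp.single w (1 : B) ∈ ofLength (Idx V A) B 1)
      exact ⟨y, fun _ => hy⟩
    · exact ⟨0, fun h => absurd h hw⟩
  choose y hy using hy
  let σ₀ : BarWords (Idx V A) B →ₗ[B] BarWords (Idx V A) B := Finsupp.linearCombination B y
  have hσ₀ (z) (hz : z ∈ ofLength (Idx V A) B 1) :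
      bar β ε (σ₀ z) - z - D z • cons B β (t V A) (Finsupp.single [] 1) = 0 := by
    rw [← Submodule.mem_bot B]
    refine map_mem_of_length (bar β ε ∘ₗ σ₀ - LinearMap.id -
      D.smulRight (cons B β (t V A) (Finsupp.single [] 1))) (fun w hw => ?_) hz
    simp [σ₀, (hy w hw).2]
  obtain ⟨σ, hσl, -, hσ⟩ := exists_contraction β ε (∅ : Set (List (Idx V A))) 1 (n + 2)
    (fun z hz => by rw [h0] at *; rw [hz, map_zero])
    ⟨σ₀, fun z hz => map_mem_of_length _ (fun w hw => by simpa [σ₀] using (hy w hw).1) hz,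
      fun z hz => by rw [h0] at *; rw [hz, map_zero],
      fun z hz => by
        have h1 := hσ₀ _ (bar_mem_ofLength β ε hz)
        rw [derivation_bar φ D hD' hz, zero_smul, sub_zero] at h1
        rw [h0, map_sub, ← neg_sub, h1, neg_zero]⟩
    (fun m hm _ z hz hb => by
      obtain ⟨m, rfl⟩ : ∃ l, m = l + 2 := ⟨m - 2, by omega⟩
      obtain ⟨y, hy, h⟩ := bar_character_exact φ hz (h0.1 hb)
      exact ⟨y, hy, by rw [h0, h, sub_self]⟩) (n + 2) (by omega) le_rfl
  refine ⟨F ∘ₗ σ, fun z hz => ?_⟩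
  obtain ⟨y, hy, h⟩ := bar_character_exact φ
    (sub_mem hz (hσl _ (bar_mem_ofLength β ε hz))) (h0.1 (hσ z hz))
  have h1 := hF y hy
  rw [h, map_sub] at h1
  exact sub_eq_zero.1 h1

end BarWords

/-! ### Weights and the Koszul property -/

namespace BarWords

open PositivePart

variable {V A S : Type*} [AddCommGroup V] [Module (ZMod 2) V] [BooleanRing A]
  [CommRing S] [Algebra (ZMod 2) S]

/-- The weight of a word: the sum of the degrees of its letters. -/
def weight (w : List (Idx V A)) : ℕ := (w.map deg).sum

@[simp] theorem weight_nil : weight ([] : List (Idx V A)) = 0 := rfl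

@[simp] theorem weight_cons (i : Idx V A) (w : List (Idx V A)) :
    weight (i :: w) = deg i + weight w := by simp [weight]

theorem length_le_weight (w : List (Idx V A)) : w.length ≤ weight w := by
  induction w with
  | nil => exact le_rfl
  | cons i w ih => have := deg_pos i; simp only [List.length_cons, weight_cons]; omega

local notation "β" => basis V A

theorem mulHead_zero_weight (i : Idx V A) (w : List (Idx V A)) :
    mulHead β (0 : _ →ₙₐ[ZMod 2] S) (β i) (Finsupp.single w 1) ∈
      Finsupp.supported S S {u | weight u = deg i + weight w} := by
  cases w with
  | nil => simp
  | cons j w =>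
    rw [← cons_basis_single S β, mulHead_cons]
    refine cons_mem β (X := {w}) (fun l hl u hu => ?_) (Finsupp.single_mem_supported _ _ rfl)
    rw [Set.mem_singleton_iff.1 hu]
    simp only [Set.mem_ofPred_eq, weight_cons, deg_eq_of_repr_mul_ne_zero hl, add_assoc]

/-- The bar differential with trivial coefficients preserves weights. -/
theorem barEnd_zero_weight (w : List (Idx V A)) :
    barEnd β (0 : _ →ₙₐ[ZMod 2] S) (Finsupp.single w 1) ∈
      Finsupp.supported S S {u | weight u = weight w} := by
  induction w with
  | nil => simp
  | cons i w ih =>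
    rw [← cons_basis_single S β, barEnd_cons, weight_cons]
    refine add_mem (mulHead_zero_weight i w) (cons_mem β (fun l hl u hu => ?_) ih)
    have h := deg_eq_of_repr_ne_zero (basis_mem_grading i) hl
    rw [PNat.mk_coe] at h
    simp only [Set.mem_ofPred_eq] at hu
    simp only [Set.mem_ofPred_eq, weight_cons, h, hu]

theorem barEnd_sub_weight (ε : PositivePart V A →ₙₐ[ZMod 2] S) (w : List (Idx V A)) :
    barEnd β ε (Finsupp.single w 1) - barEnd β 0 (Finsupp.single w 1) ∈
      Finsupp.supported S S {u | weight u < weight w} := by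
  induction w with
  | nil => simp
  | cons i w ih =>
    rw [← cons_basis_single S β, barEnd_cons, barEnd_cons, add_sub_add_comm, ← map_sub]
    refine add_mem ?_ (cons_mem β (fun l hl u hu => ?_) ih)
    · cases w with
      | nil =>
        rw [mulHead_nil, mulHead_nil]
        simp only [NonUnitalAlgHom.zero_apply, Finsupp.single_zero, sub_zero]
        refine Finsupp.single_mem_supported _ _ ?_
        have := deg_pos i
        simpa using this
      | cons j w =>
        rw [← cons_basis_single S β, mulHead_cons, mulHead_cons, sub_self]
        exact zero_mem _
    · have h := deg_eq_of_repr_ne_zero (basis_mem_grading i) hl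
      rw [PNat.mk_coe] at h
      simp only [Set.mem_ofPred_eq] at hu
      simp only [Set.mem_ofPred_eq, weight_cons, h]
      omega

/-- The coefficient actions in the bar differential lower the weight. -/
theorem bar_sub_barEnd_zero_weight (ε : PositivePart V A →ₙₐ[ZMod 2] S) (w : List (Idx V A)) :
    bar β ε (Finsupp.single w 1) - barEnd β 0 (Finsupp.single w 1) ∈
      Finsupp.supported S S {u | weight u < weight w} := by
  rw [bar_apply, add_sub_right_comm]
  refine add_mem (barEnd_sub_weight ε w) ?_
  cases w with
  | nil => simp
  | cons i w =>
    rw [← cons_basis_single S β, barStart_cons]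
    refine Submodule.smul_mem _ _ (Finsupp.single_mem_supported _ _ ?_)
    have := deg_pos i
    simp only [Set.mem_ofPred_eq, weight_cons]
    omega

theorem bar_weight_lt (ε : PositivePart V A →ₙₐ[ZMod 2] S) (m : ℕ) {z : BarWords (Idx V A) S}
    (hz : z ∈ Finsupp.supported S S {u : List (Idx V A) | weight u < m}) :
    bar β ε z ∈ Finsupp.supported S S {u : List (Idx V A) | weight u < m} := by
  refine map_mem_of_single _ (fun w hw => ?_) hz
  have h1 : bar β ε (Finsupp.single w 1) - barEnd β 0 (Finsupp.single w 1) ∈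
      Finsupp.supported S S {u : List (Idx V A) | weight u < m} :=
    Finsupp.supported_mono (fun u hu => lt_trans (Set.mem_ofPred_eq .. ▸ hu) hw)
      (bar_sub_barEnd_zero_weight ε w)
  have h2 : barEnd β 0 (Finsupp.single w 1) ∈
      Finsupp.supported S S {u : List (Idx V A) | weight u < m} :=
    Finsupp.supported_mono (fun u hu => lt_of_eq_of_lt (Set.mem_ofPred_eq .. ▸ hu) hw)
      (barEnd_zero_weight (S := S) w)
  simpa using add_mem h1 h2

/-- The combination of the words `w` for the words `i :: w` in a given combination. -/
noncomputable def tail (i : Idx V A) : BarWords (Idx V A) S →ₗ[S] BarWords (Idx V A) S :=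
  Finsupp.lcomapDomain (List.cons i) fun _ _ h => (List.cons.inj h).2

theorem tail_apply (i : Idx V A) (z : BarWords (Idx V A) S) (w : List (Idx V A)) :
    tail i z w = z (i :: w) := rfl

theorem tail_nil (i : Idx V A) : tail i (Finsupp.single [] (1 : S)) = 0 := by
  ext w; simp [tail_apply]

theorem tail_cons (i : Idx V A) (p : PositivePart V A) (z : BarWords (Idx V A) S) :
    tail i (cons S β p z) = (basis V A).repr p i • z := by
  have : (LinearMap.llcomp S _ _ _ (tail i)).restrictScalars (ZMod 2) ∘ₗ cons S β =
      LinearMap.toSpanSingleton (ZMod 2) _ (LinearMap.id : BarWords (Idx V A) S →ₗ[S] _) ∘ₗ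
        (β).coord i := by
    refine cons_ext β fun j w => ?_
    simp only [LinearMap.comp_apply, LinearMap.restrictScalars_apply, LinearMap.llcomp_apply,
      LinearMap.toSpanSingleton_apply, Module.Basis.coord_apply, LinearMap.smul_apply,
      LinearMap.id_apply]
    rw [cons_basis_single]
    ext u
    rw [tail_apply, Module.Basis.repr_self, Finsupp.smul_apply]
    by_cases h : j = i
    · subst h
      classical
      rw [Finsupp.single_eq_same, one_smul, Finsupp.single_apply, Finsupp.single_apply]
      simp only [List.cons.injEq, true_and]
    · rw [Finsupp.single_eq_of_ne (Ne.symm h), zero_smul, Finsupp.single_eq_of_ne]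
      exact fun h' => h (List.cons.inj h').1.symm
  exact LinearMap.congr_fun (LinearMap.congr_fun this p) z

theorem tail_mulHead_zero {i : Idx V A} (hi : deg i = 1) (j : Idx V A)
    (z : BarWords (Idx V A) S) : tail i (mulHead β 0 (β j) z) = 0 := by
  have : tail i ∘ₗ mulHead β (0 : _ →ₙₐ[ZMod 2] S) (β j) = 0 := by
    refine linearMap_ext β ?_ fun l w => ?_
    · simp
    · simp only [LinearMap.comp_apply, mulHead_cons, tail_cons, LinearMap.zero_apply]
      have h : (basis V A).repr (β j * β l) i = 0 := by
        by_contra h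
        have h1 := deg_eq_of_repr_mul_ne_zero h
        have h2 := deg_pos j
        have h3 := deg_pos l
        omega
      rw [h, zero_smul]
  exact LinearMap.congr_fun this z

/-- A first letter of degree one is not a product, so that the differential acts on its tail. -/
theorem tail_barEnd_zero {i : Idx V A} (hi : deg i = 1) (z : BarWords (Idx V A) S) :
    tail i (barEnd β 0 z) = barEnd β 0 (tail i z) := by
  have : tail i ∘ₗ barEnd β (0 : _ →ₙₐ[ZMod 2] S) = barEnd β 0 ∘ₗ tail i := by
    refine linearMap_ext β ?_ fun l w => ?_
    · simp only [LinearMap.comp_apply, barEnd_nil, map_zero, tail_nil]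
    · simp only [LinearMap.comp_apply, barEnd_cons, map_add, tail_mulHead_zero hi, tail_cons,
        zero_add]
      rw [← algebraMap_smul S, ← algebraMap_smul S ((basis V A).repr (β l) i) (Finsupp.single w 1),
        map_smul]
  exact LinearMap.congr_fun this z

/-- Division of a first letter in `A` by `t`. -/
def divHead : List (Idx V A) → List (Idx V A)
  | Sum.inr ⟨n, j⟩ :: w => Sum.inr ⟨n - 1, j⟩ :: w
  | w => w

theorem divHead_inr (n j) (w : List (Idx V A)) :
    divHead (Sum.inr ⟨n, j⟩ :: w) = Sum.inr ⟨n - 1, j⟩ :: w := rfl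

theorem mulHead_t_inr (n j) (w : List (Idx V A)) (ε : PositivePart V A →ₙₐ[ZMod 2] S) :
    mulHead β ε (t V A) (Finsupp.single (Sum.inr ⟨n, j⟩ :: w) 1) =
      Finsupp.single (Sum.inr ⟨n + 1, j⟩ :: w) 1 := by
  rw [← cons_basis_single S β, mulHead_cons, t_mul_basis_inr, cons_basis_single]

theorem barEnd_zero_head_inr {z : BarWords (Idx V A) S}
    (hz : z ∈ Finsupp.supported S S {w : List (Idx V A) | ∃ x u, w = Sum.inr x :: u}) :
    barEnd β 0 z ∈ Finsupp.supported S S {w : List (Idx V A) | ∃ x u, w = Sum.inr x :: u} := by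
  refine map_mem_of_single _ ?_ hz
  rintro _ ⟨x, w, rfl⟩
  rw [← cons_basis_single S β, barEnd_cons]
  refine add_mem ?_ (cons_mem β (X := Set.univ) (fun l hl u _ => ?_) (by simp))
  · cases w with
    | nil => simp
    | cons j w =>
      rw [← cons_basis_single S β, mulHead_cons]
      refine cons_mem β (X := Set.univ) (fun l hl u _ => ?_) (by simp)
      cases l with
      | inl j => exact absurd (repr_mul_inl _ _ j) hl
      | inr x => exact ⟨x, u, rfl⟩
  · rw [Module.Basis.repr_self, Finsupp.single_apply_ne_zero] at hl
    exact ⟨x, u, by rw [hl.1]⟩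

/-- `μ_t` is injective on the combinations of words with first letter in `A`. -/
theorem eq_zero_of_mulHead_t_eq_zero {z : BarWords (Idx V A) S}
    (hz : z ∈ Finsupp.supported S S {w : List (Idx V A) | ∃ x u, w = Sum.inr x :: u})
    (ε : PositivePart V A →ₙₐ[ZMod 2] S) (h : mulHead β ε (t V A) z = 0) : z = 0 := by
  have h1 : Finsupp.lmapDomain S S divHead (mulHead β ε (t V A) z) - z = 0 := by
    rw [← Submodule.mem_bot S]
    refine map_mem_of_single (Finsupp.lmapDomain S S divHead ∘ₗ mulHead β ε (t V A) -
      LinearMap.id) ?_ hz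
    rintro _ ⟨⟨n, j⟩, w, rfl⟩
    rw [Submodule.mem_bot, LinearMap.sub_apply, LinearMap.comp_apply, mulHead_t_inr,
      LinearMap.id_apply, Finsupp.lmapDomain_apply, Finsupp.mapDomain_single, divHead_inr,
      sub_eq_zero]
    congr 4
    exact PNat.eq (by rw [PNat.sub_coe, if_pos (PNat.lt_add_left 1 n)]; simp)
  rw [h, map_zero, zero_sub, neg_eq_zero] at h1
  exact h1

/-- The bar complex with trivial coefficients is exact in the weights larger than the length:
`V_* ⊓ A_*` is a Koszul algebra. Up to a boundary the first letters of degree one of a cycle can be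
removed, by induction on the length; the other first letters are products with `t`. -/
theorem exists_barEnd_zero_eq {n m : ℕ} {z : BarWords (Idx V A) S}
    (hz : z ∈ Finsupp.supported S S
      {w : List (Idx V A) | w.length = n ∧ n < weight w ∧ weight w ≤ m})
    (hb : barEnd β 0 z = 0) :
    ∃ y ∈ Finsupp.supported S S {w : List (Idx V A) | w.length = n + 1 ∧ weight w ≤ m},
      barEnd β 0 y = z := by
  classical
  induction n generalizing m z with
  | zero =>
    refine ⟨0, zero_mem _, ?_⟩
    rw [map_zero, eq_comm, ← Finsupp.support_eq_empty, Finset.eq_empty_iff_forall_notMem]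
    intro w hw
    have h := (Finsupp.mem_supported _ _).1 hz hw
    rw [Set.mem_ofPred_eq, List.length_eq_zero_iff] at h
    obtain ⟨rfl, h, -⟩ := h
    simp at h
  | succ n ih =>
    have hz' (w) (h : z w ≠ 0) : w.length = n + 1 ∧ n + 1 < weight w ∧ weight w ≤ m :=
      (Finsupp.mem_supported _ _).1 hz (Finsupp.mem_support_iff.2 h)
    have hy (i : Idx V A) : ∃ y : BarWords (Idx V A) S, deg i = 1 →
        y ∈ Finsupp.supported S S {w : List (Idx V A) | w.length = n + 1 ∧ weight w + 1 ≤ m} ∧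
          barEnd β 0 y = tail i z := by
      by_cases hi : deg i = 1
      · obtain ⟨y, hy, h⟩ := ih (z := tail i z) (m := m - 1) (fun w hw => by
          have hw' : tail i z w ≠ 0 := Finsupp.mem_support_iff.1 hw
          have := hz' (i :: w) hw'
          simp only [List.length_cons, weight_cons, hi] at this
          refine ⟨?_, ?_, ?_⟩ <;> omega) (by rw [← tail_barEnd_zero hi, hb, map_zero])
        by_cases hm : m = 0
        · refine ⟨0, fun _ => ⟨zero_mem _, ?_⟩⟩
          rw [map_zero]
          ext w
          by_contra hw
          have := hz' (i :: w) (Ne.symm hw)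
          omega
        · refine ⟨y, fun _ => ⟨Finsupp.supported_mono (fun w hw => ?_) hy, h⟩⟩
          exact ⟨hw.1, by have := hw.2; omega⟩
      · exact ⟨0, fun h => absurd h hi⟩
    choose y hy using hy
    let I : Finset (Idx V A) := (z.support.biUnion fun w => w.toFinset).filter fun i => deg i = 1
    let Y : BarWords (Idx V A) S := ∑ i ∈ I, cons S β (β i) (y i)
    have hY : Y ∈ Finsupp.supported S S
        {w : List (Idx V A) | w.length = n + 2 ∧ weight w ≤ m} := by
      refine Submodule.sum_mem _ fun i hi => ?_
      have hi := (Finset.mem_filter.1 hi).2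
      refine cons_mem β (fun l hl w hw => ?_) (hy i hi).1
      rw [Module.Basis.repr_self, Finsupp.single_apply_ne_zero] at hl
      rw [hl.1]
      have := hw.1
      have := hw.2
      constructor
      · simp only [List.length_cons]; omega
      · simp only [weight_cons]; omega
    have htail (j : Idx V A) (hj : deg j = 1) : tail j (barEnd β 0 Y) = tail j z := by
      rw [tail_barEnd_zero hj]
      have h1 : tail j Y = if j ∈ I then y j else 0 := by
        simp only [Y, map_sum, tail_cons, Module.Basis.repr_self, Finsupp.single_apply, ite_smul,
          one_smul, zero_smul, Finset.sum_ite_eq']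
      rw [h1]
      split_ifs with h
      · exact (hy j hj).2
      · rw [map_zero, eq_comm]
        ext w
        by_contra hw
        refine h (Finset.mem_filter.2 ⟨Finset.mem_biUnion.2 ⟨j :: w, ?_, by simp⟩, hj⟩)
        exact Finsupp.mem_support_iff.2 hw
    set z₂ := z - barEnd β 0 Y with hz₂
    have hz₂b : barEnd β 0 z₂ = 0 := by rw [hz₂, map_sub, hb, barEnd_barEnd, sub_zero]
    have hz₂s : z₂ ∈ Finsupp.supported S S {w : List (Idx V A) |
        w.length = n + 1 ∧ weight w ≤ m ∧ ∃ n j u, w = Sum.inr ⟨n + 1, j⟩ :: u} := by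
      have h1 : z₂ ∈ Finsupp.supported S S
          {w : List (Idx V A) | w.length = n + 1 ∧ weight w ≤ m} := by
        refine sub_mem (Finsupp.supported_mono (fun w hw => And.intro hw.1 hw.2.2) hz)
          (map_mem_of_single _ (fun w hw => ?_) hY)
        have h2 := barEnd_mem_ofLength β (0 : _ →ₙₐ[ZMod 2] S)
          (hw.1 ▸ single_mem_ofLength 1 : Finsupp.single w (1 : S) ∈ ofLength _ S (n + 2))
        have h3 := barEnd_zero_weight (S := S) w
        exact fun u hu => And.intro (h2 hu) ((h3 hu).trans_le hw.2)
      intro w hw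
      obtain ⟨hwl, hwm⟩ := h1 hw
      refine ⟨hwl, hwm, ?_⟩
      cases w with
      | nil => simp at hwl
      | cons i u =>
        have hi : deg i ≠ 1 := fun hi => by
          rw [Finset.mem_coe, Finsupp.mem_support_iff, ← tail_apply, hz₂, map_sub, htail i hi,
            sub_self] at hw
          exact hw rfl
        cases i with
        | inl j => exact absurd rfl hi
        | inr x =>
          obtain ⟨d, j⟩ := x
          obtain ⟨d, rfl⟩ := PNat.exists_eq_succ_of_ne_one (n := d) fun h => hi (by rw [h]; rfl)
          exact ⟨d, j, u, rfl⟩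
    let x : BarWords (Idx V A) S := Finsupp.lmapDomain S S divHead z₂
    have hd (d : ℕ+) : d + 1 - 1 = d :=
      PNat.eq (by rw [PNat.sub_coe, if_pos (PNat.lt_add_left 1 d)]; simp)
    have hx : x ∈ Finsupp.supported S S {w : List (Idx V A) |
        (w.length = n + 1 ∧ weight w + 1 ≤ m) ∧ ∃ x u, w = Sum.inr x :: u} := by
      refine map_mem_of_single _ ?_ hz₂s
      rintro _ ⟨hl, hm, d, j, u, rfl⟩
      rw [Finsupp.lmapDomain_apply, Finsupp.mapDomain_single, divHead_inr, hd]
      refine Finsupp.single_mem_supported _ _ ⟨⟨by simpa using hl, ?_⟩, _, u, rfl⟩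
      simp only [weight_cons, deg, PNat.add_coe, PNat.one_coe] at hm ⊢
      omega
    have hxz : mulHead β 0 (t V A) x = z₂ := by
      rw [← sub_eq_zero, ← Submodule.mem_bot S]
      refine map_mem_of_single (mulHead β 0 (t V A) ∘ₗ Finsupp.lmapDomain S S divHead -
        LinearMap.id) ?_ hz₂s
      rintro _ ⟨hl, hm, d, j, u, rfl⟩
      rw [Submodule.mem_bot, LinearMap.sub_apply, LinearMap.comp_apply, Finsupp.lmapDomain_apply,
        Finsupp.mapDomain_single, divHead_inr, hd, mulHead_t_inr, LinearMap.id_apply, sub_self]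
    have hxb : barEnd β 0 x = 0 := by
      refine eq_zero_of_mulHead_t_eq_zero
        (barEnd_zero_head_inr (Finsupp.supported_mono (fun w hw => hw.2) hx)) 0 ?_
      rw [← barEnd_mulHead, hxz, hz₂b]
    refine ⟨Y + cons S β (t V A) x, add_mem hY (cons_mem β (fun l hl w hw => ?_) hx), ?_⟩
    · have h1 := repr_t_ne_zero hl
      have h2 := hw.1.1
      have h3 := hw.1.2
      constructor
      · simp only [List.length_cons]; omega
      · simp only [weight_cons]; omega
    · rw [map_add, barEnd_cons, hxb, hxz, map_zero, add_zero, hz₂, add_sub_cancel]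

/-- Modulo the words of weight less than `w`, a cycle of length `n ≤ w` is homologous to a
combination of words of weight `n = w`. -/
theorem exists_sub_bar_weight_lt (ε : PositivePart V A →ₙₐ[ZMod 2] S) {n w : ℕ}
    (m : ℕ) {z : BarWords (Idx V A) S} (hz : z ∈ ofLength (Idx V A) S n)
    (hzm : z ∈ Finsupp.supported S S {u : List (Idx V A) | weight u < m})
    (hb : bar β ε z ∈ Finsupp.supported S S {u : List (Idx V A) | weight u < w}) :
    ∃ y ∈ ofLength (Idx V A) S (n + 1), z - bar β ε y ∈
      Finsupp.supported S S {u : List (Idx V A) | weight u < max w (n + 1)} := by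
  classical
  induction m generalizing z with
  | zero =>
    exact ⟨0, zero_mem _, by
      rw [map_zero, sub_zero]; exact Finsupp.supported_mono (fun u hu => absurd hu (by simp)) hzm⟩
  | succ m ih =>
    by_cases hm : m < max w (n + 1)
    · exact ⟨0, zero_mem _, by
        rw [map_zero, sub_zero]
        refine Finsupp.supported_mono (fun u hu => ?_) hzm
        simp only [Set.mem_ofPred_eq] at hu ⊢
        omega⟩
    -- the part of top weight is a cycle for trivial coefficients
    set z₁ := z.filter fun u => weight u = m with hz₁
    set z₀ := z.filter fun u => ¬ weight u = m with hz₀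
    have hsum : z = z₁ + z₀ := (Finsupp.filter_add_filter_not _ _).symm
    have hz₁s : z₁ ∈ Finsupp.supported S S
        {u : List (Idx V A) | u.length = n ∧ weight u = m} := by
      intro u hu
      rw [Finset.mem_coe, Finsupp.support_filter, Finset.mem_filter] at hu
      exact ⟨hz hu.1, hu.2⟩
    have hz₀s : z₀ ∈ Finsupp.supported S S
        {u : List (Idx V A) | u.length = n ∧ weight u < m} := by
      intro u hu
      rw [Finset.mem_coe, Finsupp.support_filter, Finset.mem_filter] at hu
      have := hzm hu.1
      simp only [Set.mem_ofPred_eq] at this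
      exact ⟨hz hu.1, by omega⟩
    have hR {x : BarWords (Idx V A) S}
        (hx : x ∈ Finsupp.supported S S {u : List (Idx V A) | weight u < m + 1}) :
        bar β ε x - barEnd β 0 x ∈ Finsupp.supported S S {u : List (Idx V A) | weight u < m} := by
      refine map_mem_of_single (bar β ε - barEnd β 0) (fun u hu => ?_) hx
      refine Finsupp.supported_mono (fun v hv => ?_) (bar_sub_barEnd_zero_weight ε u)
      simp only [Set.mem_ofPred_eq] at hu hv ⊢
      omega
    have hcyc : barEnd β 0 z₁ = 0 := by
      have h1 : barEnd β 0 z₁ ∈ Finsupp.supported S S {u : List (Idx V A) | weight u = m} :=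
        map_mem_of_single _ (fun u hu => hu.2 ▸ barEnd_zero_weight (S := S) u) hz₁s
      have h2 : barEnd β 0 z₁ ∈ Finsupp.supported S S {u : List (Idx V A) | weight u < m} := by
        have h3 : barEnd β 0 z₁ =
            bar β ε z - bar β ε z₀ - (bar β ε z₁ - barEnd β 0 z₁) := by
          rw [hsum, map_add]; abel
        rw [h3]
        refine sub_mem (sub_mem ?_ ?_) (hR ?_)
        · refine Finsupp.supported_mono (fun u hu => ?_) hb
          simp only [Set.mem_ofPred_eq] at hu ⊢
          omega
        · exact bar_weight_lt ε m (Finsupp.supported_mono (fun u hu => hu.2) hz₀s)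
        · exact Finsupp.supported_mono (fun u hu => Nat.lt_succ_of_le hu.2.le) hz₁s
      rw [← Finsupp.support_eq_empty, Finset.eq_empty_iff_forall_notMem]
      intro u hu
      exact absurd (h1 hu) (ne_of_lt (h2 hu))
    obtain ⟨y, hy, hyz⟩ := exists_barEnd_zero_eq (n := n) (m := m)
      (Finsupp.supported_mono (fun u hu => And.intro hu.1 (And.intro (by
        have := hu.2
        omega) hu.2.le)) hz₁s) hcyc
    have hyl : y ∈ ofLength (Idx V A) S (n + 1) :=
      Finsupp.supported_mono (fun u hu => hu.1) hy
    have hym := hR (Finsupp.supported_mono (fun u hu => Nat.lt_succ_of_le hu.2) hy)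
    rw [hyz] at hym
    obtain ⟨y', hy', h⟩ := ih (z := z - bar β ε y) (sub_mem hz (bar_mem_ofLength β ε hyl))
      (by
        have h1 : z - bar β ε y = z₀ - (bar β ε y - z₁) := by rw [hsum]; abel
        rw [h1]
        exact sub_mem (Finsupp.supported_mono (fun u hu => hu.2) hz₀s) hym)
      (by rw [map_sub, bar_bar, sub_zero]; exact hb)
    exact ⟨y + y', add_mem hyl hy', by rwa [map_add, ← sub_sub]⟩

theorem exists_weight_lt (z : BarWords (Idx V A) S) :
    ∃ m, z ∈ Finsupp.supported S S {u : List (Idx V A) | weight u < m} :=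
  ⟨z.support.sup weight + 1, fun _ hu => Nat.lt_succ_of_le (Finset.le_sup (f := weight) hu)⟩

/-- An `S`-linear form on the words of length `n + 1 ≤ w` which vanishes on boundaries, on the words
of weight less than `w`, and on the cycles of weight `n + 1`, is a coboundary. -/
theorem exists_comp_bar_of_weight {M : Type*} [AddCommGroup M] [Module S M]
    (ε : PositivePart V A →ₙₐ[ZMod 2] S) {n w : ℕ} (hn : n < w)
    (F : BarWords (Idx V A) S →ₗ[S] M)
    (hF : ∀ z ∈ ofLength (Idx V A) S (n + 2), F (bar β ε z) = 0)
    (hFw : ∀ u : List (Idx V A), u.length = n + 1 → weight u < w → F (Finsupp.single u 1) = 0)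
    (hFz : ∀ z ∈ Finsupp.supported S S
      {u : List (Idx V A) | u.length = n + 1 ∧ weight u = n + 1},
      barEnd β 0 z = 0 → w = n + 1 → F z = 0) :
    ∃ G : BarWords (Idx V A) S →ₗ[S] M,
      ∀ z ∈ ofLength (Idx V A) S (n + 1), F z = G (bar β ε z) := by
  obtain ⟨σ, hσl, -, hσ⟩ := exists_contraction β ε {u : List (Idx V A) | weight u < w} 0 n
    (fun z hz => bar_weight_lt ε w hz)
    ⟨0, fun _ _ => zero_mem _, fun _ _ => zero_mem _, fun z hz => by
      rw [LinearMap.zero_apply, sub_zero]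
      intro u hu
      have h := bar_mem_ofLength β ε hz hu
      rw [Set.mem_ofPred_eq, List.length_eq_zero_iff] at h
      rw [h]
      exact Nat.zero_lt_of_lt hn⟩
    (fun m _ hm z hz hb => by
      obtain ⟨m', hm'⟩ := exists_weight_lt z
      obtain ⟨y, hy, h⟩ := exists_sub_bar_weight_lt ε m' hz hm' hb
      rw [max_eq_left (by omega)] at h
      exact ⟨y, hy, h⟩) n (Nat.zero_le _) le_rfl
  refine ⟨F ∘ₗ σ, fun z hz => ?_⟩
  set x := z - σ (bar β ε z) with hx
  have hxl : x ∈ ofLength (Idx V A) S (n + 1) := sub_mem hz (hσl _ (bar_mem_ofLength β ε hz))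
  obtain ⟨m, hm⟩ := exists_weight_lt x
  obtain ⟨y, hy, h⟩ := exists_sub_bar_weight_lt ε m hxl hm (hσ z hz)
  have hx'l : x - bar β ε y ∈ ofLength (Idx V A) S (n + 1) :=
    sub_mem hxl (bar_mem_ofLength β ε hy)
  have hF0 : F (x - bar β ε y) = 0 := by
    by_cases hwn : w = n + 1
    · have hs : x - bar β ε y ∈ Finsupp.supported S S
          {u : List (Idx V A) | u.length = n + 1 ∧ weight u = n + 1} := by
        intro u hu
        have h1 := hx'l hu
        have h2 := h hu
        have h3 := length_le_weight u
        simp only [Set.mem_ofPred_eq] at h1 h2 ⊢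
        omega
      refine hFz _ hs ?_ hwn
      have h1 : barEnd β 0 (x - bar β ε y) ∈
          Finsupp.supported S S {u : List (Idx V A) | weight u = w} :=
        map_mem_of_single _ (fun u hu => by
          rw [hwn, ← hu.2]; exact barEnd_zero_weight (S := S) u) hs
      have h2 : barEnd β 0 (x - bar β ε y) ∈
          Finsupp.supported S S {u : List (Idx V A) | weight u < w} := by
        have h3 : bar β ε (x - bar β ε y) - barEnd β 0 (x - bar β ε y) ∈
            Finsupp.supported S S {u : List (Idx V A) | weight u < w} :=
          map_mem_of_single (bar β ε - barEnd β 0) (fun u hu => by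
            rw [hwn, ← hu.2]; exact bar_sub_barEnd_zero_weight ε u) hs
        have h4 : bar β ε (x - bar β ε y) ∈
            Finsupp.supported S S {u : List (Idx V A) | weight u < w} := by
          rw [map_sub, bar_bar, sub_zero]
          exact hσ z hz
        simpa using sub_mem h4 h3
      rw [← Finsupp.support_eq_empty, Finset.eq_empty_iff_forall_notMem]
      intro u hu
      exact absurd (h1 hu) (ne_of_lt (h2 hu))
    · rw [← Submodule.mem_bot S]
      refine map_mem_of_single (X := {u | u.length = n + 1 ∧ weight u < w}) F
        (fun u hu => hFw u hu.1 hu.2) (fun u hu => ?_)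
      have h1 := hx'l hu
      have h2 := h hu
      simp only [Set.mem_ofPred_eq] at h1 h2 ⊢
      omega
  rw [map_sub, hF y hy, sub_zero, hx, map_sub] at hF0
  exact sub_eq_zero.1 hF0

end BarWords

/-! ### Cochains of top weight and orthogonal idempotents -/

namespace BarWords

section Slots

variable {P ι S : Type*} [NonUnitalCommRing P] [Module (ZMod 2) P] [IsScalarTower (ZMod 2) P P]
  [SMulCommClass (ZMod 2) P P] [CommRing S] [Algebra (ZMod 2) S] (β : Module.Basis ι (ZMod 2) P)

/-- The endomorphism applying `E` to the first letter. -/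
noncomputable def mapHead (E : P →ₗ[ZMod 2] P) : BarWords ι S →ₗ[S] BarWords ι S :=
  Finsupp.linearCombination S fun w => match w with
    | [] => 0
    | i :: w => cons S β (E (β i)) (Finsupp.single w 1)

theorem mapHead_nil (E : P →ₗ[ZMod 2] P) (s : S) :
    mapHead β E (Finsupp.single [] s) = 0 := by
  simp [mapHead]

theorem mapHead_cons (E : P →ₗ[ZMod 2] P) (p : P) (w : BarWords ι S) :
    mapHead β E (cons S β p w) = cons S β (E p) w := by
  have : (LinearMap.llcomp S _ _ _ (mapHead β E)).restrictScalars (ZMod 2) ∘ₗ cons S β =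
      cons S β ∘ₗ E := by
    refine cons_ext β fun i w => ?_
    simp only [LinearMap.comp_apply, LinearMap.restrictScalars_apply, LinearMap.llcomp_apply]
    rw [cons_basis_single]
    simp [mapHead]
  exact LinearMap.congr_fun (LinearMap.congr_fun this p) w

/-- The value of `mapLast` on a word. -/
noncomputable def mapLastWord (E : P →ₗ[ZMod 2] P) : List ι → BarWords ι S
  | [] => 0
  | i :: w => cons S β (β i) (mapLastWord E w) +
      (Finsupp.single w (1 : S)) [] • cons S β (E (β i)) (Finsupp.single [] 1)

/-- The endomorphism applying `E` to the last letter. -/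
noncomputable def mapLast (E : P →ₗ[ZMod 2] P) : BarWords ι S →ₗ[S] BarWords ι S :=
  Finsupp.linearCombination S (mapLastWord β E)

theorem mapLast_nil (E : P →ₗ[ZMod 2] P) (s : S) :
    mapLast β E (Finsupp.single [] s) = 0 := by
  simp [mapLast, mapLastWord]

theorem mapLast_cons (E : P →ₗ[ZMod 2] P) (p : P) (w : BarWords ι S) :
    mapLast β E (cons S β p w) =
      cons S β p (mapLast β E w) + w [] • cons S β (E p) (Finsupp.single [] 1) := by
  let f : P →ₗ[ZMod 2] (BarWords ι S →ₗ[S] BarWords ι S) :=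
    { toFun := fun p => (Finsupp.lapply []).smulRight (cons S β (E p) (Finsupp.single [] 1))
      map_add' := fun p q => by ext; simp
      map_smul' := fun c p => by ext; simp }
  have : (LinearMap.llcomp S _ _ _ (mapLast β E)).restrictScalars (ZMod 2) ∘ₗ cons S β =
      (LinearMap.lcomp S _ (mapLast β E)).restrictScalars (ZMod 2) ∘ₗ cons S β + f := by
    refine cons_ext β fun i w => ?_
    simp only [LinearMap.comp_apply, LinearMap.restrictScalars_apply, LinearMap.llcomp_apply,
      LinearMap.lcomp_apply, LinearMap.add_apply]
    rw [cons_basis_single]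
    simp [mapLast, mapLastWord, f]
  exact LinearMap.congr_fun (LinearMap.congr_fun this p) w

theorem cons_apply_nil (p : P) (w : BarWords ι S) : cons S β p w [] = 0 := by
  have h : cons S β p w ∈ Finsupp.supported S S {w : List ι | w ≠ []} :=
    cons_mem β (X := Set.univ) (fun i _ u _ => List.cons_ne_nil i u) (by simp)
  rw [Finsupp.mem_supported'] at h
  exact h _ (by simp)

theorem mapLast_apply_nil (E : P →ₗ[ZMod 2] P) (w : BarWords ι S) : mapLast β E w [] = 0 := by
  have : Finsupp.lapply [] ∘ₗ mapLast β E = (0 : BarWords ι S →ₗ[S] S) := by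
    refine linearMap_ext β ?_ fun i w => ?_
    · simp [mapLast_nil]
    · simp [mapLast_cons, cons_apply_nil]
  exact LinearMap.congr_fun this w

theorem mulHead_zero_apply_nil (p : P) (w : BarWords ι S) : mulHead β 0 p w [] = 0 := by
  have : Finsupp.lapply [] ∘ₗ mulHead β (0 : _ →ₙₐ[ZMod 2] S) p = 0 := by
    refine linearMap_ext β ?_ fun i w => ?_
    · simp
    · simp [cons_apply_nil]
  exact LinearMap.congr_fun this w

theorem barEnd_zero_apply_nil (w : BarWords ι S) : barEnd β 0 w [] = 0 := by
  have : Finsupp.lapply [] ∘ₗ barEnd β (0 : _ →ₙₐ[ZMod 2] S) = 0 := by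
    refine linearMap_ext β ?_ fun i w => ?_
    · simp
    · simp [cons_apply_nil, mulHead_zero_apply_nil]
  exact LinearMap.congr_fun this w

variable {E : P →ₗ[ZMod 2] P}

theorem barEnd_zero_mapHead (hE : ∀ p q, E (p * q) = E p * q) (w : BarWords ι S) :
    barEnd β 0 (mapHead β E w) = mapHead β E (barEnd β 0 w) := by
  have h (p : P) : mapHead β E ∘ₗ mulHead β (0 : _ →ₙₐ[ZMod 2] S) p = mulHead β 0 (E p) := by
    refine linearMap_ext β ?_ fun i w => ?_
    · simp
    · simp [mapHead_cons, hE]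
  have : barEnd β 0 ∘ₗ mapHead β E = mapHead β E ∘ₗ barEnd β (0 : _ →ₙₐ[ZMod 2] S) := by
    refine linearMap_ext β ?_ fun i w => ?_
    · simp [mapHead_nil]
    · have := LinearMap.congr_fun (h (β i)) (Finsupp.single w 1)
      simp only [LinearMap.comp_apply] at this
      simp [mapHead_cons, this]
  exact LinearMap.congr_fun this w

theorem mulHead_mapLast (hE : ∀ p q, E (p * q) = E p * q) (ε : P →ₙₐ[ZMod 2] S) (p q : P)
    (w : BarWords ι S) :
    mulHead β ε p (mapLast β E (cons S β q w)) = mapLast β E (cons S β (p * q) w) := by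
  have h : E (p * q) = p * E q := by rw [mul_comm, hE, mul_comm]
  rw [mapLast_cons, mapLast_cons, map_add, map_smul, mulHead_cons, mulHead_cons, h]

theorem barEnd_zero_mapLast (hE : ∀ p q, E (p * q) = E p * q) (w : BarWords ι S) :
    barEnd β 0 (mapLast β E w) = mapLast β E (barEnd β 0 w) := by
  have h (p : P) (w : BarWords ι S) :
      mapLast β E (mulHead β (0 : _ →ₙₐ[ZMod 2] S) p w) = mulHead β 0 p (mapLast β E w) := by
    have : mapLast β E ∘ₗ mulHead β (0 : _ →ₙₐ[ZMod 2] S) p =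
        mulHead β 0 p ∘ₗ mapLast β E := by
      refine linearMap_ext β ?_ fun i w => ?_
      · simp [mapLast_nil]
      · simp only [LinearMap.comp_apply]
        rw [mulHead_mapLast β hE, mulHead_cons]
    exact LinearMap.congr_fun this w
  have : barEnd β 0 ∘ₗ mapLast β E = mapLast β E ∘ₗ barEnd β (0 : _ →ₙₐ[ZMod 2] S) := by
    refine Finsupp.lhom_ext' fun w => LinearMap.ext_ring ?_
    simp only [LinearMap.comp_apply, Finsupp.lsingle_apply]
    induction w with
    | nil => simp [mapLast_nil]
    | cons i w ih =>
      rw [← cons_basis_single S β, mapLast_cons, map_add, map_smul, barEnd_cons, barEnd_cons, ih,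
        barEnd_cons, map_add, mapLast_cons, h, barEnd_zero_apply_nil]
      simp
  exact LinearMap.congr_fun this w

/-- If `p` annihilates the image of `E`, then `μ_p` annihilates the words with first letter in this
image, whatever is done to the last letter. -/
theorem mulHead_mapLast_mapHead (hE : ∀ p q, E (p * q) = E p * q)
    (ε : P →ₙₐ[ZMod 2] S) {E' : P →ₗ[ZMod 2] P} {p : P}
    (hp : ∀ q, p * E' q = 0) (w : BarWords ι S) :
    mulHead β ε p (mapLast β E (mapHead β E' w)) = 0 := by
  have : mulHead β ε p ∘ₗ mapLast β E ∘ₗ mapHead β E' = 0 := by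
    refine linearMap_ext β ?_ fun i w => ?_
    · simp [mapHead_nil]
    · simp only [LinearMap.comp_apply, mapHead_cons, LinearMap.zero_apply]
      rw [mulHead_mapLast β hE, hp, map_zero, LinearMap.zero_apply, map_zero]
  exact LinearMap.congr_fun this w

/-- If `p` annihilates the image of `E`, then `p` annihilates the effect of the coefficient action
of a last letter in this image. -/
theorem smul_barEnd_mapLast (ε : P →ₙₐ[ZMod 2] S) {p : P} (hp : ∀ q, p * E q = 0)
    (w : BarWords ι S) :
    ε p • barEnd β ε (mapLast β E w) = ε p • barEnd β 0 (mapLast β E w) := by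
  have h (q : P) (w : BarWords ι S) :
      mulHead β ε q w = mulHead β 0 q w + (w [] * ε q) • Finsupp.single [] 1 := by
    have : mulHead β ε q = mulHead β 0 q +
        (Finsupp.lapply [] : BarWords ι S →ₗ[S] S).smulRight (Finsupp.single [] (ε q)) := by
      refine linearMap_ext β ?_ fun i w => ?_
      · simp
      · simp [cons_apply_nil]
    rw [this]
    simp
  have : ε p • (barEnd β ε ∘ₗ mapLast β E) =
      ε p • (barEnd β (0 : _ →ₙₐ[ZMod 2] S) ∘ₗ mapLast β E) := by
    refine Finsupp.lhom_ext' fun w => LinearMap.ext_ring ?_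
    simp only [LinearMap.comp_apply, LinearMap.smul_apply, Finsupp.lsingle_apply]
    induction w with
    | nil => simp [mapLast_nil]
    | cons i w ih =>
      have h1 : ε p * ε (E (β i)) = 0 := by rw [← map_mul, hp, map_zero]
      rw [← cons_basis_single S β, mapLast_cons, map_add, map_add, barEnd_cons, barEnd_cons, h,
        mapLast_apply_nil, smul_add, smul_add, smul_add, smul_add, ← map_smul (cons S β (β i)), ih,
        map_smul, map_smul, map_smul, barEnd_cons, barEnd_cons, mulHead_nil, mulHead_nil,
        barEnd_nil,
        barEnd_nil]
      simp only [map_zero, add_zero, zero_mul, zero_smul]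
      rw [smul_comm, Finsupp.smul_single, smul_eq_mul, h1]
      simp
  exact LinearMap.congr_fun this w

theorem sum_mapHead {κ : Type*} [Fintype κ] (E : κ → P →ₗ[ZMod 2] P) (hE : ∑ k, E k = LinearMap.id)
    {n : ℕ} {z : BarWords ι S} (hz : z ∈ ofLength ι S (n + 1)) :
    ∑ k, mapHead β (E k) z = z := by
  rw [← sub_eq_zero, ← Submodule.mem_bot S, ← LinearMap.sum_apply]
  refine map_mem_of_length (∑ k, mapHead β (E k) - LinearMap.id) (fun w hw => ?_) hz
  cases w with
  | nil => simp at hw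
  | cons i w =>
    have h := LinearMap.congr_fun hE (β i)
    rw [LinearMap.sum_apply, LinearMap.id_apply] at h
    rw [Submodule.mem_bot, LinearMap.sub_apply, LinearMap.sum_apply, LinearMap.id_apply,
      ← cons_basis_single S β]
    simp only [mapHead_cons]
    rw [← LinearMap.sum_apply, ← map_sum, h, sub_self]

theorem sum_mapLast {κ : Type*} [Fintype κ] (E : κ → P →ₗ[ZMod 2] P) (hE : ∑ k, E k = LinearMap.id)
    {n : ℕ} {z : BarWords ι S} (hz : z ∈ ofLength ι S (n + 1)) :
    ∑ k, mapLast β (E k) z = z := by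
  induction n generalizing z with
  | zero =>
    rw [← sum_mapHead β E hE hz]
    refine Finset.sum_congr rfl fun k _ => ?_
    rw [sum_mapHead β E hE hz, ← sub_eq_zero, ← Submodule.mem_bot S]
    refine map_mem_of_length (mapLast β (E k) - mapHead β (E k)) (fun w hw => ?_) hz
    obtain ⟨i, rfl⟩ := List.length_eq_one_iff.1 hw
    rw [← cons_basis_single S β]
    simp [mapHead_cons, mapLast_cons, mapLast_nil]
  | succ n ih =>
    rw [← sub_eq_zero, ← Submodule.mem_bot S, ← LinearMap.sum_apply]
    refine map_mem_of_length (∑ k, mapLast β (E k) - LinearMap.id) (fun w hw => ?_) hz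
    cases w with
    | nil => simp at hw
    | cons i w =>
      have hw' : Finsupp.single w (1 : S) ∈ ofLength ι S (n + 1) := by
        simp only [List.length_cons, add_left_inj] at hw
        rw [← hw]
        exact single_mem_ofLength _
      have hw0 : Finsupp.single w (1 : S) [] = 0 :=
        Finsupp.single_eq_of_ne (by rintro rfl; simp at hw)
      rw [Submodule.mem_bot, LinearMap.sub_apply, LinearMap.sum_apply, LinearMap.id_apply,
        ← cons_basis_single S β]
      simp only [mapLast_cons, hw0, zero_smul, add_zero]
      rw [← map_sum, ih hw', sub_self]

end Slots

section Rational

variable {P ι S : Type*} [NonUnitalCommRing P] [Module (ZMod 2) P] [IsScalarTower (ZMod 2) P P]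
  [SMulCommClass (ZMod 2) P P] [CommRing S] [Algebra (ZMod 2) S] (β : Module.Basis ι (ZMod 2) P)

/-- The combinations with coefficients in `𝔽₂` of the words in `X`. -/
noncomputable def rational (S : Type*) [CommRing S] [Algebra (ZMod 2) S] (X : Set (List ι)) :
    Submodule (ZMod 2) (BarWords ι S) :=
  Submodule.span (ZMod 2) ((fun w => Finsupp.single w (1 : S)) '' X)

theorem single_mem_rational {X : Set (List ι)} {w : List ι} (hw : w ∈ X) :
    Finsupp.single w (1 : S) ∈ rational S X :=
  Submodule.subset_span ⟨w, hw, rfl⟩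

theorem map_mem_of_mem_rational {M : Type*} [AddCommGroup M] [Module (ZMod 2) M] {X : Set (List ι)}
    (L : BarWords ι S →ₗ[ZMod 2] M) {N : Submodule (ZMod 2) M}
    (h : ∀ w ∈ X, L (Finsupp.single w 1) ∈ N) {z : BarWords ι S} (hz : z ∈ rational S X) :
    L z ∈ N := by
  refine (Submodule.span_le.2 ?_ : _ ≤ N.comap L) hz
  rintro _ ⟨w, hw, rfl⟩
  exact h w hw

theorem cons_mem_rational {X Y : Set (List ι)} {p : P}
    (h : ∀ i, β.repr p i ≠ 0 → ∀ w ∈ X, i :: w ∈ Y) {z : BarWords ι S} (hz : z ∈ rational S X) :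
    cons S β p z ∈ rational S Y := by
  refine map_mem_of_mem_rational ((cons S β p).restrictScalars (ZMod 2)) (fun w hw => ?_) hz
  rw [LinearMap.restrictScalars_apply, ← β.linearCombination_repr p,
    Finsupp.linearCombination_apply, Finsupp.sum, map_sum, LinearMap.sum_apply]
  refine Submodule.sum_mem _ fun i hi => ?_
  rw [map_smul, LinearMap.smul_apply, cons_basis_single]
  exact Submodule.smul_mem _ _ (single_mem_rational (h i (Finsupp.mem_support_iff.1 hi) w hw))

theorem barEnd_zero_mem_rational (w : List ι) :
    barEnd β 0 (Finsupp.single w (1 : S)) ∈ rational S Set.univ := by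
  induction w with
  | nil => rw [barEnd_nil]; exact zero_mem _
  | cons i w ih =>
    rw [← cons_basis_single S β, barEnd_cons]
    refine add_mem ?_ (cons_mem_rational β (fun _ _ _ _ => Set.mem_univ _) ih)
    cases w with
    | nil => simp
    | cons j w =>
      rw [← cons_basis_single S β, mulHead_cons]
      exact cons_mem_rational β (fun _ _ _ _ => Set.mem_univ _)
        (single_mem_rational (Set.mem_univ w))

/-- The map applying a linear form to the coefficients. -/
noncomputable def mapCoeff (c : S →ₗ[ZMod 2] ZMod 2) :
    BarWords ι S →ₗ[ZMod 2] BarWords ι S :=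
  Finsupp.mapRange.linearMap (Algebra.linearMap (ZMod 2) S ∘ₗ c)

theorem mapCoeff_smul (c : S →ₗ[ZMod 2] ZMod 2) (s : S) {z : BarWords ι S}
    (hz : z ∈ rational S Set.univ) : mapCoeff c (s • z) = c s • z := by
  rw [← sub_eq_zero, ← Submodule.mem_bot (ZMod 2)]
  refine map_mem_of_mem_rational (mapCoeff c ∘ₗ
    (LinearMap.lsmul S (BarWords ι S) s).restrictScalars (ZMod 2) - c s • LinearMap.id)
    (fun w _ => ?_) hz
  simp only [mapCoeff, Submodule.mem_bot, LinearMap.sub_apply, LinearMap.comp_apply,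
    LinearMap.restrictScalars_apply, LinearMap.lsmul_apply, LinearMap.smul_apply,
    LinearMap.id_apply, Finsupp.smul_single, Finsupp.mapRange.linearMap_apply,
    Finsupp.mapRange_single, smul_eq_mul, mul_one, Algebra.linearMap_apply,
    Algebra.algebraMap_eq_smul_one, sub_self]

theorem barEnd_zero_mapCoeff (c : S →ₗ[ZMod 2] ZMod 2) (z : BarWords ι S) :
    barEnd β 0 (mapCoeff c z) = mapCoeff c (barEnd β 0 z) := by
  induction z using Finsupp.induction_linear with
  | zero => simp
  | add x y hx hy => rw [map_add, map_add, hx, hy, map_add, map_add]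
  | single w s =>
    have h : Finsupp.single w s = s • Finsupp.single w (1 : S) := by simp
    rw [h, map_smul (barEnd β 0), mapCoeff_smul c s (single_mem_rational (Set.mem_univ w)),
      mapCoeff_smul c s (barEnd_zero_mem_rational β w)]
    exact map_smul ((barEnd β 0).restrictScalars (ZMod 2)) (c s) (Finsupp.single w (1 : S))

theorem mapCoeff_mem_rational (c : S →ₗ[ZMod 2] ZMod 2) {X : Set (List ι)} {z : BarWords ι S}
    (hz : z ∈ Finsupp.supported S S X) : mapCoeff c z ∈ rational S X := by
  rw [← Finsupp.sum_single z, Finsupp.sum, map_sum]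
  refine Submodule.sum_mem _ fun w hw => ?_
  have h : Finsupp.single w (z w) = z w • Finsupp.single w (1 : S) := by simp
  rw [h, mapCoeff_smul c _ (single_mem_rational (Set.mem_univ w))]
  exact Submodule.smul_mem _ _ (single_mem_rational (hz hw))

/-- To show that a form vanishes on the cycles for trivial coefficients it is enough to consider
cycles with coefficients in `𝔽₂`, if its values on words lie on a line over `𝔽₂`. -/
theorem eq_zero_of_rational {M : Type*} [AddCommGroup M] [Module (ZMod 2) M] [Module S M]
    [IsScalarTower (ZMod 2) S M] (F : BarWords ι S →ₗ[S] M) {X : Set (List ι)} (m : M)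
    (hm : ∀ w ∈ X, ∃ c : ZMod 2, F (Finsupp.single w 1) = c • m)
    (hF : ∀ z ∈ rational S X, barEnd β 0 z = 0 → F z = 0)
    {z : BarWords ι S} (hz : z ∈ Finsupp.supported S S X) (hb : barEnd β 0 z = 0) : F z = 0 := by
  have hm' (w : List ι) : ∃ c : ZMod 2, w ∈ X → F (Finsupp.single w 1) = c • m := by
    by_cases hw : w ∈ X
    · obtain ⟨c, hc⟩ := hm w hw
      exact ⟨c, fun _ => hc⟩
    · exact ⟨0, fun h => absurd h hw⟩
  choose c hc using hm'
  let q : S := ∑ w ∈ z.support, c w • z w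
  have hq : F z = q • m := by
    conv_lhs => rw [← Finsupp.sum_single z, Finsupp.sum, map_sum]
    rw [Finset.sum_smul]
    refine Finset.sum_congr rfl fun w hw => ?_
    have h : Finsupp.single w (z w) = z w • Finsupp.single w (1 : S) := by simp
    rw [h, map_smul, hc w (hz hw), smul_assoc, ← smul_comm (z w) (c w) m]
  rw [hq]
  by_cases hm0 : m = 0
  · rw [hm0, smul_zero]
  have hq0 : q = 0 := by
    refine (Module.forall_dual_apply_eq_zero_iff (ZMod 2) q).1 fun f => ?_
    have h1 := hF _ (mapCoeff_mem_rational f hz) (by rw [barEnd_zero_mapCoeff, hb, map_zero])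
    have h2 : F (mapCoeff f z) = f q • m := by
      conv_lhs => rw [← Finsupp.sum_single z, Finsupp.sum, map_sum, map_sum]
      rw [map_sum, Finset.sum_smul]
      refine Finset.sum_congr rfl fun w hw => ?_
      have h : Finsupp.single w (z w) = z w • Finsupp.single w (1 : S) := by simp
      rw [h, mapCoeff_smul f _ (single_mem_rational (Set.mem_univ w))]
      have h3 := map_smul (F.restrictScalars (ZMod 2)) (f (z w)) (Finsupp.single w (1 : S))
      simp only [LinearMap.restrictScalars_apply] at h3
      rw [h3, hc w (hz hw), map_smul, smul_eq_mul, mul_comm, mul_smul]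
    rw [h2] at h1
    exact (smul_eq_zero.1 h1).resolve_right hm0
  rw [hq0, zero_smul]

end Rational

open PositivePart

section Idempotents

variable {V A S : Type*} [AddCommGroup V] [Module (ZMod 2) V] [BooleanRing A]
  [CommRing S] [Algebra (ZMod 2) S]

local notation "β" => basis V A

/-- Multiplication by `a ∈ A` in all degrees of the Boolean part. -/
noncomputable def scale (V : Type*) [AddCommGroup V] [Module (ZMod 2) V] (a : A) :
    PositivePart V A →ₗ[ZMod 2] PositivePart V A :=
  LinearMap.inr (ZMod 2) (DualPart V) (BooleanPart A) ∘ₗ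
    BooleanPart.sumHom (fun n => BooleanPart.mono n ∘ₗ LinearMap.mulLeft (ZMod 2) a) ∘ₗ
      LinearMap.snd (ZMod 2) (DualPart V) (BooleanPart A)

/-- The projection to `V`. -/
noncomputable def projDual (V A : Type*) [AddCommGroup V] [Module (ZMod 2) V] [BooleanRing A] :
    PositivePart V A →ₗ[ZMod 2] PositivePart V A :=
  LinearMap.inl (ZMod 2) (DualPart V) (BooleanPart A) ∘ₗ
    LinearMap.fst (ZMod 2) (DualPart V) (BooleanPart A)

theorem scale_mono (a b : A) (n : ℕ+) : scale V a (mono V n b) = mono V n (a * b) := by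
  simp only [scale, mono, LinearMap.comp_apply, LinearMap.snd_apply, LinearMap.inr_apply,
    BooleanPart.sumHom_mono, LinearMap.mulLeft_apply]

theorem scale_inl (a : A) (v : DualPart V) : scale V a (v, 0) = 0 := by
  simp [scale]

theorem projDual_mono (b : A) (n : ℕ+) : projDual V A (mono V n b) = 0 := by
  simp [projDual, mono]

theorem projDual_inl (v : DualPart V) : projDual V A (v, 0) = (v, 0) := by
  simp [projDual]

theorem scale_mul (a : A) (p q : PositivePart V A) : scale V a (p * q) = scale V a p * q := by
  induction p using PositivePart.induction_mono with
  | add p p' hp hp' => rw [add_mul, map_add, hp, hp', map_add, add_mul]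
  | inl v => rw [inl_mul, map_zero, scale_inl, zero_mul]
  | mono m b =>
    induction q using PositivePart.induction_mono with
    | add q q' hq hq' => rw [mul_add, map_add, hq, hq', mul_add]
    | inl v => rw [mul_inl, map_zero, mul_inl]
    | mono n c => rw [mono_mul_mono, scale_mono, scale_mono, mono_mul_mono, mul_assoc]

theorem projDual_mul (p q : PositivePart V A) : projDual V A (p * q) = projDual V A p * q := by
  rw [projDual, LinearMap.comp_apply, LinearMap.fst_apply, mul_fst, map_zero]
  exact (inl_mul _ _).symm

theorem scale_mem_grading (a : A) {n : ℕ+} {p : PositivePart V A} (hp : p ∈ grading V A n) :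
    scale V a p ∈ grading V A n := by
  have h : p.2 = BooleanPart.mono n (BooleanPart.coeff p.2 n) :=
    BooleanPart.eq_mono_of_mem_grading hp.2
  have h' : p = (p.1, 0) + mono V n (BooleanPart.coeff p.2 n) := by
    rw [mono_apply, ← h]; simp
  rw [h', map_add, scale_inl, scale_mono, zero_add]
  exact mono_mem_grading _ _

theorem projDual_mem_grading {n : ℕ+} {p : PositivePart V A} (hp : p ∈ grading V A n) :
    projDual V A p ∈ grading V A n :=
  ⟨hp.1, zero_mem _⟩

theorem mono_mul_scale {e a : A} (h : e * a = 0) (p : PositivePart V A) :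
    mono V 1 e * scale V a p = 0 := by
  induction p using PositivePart.induction_mono with
  | add p q hp hq => rw [map_add, mul_add, hp, hq, add_zero]
  | inl v => rw [scale_inl, mul_zero]
  | mono n b => rw [scale_mono, mono_mul_mono, ← mul_assoc, h, zero_mul, map_zero]

theorem mono_mul_projDual (e : A) (p : PositivePart V A) :
    mono V 1 e * projDual V A p = 0 := mul_inl _ _

/-- The projections of the positive part to `V` and to its components cut out by a family of
elements of `A`. -/
noncomputable def proj (V : Type*) [AddCommGroup V] [Module (ZMod 2) V] {κ : Type*} (e : κ → A) :
    Option κ → PositivePart V A →ₗ[ZMod 2] PositivePart V A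
  | none => projDual V A
  | some k => scale V (e k)

theorem sum_proj {κ : Type*} [Fintype κ] (e : κ → A) (he : ∑ k, e k = 1) :
    ∑ k, proj V e k = LinearMap.id := by
  refine LinearMap.ext fun p => ?_
  rw [LinearMap.id_apply]
  induction p using PositivePart.induction_mono with
  | add p q hp hq => rw [map_add, hp, hq]
  | inl v =>
    rw [LinearMap.sum_apply, Fintype.sum_option]
    simp only [proj, projDual_inl, scale_inl, Finset.sum_const_zero, add_zero]
  | mono n b =>
    rw [LinearMap.sum_apply, Fintype.sum_option]
    simp only [proj, projDual_mono, scale_mono, zero_add]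
    rw [← map_sum, ← Finset.sum_mul, he, one_mul]

theorem proj_mul {κ : Type*} (e : κ → A) (k : Option κ) (p q : PositivePart V A) :
    proj V e k (p * q) = proj V e k p * q := by
  cases k with
  | none => exact projDual_mul p q
  | some k => exact scale_mul _ p q

theorem proj_mem_grading {κ : Type*} (e : κ → A) (k : Option κ) {n : ℕ+} {p : PositivePart V A}
    (hp : p ∈ grading V A n) : proj V e k p ∈ grading V A n := by
  cases k with
  | none => exact projDual_mem_grading hp
  | some k => exact scale_mem_grading _ hp

theorem mono_mul_proj {κ : Type*} (e : κ → A) (he : ∀ i j, i ≠ j → e i * e j = 0) {l : κ}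
    {k : Option κ} (hk : some l ≠ k) (p : PositivePart V A) :
    mono V 1 (e l) * proj V e k p = 0 := by
  cases k with
  | none => exact mono_mul_projDual _ p
  | some k => exact mono_mul_scale (he l k fun h => hk (congrArg some h)) p

/-- Words with the same length and weight as a given one. -/
theorem mapHead_proj_mem_rational {κ : Type*} (e : κ → A) (k : Option κ) (w : List (Idx V A)) :
    mapHead β (proj V e k) (Finsupp.single w (1 : S)) ∈
      rational S {u : List (Idx V A) | u.length = w.length ∧ weight u = weight w} := by
  cases w with
  | nil => rw [mapHead_nil]; exact zero_mem _
  | cons i w =>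
    rw [← cons_basis_single S β, mapHead_cons]
    refine cons_mem_rational β (X := {w}) (fun l hl u hu => ?_) (single_mem_rational rfl)
    have := deg_eq_of_repr_ne_zero (proj_mem_grading e k (basis_mem_grading i)) hl
    rw [PNat.mk_coe] at this
    rw [Set.mem_singleton_iff.1 hu]
    simp [this]

theorem mapLast_proj_mem_rational {κ : Type*} (e : κ → A) (k : Option κ) (w : List (Idx V A)) :
    mapLast β (proj V e k) (Finsupp.single w (1 : S)) ∈
      rational S {u : List (Idx V A) | u.length = w.length ∧ weight u = weight w} := by
  induction w with
  | nil => rw [mapLast_nil]; exact zero_mem _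
  | cons i w ih =>
    rw [← cons_basis_single S β, mapLast_cons]
    refine add_mem (cons_mem_rational β (fun l hl u hu => ?_) ih) ?_
    · have := deg_eq_of_repr_ne_zero (basis_mem_grading i) hl
      rw [PNat.mk_coe] at this
      simp [this, hu.1, hu.2]
    · cases w with
      | nil =>
        rw [Finsupp.single_eq_same, one_smul]
        refine cons_mem_rational β (X := {[]}) (fun l hl u hu => ?_) (single_mem_rational rfl)
        have := deg_eq_of_repr_ne_zero (proj_mem_grading e k (basis_mem_grading i)) hl
        rw [PNat.mk_coe] at this
        rw [Set.mem_singleton_iff.1 hu]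
        simp [this]
      | cons j w =>
        rw [Finsupp.single_eq_of_ne (by simp), zero_smul]
        exact zero_mem _

/-- Let `F` be a cocycle whose values on words of letters of degree one are multiples of `m`. Three
orthogonal idempotents `e` with sum one, which do not annihilate `m`, force `F` to vanish on the
cycles for trivial coefficients: decomposing such a cycle by its first and last letters, there is
an idempotent orthogonal to both, and prefixing it gives a word whose boundary shows that `F`
vanishes. -/
theorem eq_zero_of_orthogonal {M : Type*} [AddCommGroup M] [Module (ZMod 2) M] [Module S M]
    [IsScalarTower (ZMod 2) S M] (ε : PositivePart V A →ₙₐ[ZMod 2] S) {n : ℕ}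
    (F : BarWords (Idx V A) S →ₗ[S] M)
    (hF : ∀ z ∈ ofLength (Idx V A) S (n + 2), F (bar β ε z) = 0) (m : M)
    (hm : ∀ u : List (Idx V A), u.length = n + 1 → weight u = n + 1 →
      ∃ c : ZMod 2, F (Finsupp.single u 1) = c • m)
    (e : Fin 3 → A) (he1 : ∑ k, e k = 1) (he : ∀ i j, i ≠ j → e i * e j = 0)
    (hem : ∀ i, ε (mono V 1 (e i)) • ε (mono V 1 (e i)) • m ≠ 0) {z : BarWords (Idx V A) S}
    (hz : z ∈ Finsupp.supported S S {u : List (Idx V A) | u.length = n + 1 ∧ weight u = n + 1})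
    (hb : barEnd β 0 z = 0) : F z = 0 := by
  refine eq_zero_of_rational β F m (fun u hu => hm u hu.1 hu.2) (fun z hz hb => ?_) hz hb
  have hsub {z : BarWords (Idx V A) S}
      (hz : z ∈ rational S {u : List (Idx V A) | u.length = n + 1 ∧ weight u = n + 1}) :
      z ∈ ofLength (Idx V A) S (n + 1) :=
    map_mem_of_mem_rational LinearMap.id (N := (ofLength (Idx V A) S (n + 1)).restrictScalars _)
      (fun w hw => by
        rw [Submodule.restrictScalars_mem, LinearMap.id_apply, ← hw.1]
        exact single_mem_ofLength _) hz
  have hhead (i : Option (Fin 3)) : mapHead β (proj V e i) z ∈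
      rational S {u : List (Idx V A) | u.length = n + 1 ∧ weight u = n + 1} :=
    map_mem_of_mem_rational ((mapHead β (proj V e i)).restrictScalars (ZMod 2))
      (fun w hw => by
        have := mapHead_proj_mem_rational (S := S) e i w
        rwa [hw.1, hw.2] at this) hz
  rw [← sum_mapHead β (proj V e) (sum_proj e he1) (hsub hz), map_sum]
  refine Finset.sum_eq_zero fun i _ => ?_
  rw [← sum_mapLast β (proj V e) (sum_proj e he1) (hsub (hhead i)), map_sum]
  refine Finset.sum_eq_zero fun j _ => ?_
  set x := mapLast β (proj V e j) (mapHead β (proj V e i) z) with hx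
  have hxr : x ∈ rational S {u : List (Idx V A) | u.length = n + 1 ∧ weight u = n + 1} :=
    map_mem_of_mem_rational ((mapLast β (proj V e j)).restrictScalars (ZMod 2))
      (fun w hw => by
        have := mapLast_proj_mem_rational (S := S) e j w
        rwa [hw.1, hw.2] at this) (hhead i)
  have hl : ∀ i j : Option (Fin 3), ∃ l : Fin 3, some l ≠ i ∧ some l ≠ j := by decide
  obtain ⟨l, hli, hlj⟩ := hl i j
  set p := mono V 1 (e l) with hp
  have hx0 : barEnd β 0 x = 0 := by
    rw [hx, barEnd_zero_mapLast β (proj_mul e j), barEnd_zero_mapHead β (proj_mul e i), hb,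
      map_zero, map_zero]
  have h1 : ε p • bar β ε (cons S β p x) = ε p • ε p • x := by
    rw [bar_cons, hx, mulHead_mapLast_mapHead β (proj_mul e j) ε (mono_mul_proj e he hli), ← hx,
      zero_add, smul_add, ← map_smul (cons S β p), hx,
      smul_barEnd_mapLast β ε (mono_mul_proj e he hlj), ← hx, hx0, smul_zero, map_zero, zero_add]
  have h2 : F (ε p • ε p • x) = 0 := by
    rw [← h1, map_smul, hF _ (cons_mem_ofLength β _ (hsub hxr)), smul_zero]
  obtain ⟨c, hc⟩ : ∃ c : ZMod 2, F x = c • m := by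
    have : F x ∈ Submodule.span (ZMod 2) {m} :=
      map_mem_of_mem_rational (F.restrictScalars (ZMod 2)) (fun u hu => by
        obtain ⟨c, hc⟩ := hm u hu.1 hu.2
        exact Submodule.mem_span_singleton.2 ⟨c, hc.symm⟩) hxr
    obtain ⟨c, hc⟩ := Submodule.mem_span_singleton.1 this
    exact ⟨c, hc.symm⟩
  rw [map_smul, map_smul, hc, smul_comm (ε p) c m, smul_comm (ε p) c] at h2
  rw [hc, (smul_eq_zero.1 h2).resolve_right (hem l), zero_smul]

end Idempotents

end BarWords

/-! ### Normalization of Hochschild cocycles -/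

section Normalization

variable {Q M : Type*} [CommRing Q] [Algebra (ZMod 2) Q] [AddCommGroup M] [Module (ZMod 2) M]

/-- The Hochschild differential in characteristic two of a function of `n` arguments, for
coefficients on which `Q` acts by `l` on the left and by `r` on the right. -/
def bimoduleD (l r : Q → Module.End (ZMod 2) M) {n : ℕ} (f : (Fin n → Q) → M)
    (a : Fin (n + 1) → Q) : M :=
  l (a 0) (f fun i => a i.succ) + ∑ i : Fin n, f (Fin.contractNth i.castSucc (· * ·) a) +
    r (a (Fin.last n)) (f fun i => a i.castSucc)

/-- The left action of `Q` on functions `Q → M` which makes the differential compatible with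
currying, see `bimoduleD_cons`. -/
def curryLeftAction (l : Q → Module.End (ZMod 2) M) (b : Q) : Module.End (ZMod 2) (Q → M) where
  toFun φ x := φ (x * b) + l x (φ b)
  map_add' φ ψ := by ext x; simp only [Pi.add_apply, map_add]; abel
  map_smul' c φ := by ext x; simp

/-- The right action of `Q` on functions `Q → M` through the right action on `M`. -/
def curryRightAction (r : Q → Module.End (ZMod 2) M) (b : Q) : Module.End (ZMod 2) (Q → M) where
  toFun φ x := r b (φ x)
  map_add' φ ψ := by ext x; simp
  map_smul' c φ := by ext x; simp

theorem curryLeftAction_apply (l : Q → Module.End (ZMod 2) M) (b : Q) (φ : Q → M) (x : Q) :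
    curryLeftAction l b φ x = φ (x * b) + l x (φ b) := rfl

theorem curryRightAction_apply (r : Q → Module.End (ZMod 2) M) (b : Q) (φ : Q → M) (x : Q) :
    curryRightAction r b φ x = r b (φ x) := rfl

variable (l r : Q → Module.End (ZMod 2) M)

theorem contractNth_succ_cons {n : ℕ} (i : Fin n) (x : Q) (a : Fin (n + 1) → Q) :
    (Fin.contractNth i.succ.castSucc (· * ·) (Fin.cons x a : Fin (n + 2) → Q) : Fin (n + 1) → Q) =
      Fin.cons x (Fin.contractNth i.castSucc (· * ·) a) := by
  rw [← Fin.succ_castSucc]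
  funext k
  cases k using Fin.cases with
  | zero => rw [contractNth_succ_zero, Fin.cons_zero, Fin.cons_zero]
  | succ k => rw [contractNth_succ_succ]; simp

theorem contractNth_zero_cons {n : ℕ} (x : Q) (a : Fin (n + 1) → Q) :
    (Fin.contractNth (Fin.castSucc 0) (· * ·) (Fin.cons x a : Fin (n + 2) → Q) :
      Fin (n + 1) → Q) = Fin.cons (x * a 0) fun i => a i.succ := by
  funext k
  cases k using Fin.cases with
  | zero => simp [Fin.contractNth]
  | succ k => rw [Fin.castSucc_zero, contractNth_zero_succ]; simp

theorem cons_castSucc {n : ℕ} (x : Q) (a : Fin (n + 1) → Q) :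
    (fun i : Fin (n + 1) => (Fin.cons x a : Fin (n + 2) → Q) i.castSucc) =
      Fin.cons x fun i => a i.castSucc := by
  funext k
  cases k using Fin.cases with
  | zero => rfl
  | succ k => rw [← Fin.succ_castSucc]; simp

theorem bimoduleD_cons_expand {n : ℕ} (f : (Fin (n + 1) → Q) → M) (x : Q) (a : Fin (n + 1) → Q) :
    bimoduleD l r f (Fin.cons x a) = l x (f a) + f (Fin.cons (x * a 0) fun i => a i.succ) +
      ∑ i : Fin n, f (Fin.cons x (Fin.contractNth i.castSucc (· * ·) a)) +
        r (a (Fin.last n)) (f (Fin.cons x fun i => a i.castSucc)) := by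
  simp only [bimoduleD, Fin.sum_univ_succ, contractNth_succ_cons, contractNth_zero_cons,
    cons_castSucc, Fin.cons_zero, Fin.cons_succ, ← Fin.succ_last]
  abel

theorem bimoduleD_cons {n : ℕ} (f : (Fin (n + 1) → Q) → M) (x : Q) (a : Fin (n + 1) → Q) :
    bimoduleD l r f (Fin.cons x a) =
      bimoduleD (curryLeftAction l) (curryRightAction r) (fun b y => f (Fin.cons y b)) a x := by
  have h : (Fin.cons (a 0) fun i => a i.succ : Fin (n + 1) → Q) = a := Fin.cons_self_tail a
  rw [bimoduleD_cons_expand, bimoduleD]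
  simp only [Pi.add_apply, Finset.sum_apply, curryLeftAction_apply, curryRightAction_apply, h]
  abel

theorem bimoduleD_add {n : ℕ} (f g : (Fin n → Q) → M) (a : Fin (n + 1) → Q) :
    bimoduleD l r (fun b => f b + g b) a = bimoduleD l r f a + bimoduleD l r g a := by
  simp only [bimoduleD, map_add, Finset.sum_add_distrib]
  abel

theorem curryLeftAction_mul (hl : ∀ a b m, l (a * b) m = l a (l b m)) (a b : Q) (φ : Q → M) :
    curryLeftAction l (a * b) φ = curryLeftAction l a (curryLeftAction l b φ) := by
  funext x
  simp only [curryLeftAction_apply, map_add, hl, mul_assoc]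
  have h := ZModModule.add_self (l x (l a (φ b)))
  rw [add_assoc, add_left_comm (l x (l a (φ b))), h, add_zero]

universe u v

/-- The square of the differential is zero. -/
theorem bimoduleD_bimoduleD {Q : Type u} {M : Type (max u v)} [CommRing Q] [Algebra (ZMod 2) Q]
    [AddCommGroup M] [Module (ZMod 2) M] (l r : Q → Module.End (ZMod 2) M) {n : ℕ}
    (hl : ∀ a b m, l (a * b) m = l a (l b m)) (hr : ∀ a b m, r (a * b) m = r b (r a m))
    (hlr : ∀ a b m, l a (r b m) = r b (l a m)) (f : (Fin n → Q) → M) (a : Fin (n + 2) → Q) :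
    bimoduleD l r (bimoduleD l r f) a = 0 := by
  induction n generalizing M with
  | zero =>
    have h0 (x : Q) (c : Fin 0 → Q) : (Fin.contractNth (Fin.castSucc 0) (· * ·) a : Fin 1 → Q) 0 =
        a 0 * a 1 := by
      simp [Fin.contractNth]
    have h1 (c : Fin 0 → Q) : f c = f Fin.elim0 := congrArg f (Subsingleton.elim _ _)
    simp only [bimoduleD, h1, Fintype.sum_empty, add_zero, map_add]
    rw [Fintype.sum_subsingleton _ (0 : Fin 1)]
    have e : (Fin.contractNth (Fin.castSucc 0) (· * ·) a : Fin 1 → Q) (Fin.last 0) = a 0 * a 1 :=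
      h0 0 Fin.elim0
    rw [h0 0 Fin.elim0, e, hl, hr, hlr]
    change l (a 0) (l (a 1) (f Fin.elim0)) + r (a 1) (l (a 0) (f Fin.elim0)) +
      (l (a 0) (l (a 1) (f Fin.elim0)) + r (a 1) (r (a 0) (f Fin.elim0))) +
      (r (a 1) (l (a 0) (f Fin.elim0)) + r (a 1) (r (a 0) (f Fin.elim0))) = 0
    rw [← ZModModule.add_self (l (a 0) (l (a 1) (f Fin.elim0)) +
      r (a 1) (l (a 0) (f Fin.elim0)) + r (a 1) (r (a 0) (f Fin.elim0)))]
    abel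
  | succ n ih =>
    rw [← Fin.cons_self_tail a, bimoduleD_cons]
    simp only [bimoduleD_cons]
    refine congrFun (ih (curryLeftAction l) (curryRightAction r) (curryLeftAction_mul l hl) ?_ ?_
      (fun b y => f (Fin.cons y b)) (Fin.tail a)) (a 0)
    · intro a b φ; funext x; exact hr a b _
    · intro a b φ; funext x
      simp only [curryLeftAction_apply, curryRightAction_apply, map_add, hlr]

/-- Functions of `n` arguments which are multilinear. -/
def IsMultilinear {n : ℕ} (f : (Fin n → Q) → M) : Prop :=
  ∃ F : MultilinearMap (ZMod 2) (fun _ : Fin n => Q) M, ∀ a, F a = f a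

theorem isMultilinear_uncurry {n : ℕ} {f : (Fin n → Q) → Q → M} (hf : IsMultilinear f)
    (h : ∀ b, IsLinearMap (ZMod 2) (f b)) :
    IsMultilinear fun a : Fin (n + 1) → Q => f (fun i => a i.succ) (a 0) := by
  obtain ⟨F, hF⟩ := hf
  refine ⟨LinearMap.uncurryLeft
    { toFun := fun y => (LinearMap.proj y : (Q → M) →ₗ[ZMod 2] M).compMultilinearMap F
      map_add' := fun y z => by ext b; simp [hF, (h b).map_add]
      map_smul' := fun c y => by ext b; simp [hF, (h b).map_smul] }, fun a => ?_⟩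
  simp [hF, Fin.tail_def]

theorem isLinearMap_of_isMultilinear_cons {n : ℕ} {f : (Fin (n + 1) → Q) → M} (hf : IsMultilinear f)
    (b : Fin n → Q) : IsLinearMap (ZMod 2) fun y => f (Fin.cons y b) := by
  obtain ⟨F, hF⟩ := hf
  constructor
  · intro x y; simp only [← hF, MultilinearMap.cons_add]
  · intro x y; simp only [← hF, MultilinearMap.cons_smul]

theorem isMultilinear_cons {n : ℕ} {f : (Fin (n + 1) → Q) → M} (hf : IsMultilinear f) (y : Q) :
    IsMultilinear fun b : Fin n → Q => f (Fin.cons y b) := by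
  obtain ⟨F, hF⟩ := hf
  exact ⟨F.curryLeft y, fun b => hF _⟩

theorem isMultilinear_pi {n : ℕ} {f : (Fin n → Q) → Q → M}
    (hf : ∀ y, IsMultilinear fun b => f b y) : IsMultilinear f := by
  choose F hF using hf
  exact ⟨MultilinearMap.pi F, fun b => funext fun y => hF y b⟩

theorem IsMultilinear.add {n : ℕ} {f g : (Fin n → Q) → M} (hf : IsMultilinear f)
    (hg : IsMultilinear g) : IsMultilinear fun a => f a + g a := by
  obtain ⟨F, hF⟩ := hf
  obtain ⟨G, hG⟩ := hg
  exact ⟨F + G, fun a => by rw [add_apply, hF, hG]⟩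

theorem IsMultilinear.map {n : ℕ} {f : (Fin n → Q) → M} (hf : IsMultilinear f)
    (L : Module.End (ZMod 2) M) : IsMultilinear fun a => L (f a) := by
  obtain ⟨F, hF⟩ := hf
  exact ⟨L.compMultilinearMap F, fun a => by rw [LinearMap.compMultilinearMap_apply, hF]⟩

/-- The conditions on a left action `l`, a right action `r` and a grading `ℳ` on `M` under which
cocycles with values in the submodule `N` can be normalized. -/
structure IsGradedBimodule (𝒬 : ℕ → Submodule (ZMod 2) Q) (l r : Q → Module.End (ZMod 2) M)
    (N : Submodule (ZMod 2) M) (ℳ : ℤ → Submodule (ZMod 2) M) : Prop where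
  l_mul : ∀ a b m, l (a * b) m = l a (l b m)
  r_mul : ∀ a b m, r (a * b) m = r b (r a m)
  comm : ∀ a b m, l a (r b m) = r b (l a m)
  l_mem : ∀ a, ∀ m ∈ N, l a m ∈ N
  r_mem : ∀ a, ∀ m ∈ N, r a m ∈ N
  l_linear : ∀ m ∈ N, IsLinearMap (ZMod 2) fun a => l a m
  l_one : ∀ m ∈ N, l 1 m = m
  l_graded : ∀ d, ∀ a ∈ 𝒬 d, ∀ j, ∀ m ∈ ℳ j, l a m ∈ ℳ (j + d)

/-- Linear maps `Q → N` which vanish at `1`. -/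
def reducedMaps (Q : Type*) [CommRing Q] [Algebra (ZMod 2) Q] (N : Submodule (ZMod 2) M) :
    Submodule (ZMod 2) (Q → M) where
  carrier := {φ | IsLinearMap (ZMod 2) φ ∧ (∀ y, φ y ∈ N) ∧ φ 1 = 0}
  add_mem' {φ ψ} h h' := ⟨(h.1.mk' φ + h'.1.mk' ψ).isLinear,
    fun y => add_mem (h.2.1 y) (h'.2.1 y), by simp [h.2.2, h'.2.2]⟩
  zero_mem' := ⟨(0 : Q →ₗ[ZMod 2] M).isLinear, fun y => zero_mem _, rfl⟩
  smul_mem' c φ h := ⟨(c • h.1.mk' φ).isLinear,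
    fun y => Submodule.smul_mem _ c (h.2.1 y), by simp [h.2.2]⟩

/-- The grading of functions on `Q` by the degree by which they raise degrees. -/
def gradedMaps (𝒬 : ℕ → Submodule (ZMod 2) Q) (ℳ : ℤ → Submodule (ZMod 2) M) (j : ℤ) :
    Submodule (ZMod 2) (Q → M) where
  carrier := {φ | ∀ d, ∀ y ∈ 𝒬 d, φ y ∈ ℳ (j + d)}
  add_mem' h h' d y hy := add_mem (h d y hy) (h' d y hy)
  zero_mem' _ _ _ := zero_mem _
  smul_mem' c _ h d y hy := Submodule.smul_mem _ c (h d y hy)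

theorem isGradedBimodule_curry {𝒬 : ℕ → Submodule (ZMod 2) Q} {l r : Q → Module.End (ZMod 2) M}
    {N : Submodule (ZMod 2) M} {ℳ : ℤ → Submodule (ZMod 2) M}
    (h𝒬 : ∀ d e, ∀ x ∈ 𝒬 d, ∀ y ∈ 𝒬 e, x * y ∈ 𝒬 (d + e)) (h : IsGradedBimodule 𝒬 l r N ℳ) :
    IsGradedBimodule 𝒬 (curryLeftAction l) (curryRightAction r) (reducedMaps Q N)
      (gradedMaps 𝒬 ℳ) where
  l_mul := curryLeftAction_mul l h.l_mul
  r_mul a b φ := funext fun x => h.r_mul a b _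
  comm a b φ := funext fun x => by
    simp only [curryLeftAction_apply, curryRightAction_apply, map_add, h.comm]
  l_mem b φ hφ := by
    refine ⟨?_, fun y => add_mem (hφ.2.1 _) (h.l_mem _ _ (hφ.2.1 _)), ?_⟩
    · exact ((hφ.1.mk' φ ∘ₗ LinearMap.mulRight (ZMod 2) b) +
        (h.l_linear _ (hφ.2.1 b)).mk' _).isLinear
    · rw [curryLeftAction_apply, one_mul, h.l_one _ (hφ.2.1 b), ZModModule.add_self]
  r_mem b φ hφ := ⟨(r b ∘ₗ hφ.1.mk' φ).isLinear, fun y => h.r_mem _ _ (hφ.2.1 _), by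
    rw [curryRightAction_apply, hφ.2.2, map_zero]⟩
  l_linear φ hφ := by
    constructor
    · intro a b; funext x
      simp only [Pi.add_apply, curryLeftAction_apply, mul_add, hφ.1.map_add, map_add]
      abel
    · intro c a; funext x
      simp only [Pi.smul_apply, curryLeftAction_apply, mul_smul_comm, hφ.1.map_smul, map_smul,
        smul_add]
  l_one φ hφ := by
    funext x
    rw [curryLeftAction_apply, mul_one, hφ.2.2, map_zero, add_zero]
  l_graded d b hb j φ hφ e x hx := by
    have h1 := hφ _ _ (h𝒬 e d x hx b hb)
    have h2 := h.l_graded e x hx _ _ (hφ d b hb)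
    rw [Nat.cast_add, add_comm (e : ℤ), ← add_assoc] at h1
    exact add_mem h1 h2

theorem bimoduleD_mem {n : ℕ} {N : Submodule (ZMod 2) M} (hl : ∀ a, ∀ m ∈ N, l a m ∈ N)
    (hr : ∀ a, ∀ m ∈ N, r a m ∈ N) {f : (Fin n → Q) → M} (hf : ∀ a, f a ∈ N)
    (a : Fin (n + 1) → Q) : bimoduleD l r f a ∈ N :=
  add_mem (add_mem (hl _ _ (hf _)) (sum_mem fun _ _ => hf _)) (hr _ _ (hf _))

/-- The coboundary of `f (1, ⋯)` for a cocycle `f`. -/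
theorem bimoduleD_cons_one {n : ℕ} {N : Submodule (ZMod 2) M} (hl : ∀ m ∈ N, l 1 m = m)
    {f : (Fin (n + 1) → Q) → M} (hfN : ∀ a, f a ∈ N) (hD : ∀ a, bimoduleD l r f a = 0)
    (a : Fin (n + 1) → Q) :
    bimoduleD l r (fun b => f (Fin.cons 1 b)) a =
      l (a 0) (f (Fin.cons 1 fun i => a i.succ)) := by
  have h := hD (Fin.cons 1 a)
  have e : (Fin.cons (1 * a 0) fun i => a i.succ : Fin (n + 1) → Q) = a := by
    rw [one_mul]; exact Fin.cons_self_tail a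
  rw [bimoduleD_cons_expand, e, hl _ (hfN _), ZModModule.add_self, zero_add] at h
  rw [bimoduleD, add_assoc, h, add_zero]

/-- Every cocycle is cohomologous to a normalized one, that is, to one vanishing when one of the
arguments is `1`. After subtracting the coboundary of `f (1, ⋯)` it vanishes when its first
argument is `1`, and it can be regarded as a cocycle in the remaining arguments with values in
the maps `Q → M` vanishing at `1`. -/
theorem exists_normalization {Q : Type u} {M : Type (max u v)} [CommRing Q] [Algebra (ZMod 2) Q]
    [AddCommGroup M] [Module (ZMod 2) M] {𝒬 : ℕ → Submodule (ZMod 2) Q}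
    (h𝒬 : ∀ d e, ∀ x ∈ 𝒬 d, ∀ y ∈ 𝒬 e, x * y ∈ 𝒬 (d + e)) (h1 : 1 ∈ 𝒬 0)
    {l r : Q → Module.End (ZMod 2) M} {N : Submodule (ZMod 2) M} {ℳ : ℤ → Submodule (ZMod 2) M}
    (h : IsGradedBimodule 𝒬 l r N ℳ) {n : ℕ} {f : (Fin (n + 1) → Q) → M} (hf : IsMultilinear f)
    (hfN : ∀ a, f a ∈ N) (s : ℤ)
    (hfℳ : ∀ (d : Fin (n + 1) → ℕ) a, (∀ i, a i ∈ 𝒬 (d i)) → f a ∈ ℳ ((∑ i, (d i : ℤ)) + s))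
    (hD : ∀ a, bimoduleD l r f a = 0) :
    ∃ g : (Fin n → Q) → M, IsMultilinear g ∧ (∀ a, g a ∈ N) ∧
      (∀ (d : Fin n → ℕ) a, (∀ i, a i ∈ 𝒬 (d i)) → g a ∈ ℳ ((∑ i, (d i : ℤ)) + s)) ∧
      (∀ (d : Fin (n + 1) → ℕ) a, (∀ i, a i ∈ 𝒬 (d i)) →
        f a + bimoduleD l r g a ∈ ℳ ((∑ i, (d i : ℤ)) + s)) ∧
      ∀ a, (∃ i, a i = 1) → f a = bimoduleD l r g a := by
  induction n generalizing M with
  | zero =>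
    have hg0ℳ (d : Fin 0 → ℕ) (a) (ha : ∀ i, a i ∈ 𝒬 (d i)) :
        f (Fin.cons 1 a) ∈ ℳ ((∑ i, (d i : ℤ)) + s) := by
      have := hfℳ (Fin.cons 0 d) (Fin.cons 1 a) (Fin.cases h1 fun i => ha i)
      rwa [Fin.sum_univ_succ, Fin.cons_zero, Nat.cast_zero, zero_add] at this
    refine ⟨fun b => f (Fin.cons 1 b), isMultilinear_cons hf 1, fun b => hfN _, hg0ℳ,
      fun d a ha => add_mem (hfℳ d a ha) ?_, fun a ⟨i, hi⟩ => ?_⟩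
    · rw [bimoduleD_cons_one l r h.l_one hfN hD, Fin.sum_univ_succ, add_assoc, add_comm]
      exact h.l_graded _ _ (ha 0) _ _ (hg0ℳ (fun i => d i.succ) _ fun i => ha _)
    · obtain rfl : i = 0 := Fin.fin_one_eq_zero i
      rw [bimoduleD_cons_one l r h.l_one hfN hD, hi, h.l_one _ (hfN _), ← hi]
      exact congrArg f (Fin.cons_self_tail a).symm
  | succ n ih =>
    have hg0 : IsMultilinear fun b => f (Fin.cons 1 b) := isMultilinear_cons hf 1
    have hg0ℳ (d : Fin (n + 1) → ℕ) (a) (ha : ∀ i, a i ∈ 𝒬 (d i)) :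
        f (Fin.cons 1 a) ∈ ℳ ((∑ i, (d i : ℤ)) + s) := by
      have := hfℳ (Fin.cons 0 d) (Fin.cons 1 a) (Fin.cases h1 fun i => ha i)
      rwa [Fin.sum_univ_succ, Fin.cons_zero, Nat.cast_zero, zero_add] at this
    have hg0D := bimoduleD_cons_one l r h.l_one hfN hD
    -- The difference of `f` and the coboundary of `f (1, ⋯)`, as a function of its last arguments.
    let k : (Fin (n + 1) → Q) → Q → M := fun b y => f (Fin.cons y b) + l y (f (Fin.cons 1 b))
    have hk (a : Fin (n + 2) → Q) : k (fun i => a i.succ) (a 0) =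
        f a + bimoduleD l r (fun b => f (Fin.cons 1 b)) a := by
      rw [hg0D]
      exact congrArg (f · + _) (Fin.cons_self_tail a)
    have hkN (b) : k b ∈ reducedMaps Q N := by
      refine ⟨((isLinearMap_of_isMultilinear_cons hf b).mk' _ +
        (h.l_linear _ (hfN (Fin.cons 1 b))).mk' _).isLinear,
        fun y => add_mem (hfN _) (h.l_mem _ _ (hfN _)), ?_⟩
      change f _ + l 1 (f _) = 0
      rw [h.l_one _ (hfN _), ZModModule.add_self]
    have hkD (a : Fin (n + 2) → Q) :
        bimoduleD (curryLeftAction l) (curryRightAction r) k a = 0 := by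
      funext x
      have e : k = fun b y => (fun a => f a + bimoduleD l r (fun b => f (Fin.cons 1 b)) a)
          (Fin.cons y b) := by
        funext b y
        exact hk (Fin.cons y b)
      rw [e]
      refine (bimoduleD_cons l r (fun a => f a + bimoduleD l r (fun b => f (Fin.cons 1 b)) a)
        x a).symm.trans ?_
      rw [bimoduleD_add, hD, bimoduleD_bimoduleD l r h.l_mul h.r_mul h.comm]
      exact add_zero 0
    have hkℳ (d : Fin (n + 1) → ℕ) (a) (ha : ∀ i, a i ∈ 𝒬 (d i)) :
        k a ∈ gradedMaps 𝒬 ℳ ((∑ i, (d i : ℤ)) + s) := by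
      intro e y hy
      have e1 := hfℳ (Fin.cons e d) (Fin.cons y a) (Fin.cases hy fun i => ha i)
      have e2 := h.l_graded e y hy _ _ (hg0ℳ d a ha)
      rw [Fin.sum_univ_succ] at e1
      simp only [Fin.cons_zero, Fin.cons_succ] at e1
      rw [add_assoc, add_comm] at e1
      exact add_mem e1 e2
    obtain ⟨g, hg, hgN, hgℳ, hfgℳ, hfg⟩ := ih (isGradedBimodule_curry h𝒬 h)
      (isMultilinear_pi fun y => (isMultilinear_cons hf y).add (hg0.map (l y))) hkN
      hkℳ hkD
    have hgD (a : Fin (n + 2) → Q) :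
        bimoduleD l r (fun a => g (fun i => a i.succ) (a 0)) a =
          bimoduleD (curryLeftAction l) (curryRightAction r) g (fun i => a i.succ) (a 0) := by
      conv_lhs => rw [← Fin.cons_self_tail a, bimoduleD_cons]
      rfl
    have hfgk (a : Fin (n + 2) → Q) : f a + bimoduleD l r
        (fun a => f (Fin.cons 1 a) + g (fun i => a i.succ) (a 0)) a =
          (k (fun i => a i.succ) +
            bimoduleD (curryLeftAction l) (curryRightAction r) g (fun i => a i.succ)) (a 0) := by
      rw [bimoduleD_add, ← add_assoc, hgD, Pi.add_apply, hk]
    refine ⟨fun a => f (Fin.cons 1 a) + g (fun i => a i.succ) (a 0),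
      hg0.add (isMultilinear_uncurry hg fun b => (hgN b).1),
      fun a => add_mem (hfN _) ((hgN _).2.1 _), fun d a ha => add_mem (hg0ℳ d a ha) ?_,
      fun d a ha => ?_, fun a ha => ?_⟩
    · have := hgℳ (fun i => d i.succ) (fun i => a i.succ) (fun i => ha _) _ _ (ha 0)
      rwa [Fin.sum_univ_succ, add_assoc, add_comm]
    · rw [hfgk, Fin.sum_univ_succ, add_assoc, add_comm]
      exact hfgℳ (fun i => d i.succ) _ (fun i => ha _) _ _ (ha 0)
    · refine (add_eq_zero_iff_eq_neg.1 ?_).trans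
        (neg_eq_of_add_eq_zero_left (ZModModule.add_self _))
      rw [hfgk]
      obtain ⟨i, hi⟩ := ha
      cases i using Fin.cases with
      | zero =>
        rw [hi]
        exact (add_mem (hkN _) (bimoduleD_mem _ _ (isGradedBimodule_curry h𝒬 h).l_mem
          (isGradedBimodule_curry h𝒬 h).r_mem hgN _)).2.2
      | succ i =>
        rw [← hfg _ ⟨i, hi⟩]
        exact ZModModule.add_self _

/-- The differential preserves the cochains which vanish when an argument is `1`. -/
theorem bimoduleD_eq_zero_of_normalized {Q : Type u} {M : Type (max u v)} [CommRing Q]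
    [Algebra (ZMod 2) Q] [AddCommGroup M] [Module (ZMod 2) M] (l r : Q → Module.End (ZMod 2) M)
    {N : Set M} (hl : ∀ m ∈ N, l 1 m = m) (hr : ∀ m ∈ N, r 1 m = m) {n : ℕ} {f : (Fin n → Q) → M}
    (hfN : ∀ a, f a ∈ N) (hf : ∀ a, (∃ i, a i = 1) → f a = 0) (a : Fin (n + 1) → Q)
    (ha : ∃ i, a i = 1) : bimoduleD l r f a = 0 := by
  induction n generalizing M with
  | zero =>
    obtain ⟨i, hi⟩ := ha
    obtain rfl : i = 0 := Fin.fin_one_eq_zero i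
    simp only [bimoduleD, Fintype.sum_empty, add_zero]
    rw [show Fin.last 0 = 0 from rfl, hi, hl _ (hfN _), hr _ (hfN _)]
    rw [show (fun i : Fin 0 => a i.succ) = fun i => a i.castSucc from Subsingleton.elim _ _]
    exact ZModModule.add_self _
  | succ n ih =>
    obtain ⟨x, a, rfl⟩ : ∃ x b, a = Fin.cons x b := ⟨_, _, (Fin.cons_self_tail a).symm⟩
    obtain ⟨i, hi⟩ := ha
    cases i using Fin.cases with
    | zero =>
      rw [Fin.cons_zero] at hi
      subst hi
      have e (b : Fin n → Q) : f (Fin.cons 1 b) = 0 := hf _ ⟨0, rfl⟩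
      have h : (Fin.cons (1 * a 0) fun i => a i.succ : Fin (n + 1) → Q) = a := by
        rw [one_mul]; exact Fin.cons_self_tail a
      rw [bimoduleD_cons_expand, h, hl _ (hfN _)]
      simp only [e, Finset.sum_const_zero, map_zero, ZModModule.add_self]
    | succ i =>
      rw [Fin.cons_succ] at hi
      rw [bimoduleD_cons]
      refine congrFun (ih (curryLeftAction l) (curryRightAction r)
        (N := {φ | φ 1 = 0 ∧ ∀ y, φ y ∈ N}) ?_ ?_ (fun b => ?_) (fun b hb => ?_) a ⟨i, hi⟩) x
      · intro φ hφ; funext y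
        rw [curryLeftAction_apply, mul_one, hφ.1, map_zero, add_zero]
      · intro φ hφ; funext y; exact hr _ (hφ.2 y)
      · exact ⟨hf _ ⟨0, rfl⟩, fun y => hfN _⟩
      · funext y
        obtain ⟨j, hj⟩ := hb
        exact hf _ ⟨j.succ, by rw [Fin.cons_succ, hj]⟩

end Normalization

/-! ### Hochschild cochains and linear forms on words -/

section Normalized

variable {Q M : Type*} [CommRing Q] [Algebra (ZMod 2) Q] [AddCommGroup M] [Module (ZMod 2) M]
  [Module Q M] [IsScalarTower (ZMod 2) Q M]

/-- The action of `Q` on a module by linear maps. -/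
def smulEnd (M : Type*) [AddCommGroup M] [Module (ZMod 2) M] [Module Q M] (q : Q) :
    Module.End (ZMod 2) M :=
  (DistribSMul.toAddMonoidHom M q).toZModLinearMap 2

theorem hochschildD_apply {n : ℕ} (f : MultilinearMap (ZMod 2) (fun _ : Fin n => Q) M)
    (a : Fin (n + 1) → Q) :
    hochschildD (ZMod 2) Q M n f a = bimoduleD (smulEnd M) (smulEnd M) f a := by
  have h : (-1 : ZMod 2) = 1 := rfl
  change hochschildFun f a = _
  simp only [hochschildFun, h, one_pow, one_smul]
  rfl

theorem isGradedBimodule_smulEnd {𝒬 : ℕ → Submodule (ZMod 2) Q} {ℳ : ℤ → Submodule (ZMod 2) M}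
    (h : ∀ d, ∀ q ∈ 𝒬 d, ∀ j, ∀ m ∈ ℳ j, q • m ∈ ℳ (j + d)) :
    IsGradedBimodule 𝒬 (smulEnd M) (smulEnd M) ⊤ ℳ where
  l_mul a b m := mul_smul a b m
  r_mul a b m := by rw [mul_comm]; exact mul_smul b a m
  comm a b m := smul_comm a b m
  l_mem _ _ _ := Submodule.mem_top
  r_mem _ _ _ := Submodule.mem_top
  l_linear m _ := ⟨fun a b => add_smul a b m, fun c a => smul_assoc c a m⟩
  l_one m _ := one_smul Q m
  l_graded := h

universe u v

variable {Q : Type u} {M : Type (max u v)} [CommRing Q] [Algebra (ZMod 2) Q] [AddCommGroup M]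
  [Module (ZMod 2) M] [Module Q M] [IsScalarTower (ZMod 2) Q M]

/-- If the normalized cocycles are coboundaries, then all cocycles are. -/
theorem subsingleton_gradedHH_of_normalized {𝒬 : ℕ → Submodule (ZMod 2) Q}
    {ℳ : ℤ → Submodule (ZMod 2) M} (h𝒬 : ∀ d e, ∀ x ∈ 𝒬 d, ∀ y ∈ 𝒬 e, x * y ∈ 𝒬 (d + e))
    (h1 : 1 ∈ 𝒬 0) (hℳ : ∀ d, ∀ q ∈ 𝒬 d, ∀ j, ∀ m ∈ ℳ j, q • m ∈ ℳ (j + d)) (n : ℕ) (s : ℤ)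
    (h : ∀ f ∈ gradedCochains 𝒬 ℳ (n + 1) s, hochschildD (ZMod 2) Q M (n + 1) f = 0 →
      (∀ a, (∃ i, a i = 1) → f a = 0) →
      ∃ g ∈ gradedCochains 𝒬 ℳ n s, hochschildD (ZMod 2) Q M n g = f) :
    Subsingleton (GradedHH 𝒬 ℳ (n + 1) s) := by
  rw [Submodule.Quotient.subsingleton_iff, eq_top_iff]
  rintro ⟨f, hf, hfD⟩ -
  have hfD : hochschildD (ZMod 2) Q M (n + 1) f = 0 := hfD
  obtain ⟨g, ⟨G, hG⟩, -, hgℳ, hfgℳ, hfg⟩ := exists_normalization.{u, v} h𝒬 h1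
    (isGradedBimodule_smulEnd hℳ) (f := f) ⟨f, fun _ => rfl⟩ (fun _ => Submodule.mem_top) s hf
    (fun a => by rw [← hochschildD_apply, hfD]; rfl)
  obtain rfl : ⇑G = g := funext hG
  have hGs : G ∈ gradedCochains 𝒬 ℳ n s := fun d a ha => hgℳ d a ha
  have hDD : hochschildD (ZMod 2) Q M (n + 1) (hochschildD (ZMod 2) Q M n G) = 0 := by
    ext a
    rw [hochschildD_apply]
    have e : ⇑(hochschildD (ZMod 2) Q M n G) = bimoduleD (smulEnd M) (smulEnd M) G :=
      funext (hochschildD_apply G)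
    have hs := isGradedBimodule_smulEnd hℳ
    rw [e, bimoduleD_bimoduleD.{u, v} _ _ hs.l_mul hs.r_mul hs.comm]
    rfl
  obtain ⟨g', hg', hD⟩ := h (f + hochschildD (ZMod 2) Q M n G)
    (fun d a ha => by
      rw [add_apply, hochschildD_apply]
      exact hfgℳ d a ha)
    (by rw [map_add, hfD, hDD, add_zero])
    (fun a ha => by
      rw [add_apply, hfg a ha, hochschildD_apply, ZModModule.add_self])
  refine ⟨g' + G, add_mem hg' hGs, ?_⟩
  rw [map_add, hD, add_assoc]
  ext a
  rw [add_apply, add_apply, ZModModule.add_self, add_zero]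
  rfl

theorem eq_zero_of_span {X : Set Q} (hX : Submodule.span (ZMod 2) X = ⊤) {n : ℕ}
    (f : MultilinearMap (ZMod 2) (fun _ : Fin n => Q) M) (h : ∀ a, (∀ i, a i ∈ X) → f a = 0) :
    f = 0 := by
  induction n with
  | zero =>
    ext a
    exact h a (fun i => i.elim0)
  | succ n ih =>
    have h1 : f.curryLeft = 0 := LinearMap.ext_on hX fun x hx =>
      ih (f.curryLeft x) fun a ha => h (Fin.cons x a) (Fin.cases hx ha)
    ext a
    rw [← Fin.cons_self_tail a, ← MultilinearMap.curryLeft_apply, h1]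
    rfl

end Normalized

namespace BarWords

section Cochain

variable {P ι S M N : Type*} [NonUnitalCommRing P] [Module (ZMod 2) P] [IsScalarTower (ZMod 2) P P]
  [SMulCommClass (ZMod 2) P P] [CommRing S] [Algebra (ZMod 2) S] (β : Module.Basis ι (ZMod 2) P)
  (ε : P →ₙₐ[ZMod 2] S) [AddCommGroup M] [Module (ZMod 2) M] [Module (Unitization (ZMod 2) P) M]
  [IsScalarTower (ZMod 2) (Unitization (ZMod 2) P) M]
  [AddCommGroup N] [Module (ZMod 2) N] [Module S N] [IsScalarTower (ZMod 2) S N]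

theorem contractNth_inr {n : ℕ} (i : Fin n) (a : Fin (n + 1) → P) :
    (Fin.contractNth i.castSucc (· * ·) (fun i => (a i : Unitization (ZMod 2) P)) :
      Fin n → Unitization (ZMod 2) P) =
      fun j => ((Fin.contractNth i.castSucc (· * ·) a j : P) : Unitization (ZMod 2) P) := by
  funext j
  simp only [Fin.contractNth]
  split_ifs
  · rfl
  · exact (Unitization.inr_mul _ _ _).symm
  · rfl

/-- The differential, on arguments from `P`. -/
theorem hochschildD_inr {n : ℕ}
    (f : MultilinearMap (ZMod 2) (fun _ : Fin n => Unitization (ZMod 2) P) M)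
    (a : Fin (n + 1) → P) :
    hochschildD (ZMod 2) (Unitization (ZMod 2) P) M n f (fun i => (a i : Unitization (ZMod 2) P)) =
      (a 0 : Unitization (ZMod 2) P) • f (fun i => (a i.succ : Unitization (ZMod 2) P)) +
      ∑ i : Fin n, f (fun j => ((Fin.contractNth i.castSucc (· * ·) a j : P) :
        Unitization (ZMod 2) P)) +
      (a (Fin.last n) : Unitization (ZMod 2) P) •
        f (fun i => (a i.castSucc : Unitization (ZMod 2) P)) := by
  rw [hochschildD_apply]
  simp only [bimoduleD, contractNth_inr]
  rfl

/-- A cocycle gives an `S`-linear form on words vanishing on boundaries. -/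
theorem exists_linearMap_of_cocycle (E : M →ₗ[ZMod 2] N)
    (hE : ∀ (p : P) m, E ((p : Unitization (ZMod 2) P) • m) = ε p • E m) {n : ℕ}
    {f : MultilinearMap (ZMod 2) (fun _ : Fin n => Unitization (ZMod 2) P) M}
    (hf : hochschildD (ZMod 2) (Unitization (ZMod 2) P) M n f = 0) :
    ∃ F : BarWords ι S →ₗ[S] N,
      (∀ a : Fin n → P, F (tensor S β n a) = E (f fun i => (a i : Unitization (ZMod 2) P))) ∧
      ∀ z ∈ ofLength ι S (n + 1), F (bar β ε z) = 0 := by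
  obtain ⟨F, hF, -⟩ := exists_linearMap_tensor (S := S) β n
    (E.compMultilinearMap (f.compLinearMap fun _ => Unitization.inrHom (ZMod 2) (ZMod 2) P))
  have hF (a : Fin n → P) :
      F (tensor S β n a) = E (f fun i => (a i : Unitization (ZMod 2) P)) := hF a
  refine ⟨F, hF, fun z hz => ?_⟩
  refine (Submodule.mem_bot S).1 (map_mem_of_length (F ∘ₗ bar β ε) (fun w hw => ?_) hz)
  obtain ⟨v, rfl⟩ : ∃ v : Fin (n + 1) → ι, w = List.ofFn v :=
    ⟨fun i => w.get (i.cast hw.symm),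
      List.ext_get (by rw [List.length_ofFn, hw]) fun _ _ _ => by simp [-List.ofFn_succ]⟩
  rw [Submodule.mem_bot, LinearMap.comp_apply, ← tensor_basis S β, bar_tensor, map_add, map_add,
    map_smul, map_smul, map_sum]
  simp only [hF, ← hE, ← map_sum, ← map_add]
  refine (congrArg E ?_).trans (map_zero E)
  rw [← hochschildD_inr f fun i => β (v i), hf]
  rfl

end Cochain

section Graded

open PositivePart

variable {V A S M N : Type*} [AddCommGroup V] [Module (ZMod 2) V] [BooleanRing A]
  [CommRing S] [Algebra (ZMod 2) S] [AddCommGroup M] [Module (ZMod 2) M]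
  [AddCommGroup N] [Module (ZMod 2) N] [Module S N] [IsScalarTower (ZMod 2) S N]

theorem tensor_weight {n : ℕ} {d : Fin n → ℕ+} {a : Fin n → PositivePart V A}
    (ha : ∀ i, a i ∈ grading V A (d i)) : tensor S (basis V A) n a ∈
      Finsupp.supported S S {w : List (Idx V A) | weight w = ∑ i, (d i : ℕ)} := by
  induction n with
  | zero => exact Finsupp.single_mem_supported _ _ rfl
  | succ n ih =>
    rw [tensor_succ]
    refine cons_mem _ (fun i hi w hw => ?_) (ih fun i => ha i.succ)
    rw [Set.mem_ofPred_eq] at hw ⊢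
    rw [weight_cons, hw, deg_eq_of_repr_ne_zero (ha 0) hi, Fin.sum_univ_succ]

/-- The cochain obtained from a linear form `G` by applying, in each degree `j`, a linear map
`pr j` to its values. -/
theorem exists_graded_cochain (G : BarWords (Idx V A) S →ₗ[S] N) (pr : ℤ → N →ₗ[ZMod 2] M)
    (n : ℕ) : ∃ γ : MultilinearMap (ZMod 2) (fun _ : Fin n => PositivePart V A) M,
      ∀ (d : Fin n → ℕ+) a, (∀ i, a i ∈ grading V A (d i)) →
        γ a = pr (∑ i, (d i : ℤ)) (G (tensor S (basis V A) n a)) := by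
  let G' : BarWords (Idx V A) (ZMod 2) →ₗ[ZMod 2] N :=
    Finsupp.linearCombination (ZMod 2) fun w => G (Finsupp.single w 1)
  let L : BarWords (Idx V A) (ZMod 2) →ₗ[ZMod 2] M :=
    Finsupp.linearCombination (ZMod 2) fun w => pr (weight w) (G (Finsupp.single w 1))
  have hG' : G'.compMultilinearMap (tensor (ZMod 2) (basis V A) n) =
      (G.restrictScalars (ZMod 2)).compMultilinearMap (tensor S (basis V A) n) :=
    Module.Basis.ext_multilinear (fun _ => basis V A) fun v => by simp [tensor_basis, G']
  refine ⟨L.compMultilinearMap (tensor (ZMod 2) (basis V A) n), fun d a ha => ?_⟩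
  have h : (L - pr (∑ i, (d i : ℤ)) ∘ₗ G') (tensor (ZMod 2) (basis V A) n a) ∈
      (⊥ : Submodule (ZMod 2) M) := by
    refine map_mem_of_single _ (fun w hw => ?_) (tensor_weight ha)
    rw [Set.mem_ofPred_eq] at hw
    simp [L, G', hw]
  rw [Submodule.mem_bot, LinearMap.sub_apply, sub_eq_zero] at h
  exact h.trans (congrArg (pr _) (congrArg (fun H => H a) hG'))

end Graded

end BarWords

/-! ### Coboundaries from linear forms -/

theorem sum_contractNth {n : ℕ} (j : Fin n) (d : Fin (n + 1) → ℕ+) :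
    ∑ i, ((Fin.contractNth j.castSucc (· + ·) d i : ℕ+) : ℤ) = ∑ i, (d i : ℤ) := by
  induction n with
  | zero => exact j.elim0
  | succ n ih =>
    rw [Fin.sum_univ_succ, Fin.sum_univ_succ (n := n + 1)]
    cases j using Fin.cases with
    | zero =>
      rw [Fin.castSucc_zero, contractNth_zero_zero, Fin.sum_univ_succ (n := n)]
      simp only [contractNth_zero_succ]
      push_cast
      rw [add_assoc]
      rfl
    | succ j =>
      rw [← Fin.succ_castSucc, contractNth_succ_zero]
      simp only [contractNth_succ_succ]
      rw [ih]

namespace DualBoolean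

open PositivePart

variable {V A : Type*} [AddCommGroup V] [Module (ZMod 2) V] [BooleanRing A]

theorem mem_grading_zero {x : DualBoolean V A} : x ∈ DualBoolean.grading V A 0 ↔ x.snd = 0 :=
  Iff.rfl

theorem mem_grading_succ {n : ℕ} {x : DualBoolean V A} :
    x ∈ DualBoolean.grading V A (n + 1) ↔ x.fst = 0 ∧ x.snd ∈ PositivePart.grading V A n.succPNat :=
  Iff.rfl

theorem inr_mem_grading {n : ℕ+} {p : PositivePart V A} (hp : p ∈ PositivePart.grading V A n) :
    (p : DualBoolean V A) ∈ DualBoolean.grading V A n := by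
  obtain ⟨m, rfl⟩ : ∃ m : ℕ, n = m.succPNat := ⟨n.natPred, (PNat.succPNat_natPred n).symm⟩
  exact mem_grading_succ.2 ⟨rfl, hp⟩

theorem one_mem_grading : (1 : DualBoolean V A) ∈ DualBoolean.grading V A 0 :=
  mem_grading_zero.2 Unitization.snd_one

/-- The algebra is spanned by `1` and the homogeneous elements of positive degree. -/
theorem span_eq_top : Submodule.span (ZMod 2) {x : DualBoolean V A | x = 1 ∨
    ∃ d : ℕ+, ∃ p ∈ PositivePart.grading V A d, x = p} = ⊤ := by
  rw [eq_top_iff]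
  rintro x -
  induction x using Unitization.ind with
  | inl_add_inr c p =>
    refine add_mem ?_ ?_
    · have h : (Unitization.inl c : DualBoolean V A) = c • 1 := by
        rw [← Unitization.inl_one, ← Unitization.inl_smul, smul_eq_mul, mul_one]
      rw [h]
      exact Submodule.smul_mem _ _ (Submodule.subset_span (Or.inl rfl))
    · induction p using PositivePart.induction_mono with
      | add p q hp hq => rw [Unitization.inr_add]; exact add_mem hp hq
      | inl v => exact Submodule.subset_span (Or.inr ⟨1, _, inl_mem_grading v, rfl⟩)
      | mono n a =>
        exact Submodule.subset_span (Or.inr ⟨n, _, PositivePart.mono_mem_grading n a, rfl⟩)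

theorem mul_mem_grading (d e : ℕ) (x : DualBoolean V A) (hx : x ∈ DualBoolean.grading V A d)
    (y : DualBoolean V A) (hy : y ∈ DualBoolean.grading V A e) :
    x * y ∈ DualBoolean.grading V A (d + e) := by
  have hinl {e : ℕ} {y : DualBoolean V A} (hy : y ∈ DualBoolean.grading V A e) {x : DualBoolean V A}
      (hx : x.snd = 0) : x * y ∈ DualBoolean.grading V A e := by
    have h : x * y = x.fst • y := by
      ext1
      · simp
      · simp [hx]
    rw [h]
    exact Submodule.smul_mem _ _ hy
  cases d with
  | zero => rw [zero_add]; exact hinl hy hx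
  | succ d =>
    cases e with
    | zero => rw [add_zero, mul_comm]; exact hinl hx hy
    | succ e =>
      rw [← add_assoc, mem_grading_succ]
      rw [mem_grading_succ] at hx hy
      refine ⟨by rw [Unitization.fst_mul, hx.1, zero_mul], ?_⟩
      rw [Unitization.snd_mul, hx.1, hy.1, zero_smul, zero_smul, zero_add, zero_add]
      have h := PositivePart.mul_mem_grading hx.2 hy.2
      have e1 : d.succPNat + e.succPNat = (d + 1 + e).succPNat := by
        rw [← PNat.coe_inj, PNat.add_coe, Nat.succPNat_coe, Nat.succPNat_coe, Nat.succPNat_coe]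
        omega
      rwa [e1] at h

end DualBoolean

namespace BarWords

open PositivePart

section Coboundary

theorem contractNth_mem_grading {V A : Type*} [AddCommGroup V] [Module (ZMod 2) V] [BooleanRing A]
    {n : ℕ} (j : Fin n) {d : Fin (n + 1) → ℕ+} {a : Fin (n + 1) → PositivePart V A}
    (ha : ∀ i, a i ∈ PositivePart.grading V A (d i)) (i : Fin n) :
    Fin.contractNth j.castSucc (· * ·) a i ∈
      PositivePart.grading V A (Fin.contractNth j.castSucc (· + ·) d i) := by
  simp only [Fin.contractNth]
  split_ifs
  · exact ha _
  · exact PositivePart.mul_mem_grading (ha _) (ha _)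
  · exact ha _

theorem le_sum_degrees {n : ℕ} (d : Fin n → ℕ+) : (n : ℤ) ≤ ∑ i, (d i : ℤ) := by
  have h : ∑ _i : Fin n, (1 : ℤ) ≤ ∑ i, (d i : ℤ) :=
    Finset.sum_le_sum fun i _ => by exact_mod_cast (d i).pos
  simpa using h

universe u v

variable {V : Type u} {A : Type v} {M : Type (max u v)} {S N : Type*} [AddCommGroup V]
  [Module (ZMod 2) V] [BooleanRing A]
  [CommRing S] [Algebra (ZMod 2) S] [AddCommGroup M] [Module (ZMod 2) M]
  [Module (DualBoolean V A) M] [IsScalarTower (ZMod 2) (DualBoolean V A) M]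
  [AddCommGroup N] [Module (ZMod 2) N] [Module S N] [IsScalarTower (ZMod 2) S N]

/-- Let the linear form `F` on words be given by the values of a normalized cochain `f`, regarded
by `E` as elements of an `S`-module `N`, and let `F` be the coboundary of a linear form `G`. If
the values of `f` can be recovered from those of `F` in the degrees in question, compatibly with
the actions, then `f` is a coboundary. -/
theorem exists_hochschildD_eq {ℳ : ℤ → Submodule (ZMod 2) M} (ε : PositivePart V A →ₙₐ[ZMod 2] S)
    (E : M →ₗ[ZMod 2] N) {n : ℕ} {s : ℤ}
    {f : MultilinearMap (ZMod 2) (fun _ : Fin (n + 1) => DualBoolean V A) M}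
    (hf : f ∈ gradedCochains (DualBoolean.grading V A) ℳ (n + 1) s)
    (hf1 : ∀ a, (∃ i, a i = 1) → f a = 0) {F G : BarWords (Idx V A) S →ₗ[S] N}
    (hF : ∀ a : Fin (n + 1) → PositivePart V A,
      F (tensor S (basis V A) (n + 1) a) = E (f fun i => (a i : DualBoolean V A)))
    (hG : ∀ z ∈ ofLength (Idx V A) S (n + 1), F z = G (bar (basis V A) ε z))
    (pr : ℤ → N →ₗ[ZMod 2] M) (hpr : ∀ j x, pr j x ∈ ℳ j)
    (hprE : ∀ j, n + 1 + s ≤ j → ∀ m ∈ ℳ j, pr j (E m) = m)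
    (hprε : ∀ j, n + s ≤ j → ∀ (d : ℕ+), ∀ p ∈ PositivePart.grading V A d, ∀ x,
      (p : DualBoolean V A) • pr j x = pr (j + d) (ε p • x)) :
    ∃ g ∈ gradedCochains (DualBoolean.grading V A) ℳ n s,
      hochschildD (ZMod 2) (DualBoolean V A) M n g = f := by
  obtain ⟨γ, hγ⟩ := exists_graded_cochain G (fun j => pr (j + s)) n
  let g : MultilinearMap (ZMod 2) (fun _ : Fin n => DualBoolean V A) M :=
    γ.compLinearMap fun _ => Unitization.sndHom (ZMod 2) (ZMod 2) (PositivePart V A)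
  have hg (a : Fin n → DualBoolean V A) : g a = γ fun i => (a i).snd := rfl
  have hg0 (a : Fin n → DualBoolean V A) (h : ∃ i, (a i).snd = 0) : g a = 0 := by
    obtain ⟨i, hi⟩ := h
    exact γ.map_coord_zero i hi
  have hg1 (a : Fin n → DualBoolean V A) (h : ∃ i, a i = 1) : g a = 0 := by
    obtain ⟨i, hi⟩ := h
    exact hg0 a ⟨i, by rw [hi, Unitization.snd_one]⟩
  refine ⟨g, fun d a ha => ?_, ?_⟩
  · by_cases h : ∃ i, (a i).snd = 0
    · rw [hg0 a h]
      exact zero_mem _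
    · have h' (i : Fin n) : ∃ e : ℕ+, (e : ℕ) = d i ∧ (a i).snd ∈ PositivePart.grading V A e := by
        have hi := ha i
        cases hd : d i with
        | zero =>
          rw [hd] at hi
          exact absurd ⟨i, DualBoolean.mem_grading_zero.1 hi⟩ h
        | succ m =>
          rw [hd] at hi
          exact ⟨m.succPNat, Nat.succPNat_coe m, (DualBoolean.mem_grading_succ.1 hi).2⟩
      choose e he hea using h'
      rw [hg, hγ e _ hea]
      simp only [he]
      exact hpr _ _
  · rw [← sub_eq_zero]
    refine eq_zero_of_span DualBoolean.span_eq_top _ fun a ha => ?_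
    rw [sub_apply]
    by_cases h : ∃ i, a i = 1
    · rw [hf1 a h, sub_zero, hochschildD_apply]
      exact bimoduleD_eq_zero_of_normalized.{max u v, max u v} (smulEnd M) (smulEnd M)
        (N := Set.univ)
        (fun m _ => one_smul _ m) (fun m _ => one_smul _ m) (fun _ => Set.mem_univ _) hg1 a h
    · have h' (i) := (ha i).resolve_left fun hi => h ⟨i, hi⟩
      choose d b hb hab using h'
      obtain rfl : a = fun i => (b i : DualBoolean V A) := funext hab
      have hD : (n : ℤ) + 1 + s ≤ ∑ i, (d i : ℤ) + s := by
        have := le_sum_degrees d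
        push_cast at this
        omega
      have h1 : f (fun i => (b i : DualBoolean V A)) =
          pr (∑ i, (d i : ℤ) + s) (F (tensor S (basis V A) (n + 1) b)) := by
        rw [hF, hprE _ hD]
        have := hf (fun i => d i) _ fun i => DualBoolean.inr_mem_grading (hb i)
        exact_mod_cast this
      have h2 : ((b 0 : PositivePart V A) : DualBoolean V A) •
          g (fun i => (b i.succ : DualBoolean V A)) = pr (∑ i, (d i : ℤ) + s)
            (ε (b 0) • G (tensor S (basis V A) n fun i => b i.succ)) := by
        have hle := le_sum_degrees fun i => d i.succ
        rw [hg]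
        simp only [Unitization.snd_inr]
        rw [hγ (fun i => d i.succ) _ fun i => hb _, hprε _ (by omega) (d 0) _ (hb 0),
          Fin.sum_univ_succ]
        congr 2
        ring
      have h3 : ((b (Fin.last n) : PositivePart V A) : DualBoolean V A) •
          g (fun i => (b i.castSucc : DualBoolean V A)) = pr (∑ i, (d i : ℤ) + s)
            (ε (b (Fin.last n)) • G (tensor S (basis V A) n fun i => b i.castSucc)) := by
        have hle := le_sum_degrees fun i => d i.castSucc
        rw [hg]
        simp only [Unitization.snd_inr]
        rw [hγ (fun i => d i.castSucc) _ fun i => hb _, hprε _ (by omega) (d _) _ (hb _),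
          Fin.sum_univ_castSucc]
        congr 2
        ring
      have h4 (i : Fin n) : g (fun j => ((Fin.contractNth i.castSucc (· * ·) b j :
          PositivePart V A) : DualBoolean V A)) = pr (∑ i, (d i : ℤ) + s)
            (G (tensor S (basis V A) n (Fin.contractNth i.castSucc (· * ·) b))) := by
        rw [hg]
        simp only [Unitization.snd_inr]
        rw [hγ _ _ (contractNth_mem_grading i hb), sum_contractNth]
      rw [h1, hochschildD_inr, h2, h3, Finset.sum_congr rfl fun i _ => h4 i,
        hG _ (tensor_mem_ofLength _ _ _), bar_tensor, sub_eq_zero]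
      simp only [map_add, map_smul, map_sum]

end Coboundary

end BarWords

/-! ### Orthogonal idempotents -/

/-- A Boolean ring with at least eight elements has a decomposition of the unit into three nonzero
orthogonal idempotents. -/
theorem exists_orthogonal {A : Type*} [BooleanRing A] (hA : 8 ≤ #A) :
    ∃ e : Fin 3 → A, ∑ i, e i = 1 ∧ (∀ i j, i ≠ j → e i * e j = 0) ∧ ∀ i, e i ≠ 0 := by
  classical
  -- Without such a decomposition any two nonzero complementary idempotents `a` and `a + 1` are
  -- atoms, so that `x` is determined by whether `x a` and `x (a + 1)` vanish.
  by_contra hne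
  have key (a x : A) (ha : a + 1 ≠ 0) (hx : x * a = x) : x = 0 ∨ x = a := by
    by_contra! h
    have hs (y : A) : y * y = y := BooleanRing.mul_self y
    have h2 (y : A) : y + y = 0 := BooleanRing.add_self y
    refine hne ⟨![x, x + a, a + 1], ?_, ?_, ?_⟩
    · rw [Fin.sum_univ_three]
      change x + (x + a) + (a + 1) = 1
      linear_combination h2 x + h2 a
    · have h01 : x * (x + a) = 0 := by linear_combination hs x + hx + h2 x
      have h02 : x * (a + 1) = 0 := by linear_combination hx + h2 x
      have h12 : (x + a) * (a + 1) = 0 := by linear_combination hx + hs a + h2 x + h2 a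
      intro i j hij
      fin_cases i <;> fin_cases j <;> first | exact absurd rfl hij | skip
      · exact h01
      · exact h02
      · exact (mul_comm _ _).trans h01
      · exact h12
      · exact (mul_comm _ _).trans h02
      · exact (mul_comm _ _).trans h12
    · intro i
      fin_cases i
      · exact h.1
      · intro h0
        have h0 : x + a = 0 := h0
        exact h.2 (by linear_combination h0 - h2 a)
      · exact ha
  obtain ⟨f, hf⟩ : ∃ f : A → Bool × Bool, Function.Injective f := by
    by_cases h01 : ∃ a : A, a ≠ 0 ∧ a + 1 ≠ 0
    · obtain ⟨a, ha0, ha1⟩ := h01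
      have hs (x b : A) : x * b * b = x * b := by rw [mul_assoc, BooleanRing.mul_self]
      have h2 : a + 1 + 1 = a := by linear_combination BooleanRing.add_self (1 : A)
      have k1 (x : A) := key a (x * a) ha1 (hs x a)
      have k2 (x : A) := key (a + 1) (x * (a + 1)) (by rwa [h2]) (hs x (a + 1))
      refine ⟨fun x => (decide (x * a = 0), decide (x * (a + 1) = 0)), fun x y hxy => ?_⟩
      rw [Prod.mk.injEq, decide_eq_decide, decide_eq_decide] at hxy
      have e1 : x * a = y * a := by
        rcases k1 x with h | h <;> rcases k1 y with h' | h' <;> simp_all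
      have e2 : x * (a + 1) = y * (a + 1) := by
        rcases k2 x with h | h <;> rcases k2 y with h' | h' <;> simp_all
      linear_combination e2 - e1
    · push Not at h01
      have h1 (x : A) (hx : x ≠ 0) : x = 1 := by
        linear_combination h01 x hx - BooleanRing.add_self (1 : A)
      refine ⟨fun x => (decide (x = 0), true), fun x y hxy => ?_⟩
      rw [Prod.mk.injEq, decide_eq_decide] at hxy
      by_cases hx : x = 0
      · rw [hx, hxy.1.1 hx]
      · rw [h1 x hx, h1 y fun h => hx (hxy.1.2 h)]
  have hcard : #A ≤ 4 :=
    calc #A ≤ #(ULift (Bool × Bool)) :=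
          Cardinal.mk_le_of_injective (f := fun x => ULift.up (f x)) fun x y h =>
            hf (ULift.up_injective h)
      _ = 4 := by simp
  exact absurd (hA.trans hcard) (by norm_num)

namespace BooleanPart

variable {A B : Type*} [BooleanRing A] [BooleanRing B]

theorem map_mem_grading (φ : A →+* B) {n : ℕ+} {p : BooleanPart A} (hp : p ∈ grading A n) :
    map φ p ∈ grading B n := by
  rw [eq_mono_of_mem_grading hp, map_mono]
  exact mono_mem_grading _ _

end BooleanPart

/-! ### Degrees in `V_* ⊓ B_*` -/

namespace DualBoolean

open PositivePart

universe u v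

variable {V : Type u} {A B : Type v} [AddCommGroup V] [Module (ZMod 2) V] [BooleanRing A]
  [BooleanRing B] (φ : A →+* B)

theorem map_inr (p : PositivePart V A) : DualBoolean.map V φ (p : DualBoolean V A) =
    ((p.1, BooleanPart.map φ p.2) : PositivePart V B) := by
  simp [DualBoolean.map]

theorem map_mem_grading {d : ℕ} {q : DualBoolean V A} (hq : q ∈ DualBoolean.grading V A d) :
    DualBoolean.map V φ q ∈ DualBoolean.grading V B d := by
  obtain ⟨c, p, rfl⟩ : ∃ (c : ZMod 2) (p : PositivePart V A),
      q = algebraMap (ZMod 2) _ c + (p : DualBoolean V A) :=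
    ⟨q.fst, q.snd, (Unitization.inl_fst_add_inr_snd_eq q).symm⟩
  rw [map_add, AlgHom.commutes, map_inr]
  cases d with
  | zero =>
    rw [mem_grading_zero] at hq ⊢
    have hp : p = 0 := by simpa [Unitization.algebraMap_eq_inl] using hq
    subst hp
    simp [Unitization.algebraMap_eq_inl]
  | succ d =>
    rw [mem_grading_succ] at hq ⊢
    simp only [Unitization.algebraMap_eq_inl, Unitization.fst_add, Unitization.snd_add] at hq ⊢
    simp at hq ⊢
    exact ⟨hq.1, hq.2.1, BooleanPart.map_mem_grading φ hq.2.2⟩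

/-- The sum of the unit component and of all the components in `B`. -/
noncomputable def augmentation (V B : Type*) [AddCommGroup V] [Module (ZMod 2) V] [BooleanRing B] :
    DualBoolean V B →ₐ[ZMod 2] B :=
  Unitization.lift (BarWords.character V (RingHom.id B))

theorem augmentation_inr (p : PositivePart V B) :
    augmentation V B (p : DualBoolean V B) = BarWords.character V (RingHom.id B) p := by
  simp [augmentation]

theorem augmentation_map_inr (p : PositivePart V A) :
    augmentation V B (DualBoolean.map V φ (p : DualBoolean V A)) = BarWords.character V φ p := by
  rw [map_inr, augmentation_inr]
  induction p using PositivePart.induction_mono with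
  | add p q hp hq =>
    rw [map_add, ← hp, ← hq, ← map_add]
    simp
  | inl v =>
    rw [BarWords.character_inl]
    simp [BarWords.character_inl]
  | mono n a =>
    rw [BarWords.character_mono, PositivePart.mono_apply, BooleanPart.map_mono,
      ← PositivePart.mono_apply, BarWords.character_mono, RingHom.id_apply]

/-- The element `b` of degree `j`, for `j > 0`. -/
noncomputable def place (V B : Type*) [AddCommGroup V] [Module (ZMod 2) V] [BooleanRing B] :
    ℤ → B →ₗ[ZMod 2] DualBoolean V B
  | Int.ofNat (n + 1) =>
    Unitization.inrHom (ZMod 2) (ZMod 2) (PositivePart V B) ∘ₗ PositivePart.mono V n.succPNat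
  | _ => 0

theorem place_pnat (d : ℕ+) (b : B) :
    place V B (d : ℤ) b = ((PositivePart.mono V d b : PositivePart V B) : DualBoolean V B) := by
  obtain ⟨m, rfl⟩ : ∃ m : ℕ, d = m.succPNat := ⟨d.natPred, (PNat.succPNat_natPred d).symm⟩
  rfl

theorem place_mem (j : ℤ) (b : B) : place V B j b ∈ intGrading (DualBoolean.grading V B) j := by
  match j with
  | Int.ofNat (n + 1) => exact mem_grading_succ.2 ⟨rfl, PositivePart.mono_mem_grading _ _⟩
  | Int.ofNat 0 => exact zero_mem _
  | Int.negSucc n => exact zero_mem _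

theorem place_augmentation {j : ℤ} (hj : 2 ≤ j) {m : DualBoolean V B}
    (hm : m ∈ intGrading (DualBoolean.grading V B) j) : place V B j (augmentation V B m) = m := by
  match j with
  | Int.ofNat (n + 2) =>
    obtain ⟨h1, h2, h3⟩ := mem_grading_succ.1 hm
    have hV : m.snd.1 = 0 := by
      rwa [SetLike.mem_coe, dualPartGrading, if_neg, Submodule.mem_bot] at h2
      rw [← PNat.coe_inj]
      simp
    obtain ⟨b, hb⟩ : ∃ b : B, m = ((PositivePart.mono V (n + 1).succPNat b : PositivePart V B) :
        DualBoolean V B) := by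
      refine ⟨BooleanPart.coeff m.snd.2 (n + 1).succPNat, ?_⟩
      ext1
      · exact h1
      · rw [Unitization.snd_inr, mono_apply, ← BooleanPart.eq_mono_of_mem_grading h3, ← hV]
    rw [hb, augmentation_inr, BarWords.character_mono]
    rfl
  | Int.ofNat 0 => exact absurd hj (by decide)
  | Int.ofNat 1 => exact absurd hj (by decide)
  | Int.negSucc n => exact absurd hj (by omega)

theorem map_mul_place {j : ℤ} (hj : 1 ≤ j) (d : ℕ+) {p : PositivePart V A}
    (hp : p ∈ PositivePart.grading V A d) (b : B) :
    DualBoolean.map V φ (p : DualBoolean V A) * place V B j b =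
      place V B (j + d) (BarWords.character V φ p * b) := by
  obtain ⟨e, rfl⟩ : ∃ e : ℕ+, (e : ℤ) = j := ⟨⟨j.toNat, by omega⟩, by simp; omega⟩
  have h1 : p = (p.1, 0) + PositivePart.mono V d (BooleanPart.coeff p.2 d) := by
    rw [mono_apply, ← BooleanPart.eq_mono_of_mem_grading hp.2]
    simp
  have h2 : ((p.1, BooleanPart.map φ p.2) : PositivePart V B) =
      (p.1, 0) + PositivePart.mono V d (φ (BooleanPart.coeff p.2 d)) := by
    rw [mono_apply, ← BooleanPart.map_mono, ← BooleanPart.eq_mono_of_mem_grading hp.2]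
    simp
  rw [map_inr, h2, place_pnat, ← Unitization.inr_mul, add_mul, inl_mul, zero_add,
    mono_mul_mono]
  have h3 : BarWords.character V φ p = φ (BooleanPart.coeff p.2 d) := by
    conv_lhs => rw [h1, map_add, BarWords.character_inl, BarWords.character_mono, zero_add]
  rw [h3, show (e : ℤ) + d = ((d + e : ℕ+) : ℤ) by push_cast; ring, place_pnat]

/-- The projection to the component of degree `d` of the positive part. -/
noncomputable def _root_.PositivePart.component (V B : Type*) [AddCommGroup V] [Module (ZMod 2) V]
    [BooleanRing B] (d : ℕ+) : PositivePart V B →ₗ[ZMod 2] PositivePart V B :=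
  (if d = 1 then LinearMap.id else 0 : DualPart V →ₗ[ZMod 2] DualPart V).prodMap
    (BooleanPart.mono d ∘ₗ Finsupp.lapply d ∘ₗ (BooleanPart.coeffEquiv B).toLinearMap)

theorem _root_.PositivePart.component_mem (d : ℕ+) (p : PositivePart V B) :
    PositivePart.component V B d p ∈ PositivePart.grading V B d := by
  refine ⟨?_, BooleanPart.mono_mem_grading _ _⟩
  rw [component, SetLike.mem_coe, dualPartGrading]
  split_ifs <;> simp

theorem _root_.PositivePart.component_of_mem {d e : ℕ+} {p : PositivePart V B}
    (hp : p ∈ PositivePart.grading V B e) :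
    PositivePart.component V B d p = if d = e then p else 0 := by
  obtain ⟨h1, h2⟩ := hp
  rw [SetLike.mem_coe, dualPartGrading] at h1
  split_ifs with h
  · subst h
    ext1
    · simp only [component, LinearMap.prodMap_apply]
      split_ifs with hd
      · rfl
      · rw [if_neg hd, Submodule.mem_bot] at h1
        rw [h1, map_zero]
    · exact (BooleanPart.eq_mono_of_mem_grading h2).symm
  · ext1
    · simp only [component, LinearMap.prodMap_apply]
      split_ifs with hd
      · rw [if_neg fun he => h (hd.trans he.symm), Submodule.mem_bot] at h1
        rw [h1, map_zero]
        rfl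
      · rfl
    · change BooleanPart.mono d (BooleanPart.coeff p.2 d) = 0
      rw [h2 d h, map_zero]

/-- The projection to the component of degree `j`. -/
noncomputable def component (V B : Type*) [AddCommGroup V] [Module (ZMod 2) V] [BooleanRing B] :
    ℤ → DualBoolean V B →ₗ[ZMod 2] DualBoolean V B
  | Int.ofNat 0 => Algebra.linearMap (ZMod 2) (DualBoolean V B) ∘ₗ
      (Unitization.fstHom (ZMod 2) (PositivePart V B)).toLinearMap
  | Int.ofNat (n + 1) => Unitization.inrHom (ZMod 2) (ZMod 2) (PositivePart V B) ∘ₗ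
      PositivePart.component V B n.succPNat ∘ₗ
        Unitization.sndHom (ZMod 2) (ZMod 2) (PositivePart V B)
  | Int.negSucc _ => 0

theorem component_mem (j : ℤ) (m : DualBoolean V B) :
    component V B j m ∈ intGrading (DualBoolean.grading V B) j := by
  match j with
  | Int.ofNat (n + 1) => exact mem_grading_succ.2 ⟨rfl, PositivePart.component_mem _ _⟩
  | Int.ofNat 0 => exact mem_grading_zero.2 (Unitization.snd_inl _ _)
  | Int.negSucc n => exact zero_mem _

theorem component_of_mem {j : ℤ} {e : ℕ} {m : DualBoolean V B}
    (hm : m ∈ DualBoolean.grading V B e) : component V B j m = if j = e then m else 0 := by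
  match j, e with
  | Int.ofNat 0, 0 =>
    rw [mem_grading_zero] at hm
    rw [if_pos (by rfl)]
    ext1
    · rfl
    · exact hm.symm
  | Int.ofNat (n + 1), 0 =>
    rw [mem_grading_zero] at hm
    rw [if_neg (by simp; omega)]
    ext1
    · rfl
    · change PositivePart.component V B n.succPNat m.snd = 0
      rw [hm, map_zero]
  | Int.ofNat 0, e + 1 =>
    rw [mem_grading_succ] at hm
    rw [if_neg (by simp; omega)]
    ext1
    · exact hm.1
    · rfl
  | Int.ofNat (n + 1), e + 1 =>
    rw [mem_grading_succ] at hm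
    have h := PositivePart.component_of_mem (d := n.succPNat) hm.2
    ext1
    · change (0 : ZMod 2) = _
      split_ifs
      · exact hm.1.symm
      · rfl
    · change PositivePart.component V B n.succPNat m.snd = _
      rw [h]
      by_cases hne : n = e
      · rw [if_pos (by rw [hne]), if_pos (by rw [hne]; rfl)]
      · rw [if_neg, if_neg]
        · rfl
        · simp; omega
        · intro h; exact hne (Nat.succPNat_injective h)
  | Int.negSucc n, e => rw [if_neg (by omega)]; rfl

theorem component_eq_self {j : ℤ} {m : DualBoolean V B}
    (hm : m ∈ intGrading (DualBoolean.grading V B) j) : component V B j m = m := by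
  match j with
  | Int.ofNat n => exact (component_of_mem hm).trans (if_pos rfl)
  | Int.negSucc n => exact ((Submodule.mem_bot (ZMod 2)).1 hm).symm

theorem mul_component (j : ℤ) {d : ℕ} {q : DualBoolean V B} (hq : q ∈ DualBoolean.grading V B d)
    (m : DualBoolean V B) : q * component V B j m = component V B (j + d) (q * m) := by
  have h : LinearMap.mulLeft (ZMod 2) q ∘ₗ component V B j =
      component V B (j + d) ∘ₗ LinearMap.mulLeft (ZMod 2) q := by
    refine LinearMap.ext_on span_eq_top fun x hx => ?_
    obtain ⟨e, he⟩ : ∃ e : ℕ, x ∈ DualBoolean.grading V B e := by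
      rcases hx with rfl | ⟨e, p, hp, rfl⟩
      · exact ⟨0, one_mem_grading⟩
      · exact ⟨e, inr_mem_grading hp⟩
    simp only [LinearMap.comp_apply, LinearMap.mulLeft_apply]
    rw [component_of_mem he, component_of_mem (mul_mem_grading _ _ _ hq _ he)]
    by_cases hj : j = e
    · rw [if_pos hj, if_pos (by rw [hj]; push_cast; ring)]
    · rw [if_neg hj, if_neg (by push_cast; omega), mul_zero]
  exact congrArg (fun L => L m) h

theorem mul_mem_intGrading {d : ℕ} {q : DualBoolean V B} (hq : q ∈ DualBoolean.grading V B d)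
    {j : ℤ} {m : DualBoolean V B} (hm : m ∈ intGrading (DualBoolean.grading V B) j) :
    q * m ∈ intGrading (DualBoolean.grading V B) (j + d) := by
  rw [← component_eq_self hm, mul_component j hq]
  exact component_mem _ _

end DualBoolean

/-! ### Vanishing of Hochschild cohomology -/

namespace BarWords

open PositivePart DualBoolean

universe u v

variable {V : Type u} {A B : Type v} [AddCommGroup V] [Module (ZMod 2) V] [BooleanRing A]
  [BooleanRing B] {φ : A →+* B} [Module (DualBoolean V A) (DualBoolean V B)]
  [IsScalarTower (ZMod 2) (DualBoolean V A) (DualBoolean V B)]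

theorem smul_mem_intGrading
    (hφ : ∀ (q : DualBoolean V A) (m : DualBoolean V B), q • m = DualBoolean.map V φ q * m) :
    ∀ d, ∀ q ∈ DualBoolean.grading V A d, ∀ j, ∀ m ∈ intGrading (DualBoolean.grading V B) j,
      q • m ∈ intGrading (DualBoolean.grading V B) (j + d) := fun d q hq j m hm => by
  rw [hφ]
  exact mul_mem_intGrading (map_mem_grading φ hq) hm

/-- Above the line `k + s = 1` the cohomology vanishes because that of the localized coefficients
`B` does: the values of a normalized cocycle have degree at least two, and in these degrees
`V_* ⊓ B_*` agrees with `B`. -/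
theorem subsingleton_of_two_le
    (hφ : ∀ (q : DualBoolean V A) (m : DualBoolean V B), q • m = DualBoolean.map V φ q * m)
    (n : ℕ) (s : ℤ) (hs : 2 ≤ n + 3 + s) :
    Subsingleton (GradedHH (DualBoolean.grading V A) (intGrading (DualBoolean.grading V B))
      (n + 3) s) := by
  refine subsingleton_gradedHH_of_normalized.{max u v, max u v}
    (DualBoolean.mul_mem_grading (V := V) (A := A)) (one_mem_grading (V := V) (A := A))
    (smul_mem_intGrading hφ)
    (n + 2) s fun f hf hfD hf1 => ?_
  obtain ⟨F, hF, hFb⟩ := exists_linearMap_of_cocycle (PositivePart.basis V A) (character V φ)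
    (augmentation V B).toLinearMap (fun p m => by
      rw [hφ, AlgHom.toLinearMap_apply, map_mul, augmentation_map_inr, smul_eq_mul]
      rfl) hfD
  obtain ⟨G, hG⟩ := exists_comp_bar_character φ F hFb
  refine exists_hochschildD_eq (character V φ) (augmentation V B).toLinearMap hf hf1 hF hG
    (place V B) place_mem (fun j hj m hm => place_augmentation ?_ hm) fun j hj d p hp x => ?_
  · push_cast at hj; omega
  · rw [hφ]
    exact map_mul_place φ (by push_cast at hj; omega) d hp x

/-- Below the line `k + s = 1` the cohomology vanishes because of the Koszul property: a cocycle
vanishes on arguments of total degree less than `-s`, where its values would have negative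
degree. -/
theorem subsingleton_of_nonpos (hφi : Function.Injective φ)
    (hφ : ∀ (q : DualBoolean V A) (m : DualBoolean V B), q • m = DualBoolean.map V φ q * m)
    (hA : 8 ≤ #A) (n : ℕ) (s : ℤ) (hs : n + 1 + s ≤ 0) :
    Subsingleton (GradedHH (DualBoolean.grading V A) (intGrading (DualBoolean.grading V B))
      (n + 1) s) := by
  refine subsingleton_gradedHH_of_normalized.{max u v, max u v}
    (DualBoolean.mul_mem_grading (V := V) (A := A)) (one_mem_grading (V := V) (A := A))
    (smul_mem_intGrading hφ)
    n s fun f hf hfD hf1 => ?_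
  obtain ⟨w, rfl⟩ : ∃ w : ℕ, s = -w := ⟨(-s).toNat, by omega⟩
  let ε := Unitization.inrNonUnitalAlgHom (ZMod 2) (PositivePart V A)
  obtain ⟨F, hF, hFb⟩ := exists_linearMap_of_cocycle (PositivePart.basis V A) ε
    (LinearMap.id : DualBoolean V B →ₗ[ZMod 2] DualBoolean V B) (fun p m => rfl) hfD
  -- The values on words, in the degree of the word.
  have hFu (u : List (Idx V A)) (hu : u.length = n + 1) : F (Finsupp.single u 1) ∈
      intGrading (DualBoolean.grading V B) (weight u - w) := by
    obtain ⟨v, rfl⟩ : ∃ v : Fin (n + 1) → Idx V A, u = List.ofFn v :=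
      ⟨fun i => u.get (i.cast hu.symm),
        List.ext_get (by rw [List.length_ofFn, hu]) fun _ _ _ => by simp [-List.ofFn_succ]⟩
    rw [← tensor_basis _ (PositivePart.basis V A), hF]
    have h := hf (fun i => deg (v i)) _ fun i => inr_mem_grading (basis_mem_grading (v i))
    have hw : (weight (List.ofFn v) : ℤ) = ∑ i, (deg (v i) : ℤ) := by
      rw [weight, List.map_ofFn, List.sum_ofFn]
      push_cast
      rfl
    rw [hw]
    exact h
  obtain ⟨G, hG⟩ := exists_comp_bar_of_weight (n := n) (w := w) ε (by omega) F hFb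
    (fun u hu huw => by
      have h := hFu u hu
      obtain ⟨m, hm⟩ := Int.eq_negSucc_of_lt_zero (show (weight u : ℤ) - w < 0 by omega)
      rw [hm] at h
      exact (Submodule.mem_bot (ZMod 2)).1 h)
    (fun z hz hb hw => by
      subst hw
      obtain ⟨e, he1, he, he0⟩ := exists_orthogonal hA
      refine eq_zero_of_orthogonal ε F hFb 1 (fun u hu hun => ?_) e he1 he (fun i => ?_) hz hb
      · have h := hFu u hu
        rw [hun, sub_self] at h
        refine ⟨(F (Finsupp.single u 1)).fst, ?_⟩
        ext1
        · simp
        · simpa using mem_grading_zero.1 h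
      · intro h0
        rw [hφ, hφ, mul_one] at h0
        change DualBoolean.map V φ (((PositivePart.mono V 1 (e i) : PositivePart V A)) :
          DualBoolean V A) * DualBoolean.map V φ ((PositivePart.mono V 1 (e i) : PositivePart V A) :
          DualBoolean V A) = 0 at h0
        have h1 := congrArg (augmentation V B) h0
        rw [map_mul, augmentation_map_inr, character_mono, BooleanRing.mul_self, map_zero,
          map_eq_zero_iff φ hφi] at h1
        exact he0 i h1)
  refine exists_hochschildD_eq ε LinearMap.id hf hf1 hF hG (component V B) component_mem
    (fun j _ m hm => component_eq_self hm) fun j _ d p hp x => ?_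
  change (p : DualBoolean V A) • _ = component V B (j + d) ((p : DualBoolean V A) • x)
  rw [hφ, hφ]
  exact mul_component j (map_mem_grading φ (inr_mem_grading hp)) x

end BarWords

theorem subsingleton_gradedHH_zero {k Q M : Type*} [CommRing k] [CommRing Q] [Algebra k Q]
    [AddCommGroup M] [Module k M] [Module Q M] [IsScalarTower k Q M] (𝒬 : ℕ → Submodule k Q)
    (ℳ : ℕ → Submodule k M) {s : ℤ} (hs : s < 0) :
    Subsingleton (GradedHH 𝒬 (intGrading ℳ) 0 s) := by
  rw [Submodule.Quotient.subsingleton_iff, eq_top_iff]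
  rintro ⟨f, hf, -⟩ -
  change f = 0
  ext a
  have h := hf Fin.elim0 a fun i => i.elim0
  obtain ⟨m, rfl⟩ := Int.eq_negSucc_of_lt_zero hs
  rw [Fin.sum_univ_zero, zero_add] at h
  exact (Submodule.mem_bot k).1 h

theorem DualBoolean.map_id (V B : Type*) [AddCommGroup V] [Module (ZMod 2) V] [BooleanRing B]
    (q : DualBoolean V B) : DualBoolean.map V (RingHom.id B) q = q := by
  have h : DualBoolean.map V (RingHom.id B) = AlgHom.id (ZMod 2) (DualBoolean V B) := by
    refine Unitization.algHom_ext'' fun p => ?_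
    refine (DualBoolean.map_inr _ p).trans (congrArg _ ?_)
    refine Prod.ext rfl ?_
    change BooleanPart.map (RingHom.id B) p.2 = p.2
    induction p.2 using BooleanPart.induction_mono with
    | zero => exact map_zero _
    | add x y hx hy => rw [map_add, hx, hy]
    | mono n a => rw [BooleanPart.map_mono]; rfl
  rw [h]
  rfl

theorem theorem7p15 (V : Type*) [AddCommGroup V] [Module (ZMod 2) V] (B : Type*) [BooleanRing B] :
    (∀ A : Subring B, 8 ≤ #A → ∀ s : ℤ, s < 0 → ∀ k : ℕ, (k : ℤ) ≠ 1 - s →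
      Subsingleton
        (GradedHH (DualBoolean.grading V A) (intGrading (DualBoolean.grading V B)) k s)) ∧
    KadeishviliVanishing (DualBoolean.grading V B) := by
  refine ⟨fun A hA s hs k hk => ?_, fun n hn => ?_⟩
  · have hφ (q : DualBoolean V A) (m : DualBoolean V B) :
        q • m = DualBoolean.map V A.subtype q * m := Algebra.smul_def q m
    rcases Nat.eq_zero_or_pos k with rfl | hk0
    · exact subsingleton_gradedHH_zero _ _ hs
    · rcases lt_or_ge (1 : ℤ) (k + s) with h | h
      · obtain ⟨n, rfl⟩ : ∃ n, k = n + 3 := ⟨k - 3, by omega⟩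
        exact BarWords.subsingleton_of_two_le hφ n s (by push_cast at h; omega)
      · obtain ⟨n, rfl⟩ : ∃ n, k = n + 1 := ⟨k - 1, by omega⟩
        exact BarWords.subsingleton_of_nonpos A.subtype_injective hφ hA n s
          (by push_cast at h hk; omega)
  · obtain ⟨m, rfl⟩ : ∃ m, n = m + 3 := ⟨n - 3, by omega⟩
    exact BarWords.subsingleton_of_two_le (φ := RingHom.id B)
      (fun q m => by rw [DualBoolean.map_id, smul_eq_mul]) m _ (by push_cast; omega)
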